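/- **Setting.** Let $m,d\ge 0$ be integers. Fourier transforms are normalised as $\widehat f(\xi)=\int f(x)e^{-2\pi i x\cdot\xi}\,dx$. For an exponent $r\in[1,\infty]$ let $r'$ be the conjugate exponent, $1/r+1/r'=1$ (and $1/\infty=0$). A *weight* on $\mathbb R^N$ is a positive continuous function $v$ with $v(x+y)\le C\,w(x)v(y)$ for some constant $C$ and some continuous $w\ge 0$ that is submultiplicative ($w(x+y)\le C'w(x)w(y)$) and of at most polynomial growth. For $f\in\mathcal S'(\mathbb R^d)$ put $V_\phi f(t,\nu)=\int f(x)e^{-2\pi i x\cdot\nu}\phi(x-t)\,dx$ (read as the action of $f$ on a Schwartz function) with $\phi(x)=e^{-\|x\|^2}$. For a weight $w$ on $\mathbb R^{2d}$, $M^{p,q}_w$ is the space of all $f\in\mathcal S'(\mathbb R^d)$ with $$\|f\|_{M^{p,q}_w}=\Big(\int\Big(\int|w(t,\nu)V_\phi f(t,\nu)|^p\,dt\Big)^{q/p}d\nu\Big)^{1/q}<\infty .$$ Fix a window $g\in\mathcal S(\mathbb R^{(m+1)d})$, $g\ne0$. For $\sigma\in\mathcal S'(\mathbb R^{(m+1)d})$,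 $x,\nu\in\mathbb R^d$ and $\boldsymbol t,\boldsymbol\xi\in\mathbb R^{md}$ put $$\mathcal V_g\sigma(x,\boldsymbol t,\boldsymbol\xi,\nu)=\iint e^{-2\pi i(y\cdot\nu-\boldsymbol t\cdot\boldsymbol\eta)}\sigma(y,\boldsymbol\eta)\,g(y-x,\boldsymbol\eta-\boldsymbol\xi)\,dy\,d\boldsymbol\eta .$$ For a weight $v$ on $\mathbb R^{2(m+1)d}$ and exponents $r_0,\dots,r_m,s_1,\dots,s_{m+1}\in[1,\infty]$, let $\|\sigma\|_{\mathcal M_v}$ be the iterated mixed norm of $v\,\mathcal V_g\sigma$ taken (innermost first) with exponent $r_0$ in $x$, then $r_1,\dots,r_m$ in $t_1,\dots,t_m$, then $s_1,\dots,s_m$ in $\xi_1,\dots,\xi_m$, and finally $s_{m+1}$ in $\nu$ (the integration order given by the identity permutations $\kappa,\rho$). Let $\mathcal M_v=\mathcal M_v^{(r_0,\boldsymbol r);(\boldsymbol s,s_{m+1})}$ be the space of all $\sigma$ for which this norm is finite. (As usual, an infinite exponent means an essential supremum.) For $\sigma\in\mathcal S'(\mathbb R^{(m+1)d})$ and $f_1,\dots,f_m\in\mathcal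 S(\mathbb R^d)$ let $T_\sigma\boldsymbol f\in\mathcal S'(\mathbb R^d)$ be $$T_\sigma\boldsymbol f(x)=\int_{\mathbb R^{md}}e^{2\pi i x\cdot(\xi_1+\dots+\xi_m)}\sigma(x,\boldsymbol\xi)\widehat{f_1}(\xi_1)\cdots\widehat{f_m}(\xi_m)\,d\boldsymbol\xi,$$ in the weak sense: $T_\sigma\boldsymbol f$ applied to $\psi\in\mathcal S(\mathbb R^d)$ is $\sigma$ applied to $(x,\boldsymbol\xi)\mapsto e^{2\pi i x\cdot(\xi_1+\dots+\xi_m)}\widehat{f_1}(\xi_1)\cdots\widehat{f_m}(\xi_m)\psi(x)$. **Corollary 3.6.** Let $p_0,\dots,p_m,\ q_1,\dots,q_{m+1},\ r_0,\dots,r_m,\ s_1,\dots,s_{m+1}\in[1,\infty]$ satisfy $$r_0'\le p_1\le r_1'\le p_2\le\dots\le r_{m-1}'\le p_m\le r_m',\qquad s_1'\le q_1\le s_2'\le q_2\le\dots\le s_m'\le q_m\le s_{m+1}',$$ $$\frac1{r_0}+\sum_{\ell=1}^m\Big(\frac1{p_\ell}+\frac1{r_\ell}\Big)\ge m+\frac1{p_0},\qquad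 \frac1{s_{m+1}}+\sum_{\ell=1}^m\Big(\frac1{q_\ell}+\frac1{s_\ell}\Big)\ge m+\frac1{q_{m+1}} .$$ Let $v$ be a weight on $\mathbb R^{2(m+1)d}$ and $w_0,\dots,w_m$ weights on $\mathbb R^{2d}$ such that for all $x,\nu\in\mathbb R^d$ and $\boldsymbol t,\boldsymbol\xi\in\mathbb R^{md}$ $$v(x,\boldsymbol t,\boldsymbol\xi,\nu)^{-1}\le w_0(x,\nu+\xi_1+\dots+\xi_m)^{-1}\,w_1(x-t_1,\xi_1)\cdots w_m(x-t_m,\xi_m).$$ Then $\mathcal S(\mathbb R^d)\subset M^{p_k,q_k}_{w_k}$ for $k=1,\dots,m$, and there is a constant $C$, which does not depend on $\sigma$, such that for every $\sigma\in\mathcal M_v^{(r_0,\boldsymbol r);(\boldsymbol s,s_{m+1})}$ the operator $T_\sigma$, initially defined on $\mathcal S(\mathbb R^d)^m$, extends to a bounded multilinear operator $$T_\sigma:\ M^{p_1,q_1}_{w_1}\times\dots\times M^{p_m,q_m}_{w_m}\to M^{p_0,q_{m+1}}_{w_0}$$ satisfying, for all $f_k\in M^{p_k,q_k}_{w_k}$,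 $$\|T_\sigma\boldsymbol f\|_{M^{p_0,q_{m+1}}_{w_0}}\le C\,\|\sigma\|_{\mathcal M_v}\,\|f_1\|_{M^{p_1,q_1}_{w_1}}\cdots\|f_m\|_{M^{p_m,q_m}_{w_m}} .$$ -/

import Mathlib

open MeasureTheory
open scoped SchwartzMap ENNReal FourierTransform

namespace ModSpace

/-- The Euclidean space `ℝᵈ`. -/
abbrev Rd (d : ℕ) : Type := EuclideanSpace ℝ (Fin d)

/-- The space `ℝ^{(m+1)d}` of the symbol variables `(x, ξ₁, …, ξₘ)`; entry `0` is `x` and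
entry `k + 1` is `ξ_{k+1}`. -/
abbrev SymbolDomain (m d : ℕ) : Type := PiLp 2 (fun _ : Fin (m + 1) => Rd d)

section Schwartz

variable {V : Type} [NormedAddCommGroup V] [InnerProductSpace ℝ V]

lemma iteratedDeriv_cexp_mul_I (n : ℕ) :
    iteratedDeriv n (fun s : ℝ => Complex.exp (s * Complex.I)) =
      fun s : ℝ => Complex.I ^ n * Complex.exp (s * Complex.I) := by
  induction n with
  | zero => simp
  | succ n ih =>
    rw [iteratedDeriv_succ, ih]
    funext s
    have h : HasDerivAt (fun s : ℝ => Complex.exp (s * Complex.I))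
        (Complex.exp (s * Complex.I) * (1 * Complex.I)) s :=
      ((Complex.ofRealCLM.hasDerivAt (x := s)).mul_const Complex.I).cexp
    rw [(h.const_mul (Complex.I ^ n)).deriv]
    ring

lemma hasTemperateGrowth_cexp_mul_I :
    (fun s : ℝ => Complex.exp (s * Complex.I)).HasTemperateGrowth := by
  refine ⟨(Complex.ofRealCLM.contDiff.mul contDiff_const).cexp, fun n => ⟨0, 1, fun s => ?_⟩⟩
  rw [norm_iteratedFDeriv_eq_norm_iteratedDeriv, iteratedDeriv_cexp_mul_I]
  simp [Complex.norm_exp_ofReal_mul_I]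

/-- If `g` is real valued and of temperate growth, so is `e^{i g}`. -/
lemma hasTemperateGrowth_cexp_comp {g : V → ℝ} (hg : g.HasTemperateGrowth) :
    (fun x => Complex.exp (g x * Complex.I)).HasTemperateGrowth :=
  hasTemperateGrowth_cexp_mul_I.comp hg

/-- The Gaussian `x ↦ e^{-‖x‖²}` as a Schwartz function. -/
noncomputable def gaussian (V : Type) [NormedAddCommGroup V] [InnerProductSpace ℝ V] :
    𝓢(V, ℂ) where
  toFun x := ((Real.exp (-‖x‖ ^ 2) : ℝ) : ℂ)
  smooth' := by
    have h : ContDiff ℝ ((⊤ : ℕ∞) : WithTop ℕ∞) (fun x : V => Real.exp (-‖x‖ ^ 2)) :=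
      Real.contDiff_exp.comp (contDiff_norm_sq ℝ).neg
    exact Complex.ofRealCLM.contDiff.comp h
  decay' := by
    intro j n
    have hq : (fun x : V => -‖x‖ ^ 2).HasTemperateGrowth :=
      (Function.hasTemperateGrowth_norm_sq V).neg
    obtain ⟨k, C, hC0, hC⟩ := hq.norm_iteratedFDeriv_le_uniform n
    -- boundedness of a polynomial times the Gaussian
    obtain ⟨M, hM⟩ : ∃ M : ℝ, ∀ u : ℝ, 0 ≤ u → (1 + u) ^ (j + k * n) * Real.exp (-u ^ 2) ≤ M := by
      refine ⟨(Nat.factorial (j + k * n) : ℝ) * Real.exp 2, fun u hu => ?_⟩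
      have h1 : (1 + u) ^ (j + k * n) / (Nat.factorial (j + k * n) : ℝ) ≤ Real.exp (1 + u) :=
        Real.pow_div_factorial_le_exp (1 + u) (by linarith) _
      have h2 : Real.exp (1 + u) * Real.exp (-u ^ 2) ≤ Real.exp 2 := by
        rw [← Real.exp_add]
        apply Real.exp_le_exp.2
        nlinarith [sq_nonneg (u - 1)]
      have hpos : (0 : ℝ) < (Nat.factorial (j + k * n) : ℝ) := by exact_mod_cast Nat.factorial_pos _
      rw [div_le_iff₀ hpos] at h1
      calc (1 + u) ^ (j + k * n) * Real.exp (-u ^ 2)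
          ≤ (Real.exp (1 + u) * (Nat.factorial (j + k * n) : ℝ)) * Real.exp (-u ^ 2) := by gcongr
        _ = (Nat.factorial (j + k * n) : ℝ) * (Real.exp (1 + u) * Real.exp (-u ^ 2)) := by ring
        _ ≤ _ := by gcongr
    refine ⟨(Nat.factorial n : ℝ) * (C + 1) ^ n * M, fun x => ?_⟩
    have hcomp : ‖iteratedFDeriv ℝ n (fun x : V => ((Real.exp (-‖x‖ ^ 2) : ℝ) : ℂ)) x‖ ≤
        ‖iteratedFDeriv ℝ n (fun x : V => Real.exp (-‖x‖ ^ 2)) x‖ := by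
      have hs : ContDiff ℝ n (fun x : V => Real.exp (-‖x‖ ^ 2)) :=
        Real.contDiff_exp.comp (contDiff_norm_sq ℝ).neg
      have := Complex.ofRealCLM.norm_iteratedFDeriv_comp_left (x := x) hs.contDiffAt le_rfl
      simpa [Function.comp_def] using this
    have hexp : ‖iteratedFDeriv ℝ n (Real.exp ∘ fun x : V => -‖x‖ ^ 2) x‖ ≤
        (Nat.factorial n : ℝ) * Real.exp (-‖x‖ ^ 2) * ((C + 1) * (1 + ‖x‖) ^ k) ^ n := by
      refine norm_iteratedFDeriv_comp_le (N := n) Real.contDiff_exp (contDiff_norm_sq ℝ).neg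
        le_rfl x (fun i _ => ?_) (fun i hi1 hi => ?_)
      · rw [norm_iteratedFDeriv_eq_norm_iteratedDeriv, iteratedDeriv_eq_iterate,
          Real.iter_deriv_exp]
        simp
      · have h1 : (1 : ℝ) ≤ (C + 1) * (1 + ‖x‖) ^ k := by
          have : (1 : ℝ) ≤ (1 + ‖x‖) ^ k := one_le_pow₀ (by linarith [norm_nonneg x])
          nlinarith
        calc _ ≤ C * (1 + ‖x‖) ^ k := hC i hi x
          _ ≤ (C + 1) * (1 + ‖x‖) ^ k := by gcongr; linarith
          _ ≤ _ := le_self_pow₀ h1 (by omega)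
    have hx : ‖x‖ ^ j ≤ (1 + ‖x‖) ^ j := by gcongr; linarith
    calc ‖x‖ ^ j * ‖iteratedFDeriv ℝ n (fun x : V => ((Real.exp (-‖x‖ ^ 2) : ℝ) : ℂ)) x‖
        ≤ (1 + ‖x‖) ^ j * ((Nat.factorial n : ℝ) * Real.exp (-‖x‖ ^ 2) * ((C + 1) * (1 + ‖x‖) ^ k) ^ n) := by
          gcongr
          exact hcomp.trans hexp
      _ = (Nat.factorial n : ℝ) * (C + 1) ^ n * ((1 + ‖x‖) ^ (j + k * n) * Real.exp (-‖x‖ ^ 2)) := by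
          rw [mul_pow, pow_add, pow_mul]; ring
      _ ≤ _ := by gcongr; exact hM _ (norm_nonneg x)

@[simp] lemma gaussian_apply (x : V) :
    gaussian V x = ((Real.exp (-‖x‖ ^ 2) : ℝ) : ℂ) := rfl

/-- The Schwartz function `y ↦ e^{-2πi ⟨y, ζ⟩} φ(y - z)`. -/
noncomputable def tfShift (φ : 𝓢(V, ℂ)) (z ζ : V) : 𝓢(V, ℂ) :=
  SchwartzMap.smulLeftCLM ℂ (fun y : V =>
    Complex.exp (((-2 * Real.pi * inner ℝ y ζ : ℝ) : ℂ) * Complex.I))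
    (SchwartzMap.compSubConstCLM ℂ z φ)

lemma tfShift_apply (φ : 𝓢(V, ℂ)) (z ζ y : V) :
    tfShift φ z ζ y =
      Complex.exp (((-2 * Real.pi * inner ℝ y ζ : ℝ) : ℂ) * Complex.I) * φ (y - z) := by
  have h : (fun y : V => -2 * Real.pi * inner ℝ y ζ).HasTemperateGrowth := by fun_prop
  rw [tfShift, SchwartzMap.smulLeftCLM_apply_apply (hasTemperateGrowth_cexp_comp h)]
  simp

/-- The short-time Fourier transform
`V_φ f (z, ζ) = ∫ f(y) e^{-2πi ⟨y, ζ⟩} φ(y - z) dy` of a tempered distribution `f`. -/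
noncomputable def stft (φ : 𝓢(V, ℂ)) (f : 𝓢'(V, ℂ)) (z ζ : V) : ℂ := f (tfShift φ z ζ)

end Schwartz

section Weights

/-- Weight functions: positive continuous functions `v` that are moderate with respect to a
continuous submultiplicative control weight `w` of polynomial growth, that is
`v (x + y) ≤ C w(x) v(y)`, where `w (x + y) ≤ C w(x) w(y)`. -/
structure IsWeight {G : Type*} [NormedAddCommGroup G] (v : G → ℝ) : Prop where
  continuous : Continuous v
  pos : ∀ x, 0 < v x
  moderate : ∃ w : G → ℝ, Continuous w ∧ (∀ x, 0 ≤ w x) ∧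
    (∃ C : ℝ, ∀ x y, w (x + y) ≤ C * w x * w y) ∧
    (∃ (C : ℝ) (N : ℕ), ∀ x, w x ≤ C * (1 + ‖x‖) ^ N) ∧
    ∃ C : ℝ, ∀ x y, v (x + y) ≤ C * w x * v y

end Weights

section ModulationSpace

variable {d : ℕ}

/-- The mixed norm `(∫ (∫ |F(t, ν)|^p dt)^{q/p} dν)^{1/q}`, with essential suprema for infinite
exponents. -/
noncomputable def mixedNorm₂ (p q : ℝ≥0∞) (F : Rd d × Rd d → ℂ) : ℝ≥0∞ :=
  eLpNorm (fun ν => eLpNorm (fun t => F (t, ν)) p volume) q volume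

/-- The short-time Fourier transform with Gaussian window, times the weight `w`. -/
noncomputable def weightedStft (w : Rd d × Rd d → ℝ) (f : 𝓢'(Rd d, ℂ)) (z : Rd d × Rd d) : ℂ :=
  (w z : ℂ) * stft (gaussian (Rd d)) f z.1 z.2

/-- The norm of the weighted modulation space `M^{p,q}_w(ℝᵈ)`, as an extended number. -/
noncomputable def modNorm (p q : ℝ≥0∞) (w : Rd d × Rd d → ℝ) (f : 𝓢'(Rd d, ℂ)) : ℝ≥0∞ :=
  mixedNorm₂ p q (weightedStft w f)

lemma weightedStft_add (w : Rd d × Rd d → ℝ) (f g : 𝓢'(Rd d, ℂ)) :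
    weightedStft w (f + g) = weightedStft w f + weightedStft w g := by
  funext z
  simp [weightedStft, stft, mul_add]

lemma weightedStft_smul (w : Rd d × Rd d → ℝ) (c : ℂ) (f : 𝓢'(Rd d, ℂ)) :
    weightedStft w (c • f) = c • weightedStft w f := by
  funext z
  simp [weightedStft, stft]
  ring

lemma measurable_eLpNorm_slice (p : ℝ≥0∞) {F : Rd d × Rd d → ℂ} (hF : Measurable F) :
    Measurable (fun ν => eLpNorm (fun t => F (t, ν)) p (volume : Measure (Rd d))) := by
  rcases eq_or_ne p 0 with rfl | hp0
  · simp
  rcases eq_or_ne p ∞ with rfl | hp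
  · simp only [eLpNorm_exponent_top, eLpNormEssSup]
    refine measurable_of_Iic fun a => ?_
    have : (fun ν => essSup (fun t => ‖F (t, ν)‖ₑ) (volume : Measure (Rd d))) ⁻¹' Set.Iic a =
        {ν | (volume : Measure (Rd d)) ((fun t => (t, ν)) ⁻¹' {z | a < ‖F z‖ₑ}) = 0} := by
      ext ν
      simp only [Set.mem_preimage, Set.mem_Iic, Set.mem_ofPred_eq]
      constructor
      · intro h
        have h2 : ∀ᵐ t ∂(volume : Measure (Rd d)), ‖F (t, ν)‖ₑ ≤ a :=
          (ENNReal.ae_le_essSup _).mono fun t ht => ht.trans h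
        simpa [ae_iff, not_le] using h2
      · intro h
        refine essSup_le_of_ae_le a ?_
        have : ∀ᵐ t ∂(volume : Measure (Rd d)), ‖F (t, ν)‖ₑ ≤ a := by
          simpa [ae_iff, not_le] using h
        exact this
    rw [this]
    have hs : MeasurableSet {z : Rd d × Rd d | a < ‖F z‖ₑ} :=
      measurableSet_lt measurable_const hF.enorm
    exact measurable_measure_prodMk_right hs (measurableSet_singleton 0)
  · simp only [eLpNorm_eq_lintegral_rpow_enorm_toReal hp0 hp]
    have h : Measurable (fun z : Rd d × Rd d => ‖F z‖ₑ ^ p.toReal) := hF.enorm.pow_const _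
    exact (Measurable.lintegral_prod_left' h).pow_const _

lemma mixedNorm₂_add_lt_top {p q : ℝ≥0∞} {F G : Rd d × Rd d → ℂ} (hF : Measurable F)
    (hG : Measurable G) (h1 : mixedNorm₂ p q F < ∞) (h2 : mixedNorm₂ p q G < ∞) :
    mixedNorm₂ p q (F + G) < ∞ := by
  have mF := measurable_eLpNorm_slice p hF
  have mG := measurable_eLpNorm_slice p hG
  have hle : ∀ ν, eLpNorm (fun t => (F + G) (t, ν)) p (volume : Measure (Rd d)) ≤
      (ENNReal.LpAddConst p).toNNReal * (eLpNorm (fun t => F (t, ν)) p volume +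
        eLpNorm (fun t => G (t, ν)) p volume) := by
    intro ν
    rw [ENNReal.coe_toNNReal (ENNReal.LpAddConst_lt_top p).ne]
    exact eLpNorm_add_le' (hF.comp measurable_prodMk_right).aestronglyMeasurable
      (hG.comp measurable_prodMk_right).aestronglyMeasurable p
  have hsum : eLpNorm ((fun ν => eLpNorm (fun t => F (t, ν)) p (volume : Measure (Rd d))) +
      (fun ν => eLpNorm (fun t => G (t, ν)) p (volume : Measure (Rd d)))) q volume < ∞ :=
    eLpNorm_add_lt_top ⟨mF.aestronglyMeasurable, h1⟩ ⟨mG.aestronglyMeasurable, h2⟩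
  refine lt_of_le_of_lt (eLpNorm_le_nnreal_smul_eLpNorm_of_ae_le_mul'
    (c := (ENNReal.LpAddConst p).toNNReal)
    (g := (fun ν => eLpNorm (fun t => F (t, ν)) p (volume : Measure (Rd d))) +
      (fun ν => eLpNorm (fun t => G (t, ν)) p (volume : Measure (Rd d))))
    (Filter.Eventually.of_forall fun ν => ?_) q) (ENNReal.mul_lt_top ENNReal.coe_lt_top hsum)
  simpa only [enorm_eq_self, Pi.add_apply] using hle ν

lemma mixedNorm₂_smul_lt_top {p q : ℝ≥0∞} {F : Rd d × Rd d → ℂ} (c : ℂ)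
    (h1 : mixedNorm₂ p q F < ∞) : mixedNorm₂ p q (c • F) < ∞ := by
  refine lt_of_le_of_lt (eLpNorm_le_nnreal_smul_eLpNorm_of_ae_le_mul'
    (c := ‖c‖₊) (g := fun ν => eLpNorm (fun t => F (t, ν)) p (volume : Measure (Rd d)))
    (Filter.Eventually.of_forall fun ν => ?_) q) (ENNReal.mul_lt_top ENNReal.coe_lt_top h1)
  simp only [enorm_eq_self]
  exact (eLpNorm_const_smul c (fun t => F (t, ν)) p volume).le

/-- The weighted modulation space `M^{p,q}_w(ℝᵈ)`: the tempered distributions `f` for which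
`w · V_φ f`, with `φ` the Gaussian, belongs to the mixed norm space `L^{p,q}`. -/
noncomputable def modulationSpace (p q : ℝ≥0∞) (w : Rd d × Rd d → ℝ) :
    Submodule ℂ 𝓢'(Rd d, ℂ) where
  carrier := {f | Measurable (weightedStft w f) ∧ modNorm p q w f < ∞}
  zero_mem' := by
    have : weightedStft w (0 : 𝓢'(Rd d, ℂ)) = 0 := by
      funext z; simp [weightedStft, stft]
    refine ⟨by rw [this]; exact measurable_const, ?_⟩
    simp [modNorm, mixedNorm₂, this]
  add_mem' := by
    rintro f g ⟨hf, hf'⟩ ⟨hg, hg'⟩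
    refine ⟨by rw [weightedStft_add]; exact hf.add hg, ?_⟩
    rw [modNorm, weightedStft_add]
    exact mixedNorm₂_add_lt_top hf hg hf' hg'
  smul_mem' := by
    rintro c f ⟨hf, hf'⟩
    refine ⟨by rw [weightedStft_smul]; exact hf.const_smul c, ?_⟩
    rw [modNorm, weightedStft_smul]
    exact mixedNorm₂_smul_lt_top c hf'

end ModulationSpace

section Operators

variable {m d : ℕ}

lemma one_add_norm_le_prod (z : SymbolDomain m d) :
    1 + ‖z‖ ≤ ∏ j, (1 + ‖z j‖) := by
  have h1 : ‖z‖ ≤ ∑ j, ‖z j‖ := by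
    have hz : z = ∑ j, PiLp.single 2 j (z j) := by
      ext j : 1
      simp [Pi.single_apply]
    calc ‖z‖ = ‖∑ j, PiLp.single 2 j (z j)‖ := by rw [← hz]
      _ ≤ ∑ j, ‖(PiLp.single 2 j (z j) : SymbolDomain m d)‖ := norm_sum_le _ _
      _ = ∑ j, ‖z j‖ := by simp
  have h2 : ∀ s : Finset (Fin (m + 1)), 1 + ∑ j ∈ s, ‖z j‖ ≤ ∏ j ∈ s, (1 + ‖z j‖) := by
    intro s
    induction s using Finset.induction_on with
    | empty => simp
    | insert a s ha ih =>
      rw [Finset.sum_insert ha, Finset.prod_insert ha]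
      have h3 : 0 ≤ ∑ j ∈ s, ‖z j‖ := Finset.sum_nonneg fun _ _ => norm_nonneg _
      nlinarith [norm_nonneg (z a)]
  linarith [h2 Finset.univ]

/-- The elementary tensor `z ↦ ∏ⱼ fⱼ(zⱼ)`. -/
noncomputable def tensorFun (f : Fin (m + 1) → 𝓢(Rd d, ℂ)) (z : SymbolDomain m d) : ℂ := ∏ j, f j (z j)

lemma contDiff_tensor_factor (f : 𝓢(Rd d, ℂ)) (j : Fin (m + 1)) :
    ContDiff ℝ ((⊤ : ℕ∞) : WithTop ℕ∞) (fun z : SymbolDomain m d => f (z j)) :=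
  (f.smooth ⊤).comp (PiLp.proj (𝕜 := ℝ) 2 (fun _ : Fin (m + 1) => Rd d) j).contDiff

lemma contDiff_tensorFun (f : Fin (m + 1) → 𝓢(Rd d, ℂ)) :
    ContDiff ℝ ((⊤ : ℕ∞) : WithTop ℕ∞) (tensorFun f) :=
  contDiff_prod fun j _ => contDiff_tensor_factor (f j) j

lemma norm_iteratedFDeriv_tensor_factor_le (f : 𝓢(Rd d, ℂ)) (j : Fin (m + 1)) (i : ℕ)
    (z : SymbolDomain m d) :
    ‖iteratedFDeriv ℝ i (fun z : SymbolDomain m d => f (z j)) z‖ ≤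
      ‖iteratedFDeriv ℝ i f (z j)‖ := by
  have h := (PiLp.proj (𝕜 := ℝ) 2 (fun _ : Fin (m + 1) => Rd d) j).iteratedFDeriv_comp_right
    (f.smooth ⊤) z (i := i) (by exact_mod_cast le_top)
  have hP : ‖PiLp.proj (𝕜 := ℝ) 2 (fun _ : Fin (m + 1) => Rd d) j‖ ≤ 1 :=
    ContinuousLinearMap.opNorm_le_bound _ zero_le_one fun x => by
      simpa using PiLp.norm_apply_le x j
  have h' : iteratedFDeriv ℝ i (fun z : SymbolDomain m d => f (z j)) z = _ := h
  rw [h']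
  refine (ContinuousMultilinearMap.norm_compContinuousLinearMap_le _ _).trans ?_
  refine mul_le_of_le_one_right (norm_nonneg _) ?_
  exact Finset.prod_le_one (fun _ _ => norm_nonneg _) fun _ _ => hP

lemma tensorFun_bound (k n : ℕ) : ∃ C : ℝ, 0 ≤ C ∧ ∀ (f : Fin (m + 1) → 𝓢(Rd d, ℂ))
    (z : SymbolDomain m d), ‖z‖ ^ k * ‖iteratedFDeriv ℝ n (tensorFun f) z‖ ≤
      C * ∏ j, (Finset.Iic (k, n)).sup (schwartzSeminormFamily ℂ (Rd d) ℂ) (f j) := by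
  refine ⟨(∑ p ∈ (Finset.univ : Finset (Fin (m + 1))).sym n,
    ((p : Multiset (Fin (m + 1))).countPerms : ℝ)) * (2 ^ k) ^ (m + 1), by positivity,
    fun f z => ?_⟩
  have hL : ‖iteratedFDeriv ℝ n (tensorFun f) z‖ ≤
      ∑ p ∈ (Finset.univ : Finset (Fin (m + 1))).sym n,
        ((p : Multiset (Fin (m + 1))).countPerms : ℝ) *
        ∏ j, ‖iteratedFDeriv ℝ ((p : Multiset (Fin (m + 1))).count j)
          (fun z : SymbolDomain m d => f j (z j)) z‖ :=
    norm_iteratedFDeriv_prod_le (fun j _ => contDiff_tensor_factor (f j) j)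
      (by exact_mod_cast le_top)
  have hz : ‖z‖ ^ k ≤ ∏ j, (1 + ‖z j‖) ^ k := by
    rw [Finset.prod_pow]
    exact pow_le_pow_left₀ (norm_nonneg _) ((by linarith : ‖z‖ ≤ 1 + ‖z‖).trans
      (one_add_norm_le_prod z)) k
  calc ‖z‖ ^ k * ‖iteratedFDeriv ℝ n (tensorFun f) z‖
      ≤ (∏ j, (1 + ‖z j‖) ^ k) * ∑ p ∈ (Finset.univ : Finset (Fin (m + 1))).sym n,
        ((p : Multiset (Fin (m + 1))).countPerms : ℝ) *
        ∏ j, ‖iteratedFDeriv ℝ ((p : Multiset (Fin (m + 1))).count j)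
          (fun z : SymbolDomain m d => f j (z j)) z‖ := by gcongr
    _ = ∑ p ∈ (Finset.univ : Finset (Fin (m + 1))).sym n,
        ((p : Multiset (Fin (m + 1))).countPerms : ℝ) *
        ∏ j, ((1 + ‖z j‖) ^ k * ‖iteratedFDeriv ℝ ((p : Multiset (Fin (m + 1))).count j)
          (fun z : SymbolDomain m d => f j (z j)) z‖) := by
        rw [Finset.mul_sum]
        refine Finset.sum_congr rfl fun p _ => ?_
        rw [Finset.prod_mul_distrib]
        ring
    _ ≤ ∑ p ∈ (Finset.univ : Finset (Fin (m + 1))).sym n,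
        ((p : Multiset (Fin (m + 1))).countPerms : ℝ) *
        ∏ j, (2 ^ k * (Finset.Iic (k, n)).sup (schwartzSeminormFamily ℂ (Rd d) ℂ) (f j)) := by
        refine Finset.sum_le_sum fun p hp => mul_le_mul_of_nonneg_left ?_ (by positivity)
        refine Finset.prod_le_prod (fun _ _ => by positivity) fun j _ => ?_
        refine (mul_le_mul_of_nonneg_left (norm_iteratedFDeriv_tensor_factor_le (f j) j _ z)
          (by positivity)).trans ?_
        have hcount : (p : Multiset (Fin (m + 1))).count j ≤ n :=
          (Multiset.count_le_card j _).trans_eq p.2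
        exact SchwartzMap.one_add_le_sup_seminorm_apply (𝕜 := ℂ) (m := (k, n)) le_rfl hcount
          (f j) (z j)
    _ = _ := by
        rw [← Finset.sum_mul, Finset.prod_mul_distrib]
        simp [mul_assoc]

/-- For Schwartz functions `g₁, …, gₘ`, the continuous linear map taking `ψ` to the Schwartz
function `(x, ξ) ↦ ψ(x) g₁(ξ₁) ⋯ gₘ(ξₘ)`. -/
noncomputable def tensorCLM (g : Fin m → 𝓢(Rd d, ℂ)) :
    𝓢(Rd d, ℂ) →L[ℂ] 𝓢(SymbolDomain m d, ℂ) :=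
  SchwartzMap.mkCLM (σ := RingHom.id ℂ)
    (fun ψ => tensorFun (Fin.cons ψ g : Fin (m + 1) → 𝓢(Rd d, ℂ)))
    (fun ψ₁ ψ₂ z => by simp [tensorFun, Fin.prod_univ_succ, add_mul])
    (fun a ψ z => by simp [tensorFun, Fin.prod_univ_succ, mul_assoc])
    (fun ψ => contDiff_tensorFun _)
    (by
      rintro ⟨k, n⟩
      obtain ⟨C, hC0, hC⟩ := tensorFun_bound (m := m) (d := d) k n
      refine ⟨Finset.Iic (k, n), C * ∏ j, (Finset.Iic (k, n)).sup
        (schwartzSeminormFamily ℂ (Rd d) ℂ) (g j),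
        mul_nonneg hC0 (Finset.prod_nonneg fun _ _ => apply_nonneg _ _), fun ψ z => ?_⟩
      refine (hC _ z).trans_eq ?_
      rw [Fin.prod_univ_succ]
      simp only [Fin.cons_zero, Fin.cons_succ]
      ring)

lemma tensorCLM_apply (g : Fin m → 𝓢(Rd d, ℂ)) (ψ : 𝓢(Rd d, ℂ)) (z : SymbolDomain m d) :
    tensorCLM g ψ z = ψ (z 0) * ∏ k : Fin m, g k (z k.succ) := by
  change tensorFun (Fin.cons ψ g : Fin (m + 1) → 𝓢(Rd d, ℂ)) z = _
  simp [tensorFun, Fin.prod_univ_succ]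

/-- The map taking `ψ` to the Schwartz function
`(x, ξ) ↦ e^{2πi x·(ξ₁ + ⋯ + ξₘ)} f̂₁(ξ₁) ⋯ f̂ₘ(ξₘ) ψ(x)`, that is, to the Rihaczek transform
`R(f, g)` of `f = (f₁, …, fₘ)` and `g`, where `ψ` is the complex conjugate of `g`. -/
noncomputable def rihaczek (f : Fin m → 𝓢(Rd d, ℂ)) :
    𝓢(Rd d, ℂ) →L[ℂ] 𝓢(SymbolDomain m d, ℂ) :=
  (SchwartzMap.smulLeftCLM ℂ (fun z : SymbolDomain m d =>
    Complex.exp (((2 * Real.pi * inner ℝ (z 0) (∑ k : Fin m, z k.succ) : ℝ) : ℂ) * Complex.I)))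
  ∘L tensorCLM (fun k => 𝓕 (f k))

lemma rihaczek_apply (f : Fin m → 𝓢(Rd d, ℂ)) (ψ : 𝓢(Rd d, ℂ)) (z : SymbolDomain m d) :
    rihaczek f ψ z =
      Complex.exp (((2 * Real.pi * inner ℝ (z 0) (∑ k : Fin m, z k.succ) : ℝ) : ℂ) * Complex.I) *
        (ψ (z 0) * ∏ k : Fin m, 𝓕 (f k : Rd d → ℂ) (z k.succ)) := by
  have hp : ∀ j : Fin (m + 1), (fun z : SymbolDomain m d => z j).HasTemperateGrowth := fun j =>
    (PiLp.proj (𝕜 := ℝ) 2 (fun _ : Fin (m + 1) => Rd d) j).hasTemperateGrowth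
  have hi : (fun z : SymbolDomain m d =>
      inner ℝ (z 0) (∑ k : Fin m, z k.succ)).HasTemperateGrowth :=
    (innerSL ℝ).bilinear_hasTemperateGrowth (hp 0)
      (Function.HasTemperateGrowth.sum fun k _ => hp k.succ)
  have h : (fun z : SymbolDomain m d =>
      2 * Real.pi * inner ℝ (z 0) (∑ k : Fin m, z k.succ)).HasTemperateGrowth :=
    (Function.HasTemperateGrowth.const (2 * Real.pi)).mul hi
  rw [rihaczek, ContinuousLinearMap.comp_apply,
    SchwartzMap.smulLeftCLM_apply_apply (hasTemperateGrowth_cexp_comp h), tensorCLM_apply]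
  simp [SchwartzMap.fourier_coe]

/-- The multilinear pseudodifferential operator `T_σ` with symbol `σ ∈ 𝓢'(ℝ^{(m+1)d})` on
Schwartz functions, as a tempered distribution: `⟨T_σ f, ψ⟩` is the pairing of `σ` with
`(x, ξ) ↦ e^{2πi x·(ξ₁ + ⋯ + ξₘ)} f̂₁(ξ₁) ⋯ f̂ₘ(ξₘ) ψ(x)`, which is the weak form of
`T_σ f (x) = ∫ e^{2πi x·(ξ₁ + ⋯ + ξₘ)} σ(x, ξ) f̂₁(ξ₁) ⋯ f̂ₘ(ξₘ) dξ`. -/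
noncomputable def pseudoDiffOp (σ : 𝓢'(SymbolDomain m d, ℂ)) (f : Fin m → 𝓢(Rd d, ℂ)) :
    𝓢'(Rd d, ℂ) :=
  PointwiseConvergenceCLM.precomp ℂ (rihaczek f) σ

lemma pseudoDiffOp_apply (σ : 𝓢'(SymbolDomain m d, ℂ)) (f : Fin m → 𝓢(Rd d, ℂ))
    (ψ : 𝓢(Rd d, ℂ)) : pseudoDiffOp σ f ψ = σ (rihaczek f ψ) := rfl

end Operators

section SymbolClasses

variable {m d : ℕ}

/-- Iterated mixed norm of a function of `n` variables in `ℝᵈ`: the `L^{r 0}` norm in the first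
variable is taken first (innermost), the `L^{r (n-1)}` norm in the last variable last. -/
noncomputable def iteratedNorm : (n : ℕ) → (Fin n → ℝ≥0∞) → ((Fin n → Rd d) → ℝ≥0∞) → ℝ≥0∞
  | 0, _, F => F Fin.elim0
  | n + 1, r, F => iteratedNorm n (fun k => r k.succ)
      (fun y => eLpNorm (fun x : Rd d => F (Fin.cons x y)) (r 0) volume)

/-- Mixed norm with order of integration given by the permutation `κ`: the variable with index
`κ 0` is integrated first, with exponent `r (κ 0)`, then the one with index `κ 1`, and so on. -/
noncomputable def permutedNorm {n : ℕ} (r : Fin n → ℝ≥0∞) (κ : Equiv.Perm (Fin n))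
    (F : (Fin n → Rd d) → ℝ≥0∞) : ℝ≥0∞ :=
  iteratedNorm n (fun k => r (κ k)) (fun y => F (fun k => y (κ.symm k)))

/-- The symbol short-time Fourier transform with window `g`,
`∫∫ e^{-2πi (y·ν - t·η)} σ(y, η) g(y - x, η - ξ) dy dη`,
at the time variables `a = (x, t₁, …, tₘ)` and the frequency variables `b = (ξ₁, …, ξₘ, ν)`;
it is the short-time Fourier transform at the point `((x, ξ), (ν, -t))`. -/
noncomputable def symbolStft (g : 𝓢(SymbolDomain m d, ℂ)) (σ : 𝓢'(SymbolDomain m d, ℂ))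
    (a b : Fin (m + 1) → Rd d) : ℂ :=
  stft g σ
    (WithLp.toLp 2 (Fin.cons (a 0) (fun k : Fin m => b k.castSucc) : Fin (m + 1) → Rd d))
    (WithLp.toLp 2 (Fin.cons (b (Fin.last m)) (fun k : Fin m => -a k.succ) : Fin (m + 1) → Rd d))

/-- The norm of the symbol modulation space `𝓜_v^{(r₀, r), κ; (s, s_{m+1}), ρ}`, with window `g`.
The entries of `r` are `r₀, r₁, …, rₘ` and those of `s` are `s₁, …, s_{m+1}`; the time variables
are integrated first, in the order `κ`, and then the frequency variables, in the order `ρ`. -/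
noncomputable def symbolNorm (g : 𝓢(SymbolDomain m d, ℂ)) (r s : Fin (m + 1) → ℝ≥0∞)
    (κ ρ : Equiv.Perm (Fin (m + 1))) (v : (Fin (m + 1) → Rd d) × (Fin (m + 1) → Rd d) → ℝ)
    (σ : 𝓢'(SymbolDomain m d, ℂ)) : ℝ≥0∞ :=
  permutedNorm s ρ (fun b => permutedNorm r κ (fun a => ‖(v (a, b) : ℂ) * symbolStft g σ a b‖ₑ))

/-- The symbol modulation space `𝓜_v^{(r₀, r), κ; (s, s_{m+1}), ρ}(ℝ^{(m+1)d})`. -/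
def symbolModulationSpace (g : 𝓢(SymbolDomain m d, ℂ)) (r s : Fin (m + 1) → ℝ≥0∞)
    (κ ρ : Equiv.Perm (Fin (m + 1))) (v : (Fin (m + 1) → Rd d) × (Fin (m + 1) → Rd d) → ℝ) :
    Set 𝓢'(SymbolDomain m d, ℂ) :=
  {σ | Measurable (fun z : (Fin (m + 1) → Rd d) × (Fin (m + 1) → Rd d) =>
      (v z : ℂ) * symbolStft g σ z.1 z.2) ∧ symbolNorm g r s κ ρ v σ < ∞}

end SymbolClasses

end ModSpace

open ModSpace

/-! The weak definition of `T_σ` pairs `σ` with the Schwartz function `rihaczek f ψ`. The inversion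
formula `stft_inversion` turns this pairing into an integral of `V_g σ` against the short-time
Fourier transform of `rihaczek f ψ`, for any dual window `γ` with `∫ g γ ≠ 0`. For `γ` take
`rihaczekWindow`, built from Gaussians: its quadratic phase cancels that of the Rihaczek transform.
Up to a unimodular factor the transform then splits into a product of `V_φ ψ` and the `V_φ f_k`.
Since `g` is arbitrary, `γ` may be orthogonal to it. But `γ` vanishes nowhere, so some modulation of
`γ` is not; its only effect is a fixed translation `B₀`, `B` of the arguments. This is
`exists_pairing_eq_integral`.

The resulting integral makes sense for all `f_k` in the modulation spaces, and it is used as the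
definition of the extension. No density argument is needed, so infinite exponents cause no trouble.

For the bound, test against time-frequency shifts of the Gaussian. The weight condition distributes
`1/v` over the factors. What remains is a convolution of `H = symbolTransform F f` with a rapidly
decaying kernel, where `F = |v V_g σ|` and the `f_k` stand for the translated moduli `|w_k V_φ
f_k|`. With `ω = ν + ξ₁ + ⋯ + ξₘ`, `H` is a multilinear convolution in the time variables and
another in the frequency variables. Each is estimated by induction on `m`, one variable at a time,
with the mixed-norm Young inequality `eLpNorm_lintegral_mul_comp_sub_le`. The chains of inequalities
between the exponents are exactly what keeps each such step admissible.

The scaling conditions on the exponents are only inequalities. `H` is therefore bounded in `L^{a,b}`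
with `a`, `b` fixed by the corresponding equalities, so that `a ≤ p₀` and `b ≤ q_{m+1}`. A last
Young inequality with the decaying kernel, which lies in every `L^e` with `e ≥ 1`, passes to the
target exponents. -/

namespace ModSpace

/-! ### Hölder and Minkowski inequalities for `[0,∞]`-valued functions -/

section MixedLp

variable {α β : Type*} [MeasurableSpace α] [MeasurableSpace β] {μ : Measure α} {ν : Measure β}

/-- For finite `p` this is Tonelli. For `p = ∞`, the essential supremum is at most `a` exactly where
the section of `{F > a}` is null, and the measure of sections is measurable. -/
lemma measurable_eLpNorm_right [SFinite μ] (p : ℝ≥0∞) {F : α → β → ℝ≥0∞}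
    (hF : Measurable (Function.uncurry F)) :
    Measurable (fun y => eLpNorm (fun x => F x y) p μ) := by
  rcases eq_or_ne p 0 with rfl | hp0
  · simp
  rcases eq_or_ne p ∞ with rfl | hp
  · simp only [eLpNorm_exponent_top, eLpNormEssSup, enorm_eq_self]
    refine measurable_of_Iic fun a => ?_
    have : (fun y => essSup (fun x => F x y) μ) ⁻¹' Set.Iic a =
        {y | μ ((fun x => (x, y)) ⁻¹' {z | a < Function.uncurry F z}) = 0} := by
      ext y
      simp only [Set.mem_preimage, Set.mem_Iic, Set.mem_ofPred_eq]
      constructor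
      · intro h
        have h2 : ∀ᵐ x ∂μ, F x y ≤ a := (ENNReal.ae_le_essSup _).mono fun t ht => ht.trans h
        simpa [ae_iff, not_le] using h2
      · intro h
        refine essSup_le_of_ae_le a ?_
        have : ∀ᵐ x ∂μ, F x y ≤ a := by simpa [ae_iff, not_le] using h
        exact this
    rw [this]
    exact measurable_measure_prodMk_right (measurableSet_lt measurable_const hF)
      (measurableSet_singleton 0)
  · simp only [eLpNorm_eq_lintegral_rpow_enorm_toReal hp0 hp, enorm_eq_self]
    have h : Measurable (fun z : α × β => F z.1 z.2 ^ p.toReal) := by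
      have : Measurable (fun z : α × β => F z.1 z.2) := hF
      exact this.pow_const _
    exact (Measurable.lintegral_prod_left' h).pow_const _

lemma measurable_eLpNorm_left [SFinite ν] (p : ℝ≥0∞) {F : α → β → ℝ≥0∞}
    (hF : Measurable (Function.uncurry F)) :
    Measurable (fun x => eLpNorm (F x) p ν) :=
  measurable_eLpNorm_right (F := fun y x => F x y) p (hF.comp measurable_swap)

lemma eLpNorm_mono_ennreal {p : ℝ≥0∞} {f g : α → ℝ≥0∞} (h : ∀ x, f x ≤ g x) :
    eLpNorm f p μ ≤ eLpNorm g p μ :=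
  eLpNorm_mono_enorm (by simpa using h)

lemma eLpNorm_mono_ae_ennreal {p : ℝ≥0∞} {f g : α → ℝ≥0∞} (h : ∀ᵐ x ∂μ, f x ≤ g x) :
    eLpNorm f p μ ≤ eLpNorm g p μ :=
  eLpNorm_mono_enorm_ae (by simpa using h)

lemma eLpNorm_const_mul_ennreal_le {p : ℝ≥0∞} {c : ℝ≥0∞} (hc : c ≠ ∞) (f : α → ℝ≥0∞) :
    eLpNorm (fun x => c * f x) p μ ≤ c * eLpNorm f p μ := by
  lift c to NNReal using hc
  have := eLpNorm_le_nnreal_smul_eLpNorm_of_ae_le_mul' (μ := μ) (f := fun x => c * f x) (g := f)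
    (c := c) (Filter.Eventually.of_forall fun x => by simp) p
  simpa [ENNReal.smul_def] using this

lemma eLpNorm_const_mul_ennreal {p : ℝ≥0∞} {c : ℝ≥0∞} (hc : c ≠ ∞) (f : α → ℝ≥0∞) :
    eLpNorm (fun x => c * f x) p μ = c * eLpNorm f p μ := by
  refine le_antisymm (eLpNorm_const_mul_ennreal_le hc f) ?_
  rcases eq_or_ne c 0 with rfl | h0
  · simp
  have h := eLpNorm_const_mul_ennreal_le (μ := μ) (p := p) (c := c⁻¹) (by simpa using h0)
    (fun x => c * f x)
  simp only [← mul_assoc, ENNReal.inv_mul_cancel h0 hc, one_mul] at h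
  calc c * eLpNorm f p μ ≤ c * (c⁻¹ * eLpNorm (fun x => c * f x) p μ) := by gcongr
    _ = _ := by rw [← mul_assoc, ENNReal.mul_inv_cancel h0 hc, one_mul]

lemma ae_le_eLpNorm_top (f : α → ℝ≥0∞) : ∀ᵐ x ∂μ, f x ≤ eLpNorm f ∞ μ := by
  simpa [eLpNorm_exponent_top, eLpNormEssSup] using ENNReal.ae_le_essSup f

lemma eLpNorm_top_le_of_ae_le {f : α → ℝ≥0∞} {c : ℝ≥0∞} (h : ∀ᵐ x ∂μ, f x ≤ c) :
    eLpNorm f ∞ μ ≤ c := by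
  simpa [eLpNorm_exponent_top, eLpNormEssSup] using essSup_le_of_ae_le c h

/-- The delicate case is `∞ * 0` on the right. There `g` vanishes almost everywhere, hence so does
the product; measurability of `g` serves only this case. -/
lemma eLpNorm_top_mul_le {p : ℝ≥0∞} {f g : α → ℝ≥0∞} (hg : Measurable g) :
    eLpNorm (fun x => f x * g x) p μ ≤ eLpNorm f ∞ μ * eLpNorm g p μ := by
  rcases eq_or_ne (eLpNorm f ∞ μ) ∞ with h | h
  · rcases eq_or_ne p 0 with rfl | hp0
    · simp
    by_cases h0 : eLpNorm g p μ = 0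
    · have hg0 := (eLpNorm_eq_zero_iff hg.aestronglyMeasurable hp0).1 h0
      rw [eLpNorm_congr_ae (g := 0)]
      · simp
      · filter_upwards [hg0] with x hx
        simp [hx]
    · rw [h, ENNReal.top_mul h0]; exact le_top
  · refine le_trans (eLpNorm_mono_ae_ennreal ?_) (eLpNorm_const_mul_ennreal_le h g)
    filter_upwards [ae_le_eLpNorm_top (μ := μ) f] with x hx
    gcongr

/-- Unlike `eLpNorm_const_mul_ennreal_le`, this allows `c = ∞`, as happens when norms of other
factors play the role of constants. -/
lemma eLpNorm_const_mul_le {p : ℝ≥0∞} (c : ℝ≥0∞) {g : α → ℝ≥0∞} (hg : Measurable g) :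
    eLpNorm (fun x => c * g x) p μ ≤ c * eLpNorm g p μ := by
  refine (eLpNorm_top_mul_le (f := fun _ => c) hg).trans ?_
  gcongr
  exact eLpNorm_top_le_of_ae_le (Filter.Eventually.of_forall fun _ => le_rfl)

lemma eLpNorm_eq_lintegral_rpow {p : ℝ≥0∞} (hp0 : p ≠ 0) (hp : p ≠ ∞) (f : α → ℝ≥0∞) :
    eLpNorm f p μ = (∫⁻ x, f x ^ p.toReal ∂μ) ^ (1 / p.toReal) := by
  simp [eLpNorm_eq_lintegral_rpow_enorm_toReal hp0 hp]

/-- Hölder's inequality for extended nonnegative functions and arbitrary exponents. -/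
lemma eLpNorm_mul_le_mul_eLpNorm {p q a : ℝ≥0∞} (ha : 1 ≤ a) (h : a⁻¹ = p⁻¹ + q⁻¹)
    {f g : α → ℝ≥0∞} (hf : Measurable f) (hg : Measurable g) :
    eLpNorm (fun x => f x * g x) a μ ≤ eLpNorm f p μ * eLpNorm g q μ := by
  have ha0 : a ≠ 0 := (zero_lt_one.trans_le ha).ne'
  rcases eq_or_ne p ∞ with rfl | hp
  · have : q = a := by simpa using h.symm
    subst this
    exact eLpNorm_top_mul_le hg
  rcases eq_or_ne q ∞ with rfl | hq
  · have : p = a := by simpa using h.symm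
    subst this
    simp_rw [mul_comm (f _)]
    rw [mul_comm]
    exact eLpNorm_top_mul_le hf
  have hq0 : q⁻¹ ≠ 0 := by simpa using hq
  have hp0 : p⁻¹ ≠ 0 := by simpa using hp
  have hatop : a⁻¹ ≠ ∞ := by simpa using ha0
  have hq' : q ≠ 0 := by rintro rfl; simp [ha0] at h
  have hp' : p ≠ 0 := by rintro rfl; simp [ha0] at h
  have hane : a ≠ ∞ := by rintro rfl; exact hp (by simpa using h.symm : p = ∞ ∧ q = ∞).1
  rw [eLpNorm_eq_lintegral_rpow ha0 hane, eLpNorm_eq_lintegral_rpow hp' hp,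
    eLpNorm_eq_lintegral_rpow hq' hq]
  have h' : 1 / a.toReal = 1 / p.toReal + 1 / q.toReal := by
    have := congrArg ENNReal.toReal h
    rw [ENNReal.toReal_add (by simpa using hp') (by simpa using hq')] at this
    simpa [ENNReal.toReal_inv] using this
  have hap := ENNReal.toReal_pos ha0 hane
  have hpp := ENNReal.toReal_pos hp' hp
  have hqp := ENNReal.toReal_pos hq' hq
  refine ENNReal.lintegral_Lp_mul_le_Lq_mul_Lr hap ?_ h' μ hf.aemeasurable hg.aemeasurable
  rw [← one_div_lt_one_div hpp hap, h']
  have : 0 < 1 / q.toReal := by positivity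
  linarith

/-- **Minkowski's integral inequality**. -/
lemma eLpNorm_lintegral_le [SigmaFinite μ] [SFinite ν] {p : ℝ≥0∞} (hp1 : 1 ≤ p) {F : α → β → ℝ≥0∞}
    (hF : Measurable (Function.uncurry F)) :
    eLpNorm (fun x => ∫⁻ y, F x y ∂ν) p μ ≤ ∫⁻ y, eLpNorm (fun x => F x y) p μ ∂ν := by
  have hFx : ∀ x, Measurable (F x) := fun x => hF.comp measurable_prodMk_left
  have hFy : ∀ y, Measurable (fun x => F x y) := fun y => hF.comp measurable_prodMk_right
  have hS : Measurable (fun x => ∫⁻ y, F x y ∂ν) := hF.lintegral_prod_right'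
  have hp0 : p ≠ 0 := (zero_lt_one.trans_le hp1).ne'
  rcases eq_or_ne p ∞ with rfl | hp
  · have hN := measurable_eLpNorm_right (μ := μ) ∞ hF
    refine eLpNorm_top_le_of_ae_le ?_
    have hset : MeasurableSet {z : α × β | F z.1 z.2 ≤ eLpNorm (fun x => F x z.2) ∞ μ} :=
      measurableSet_le hF (hN.comp measurable_snd)
    have h1 : ∀ᵐ y ∂ν, ∀ᵐ x ∂μ, F x y ≤ eLpNorm (fun x => F x y) ∞ μ :=
      Filter.Eventually.of_forall fun y => ae_le_eLpNorm_top _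
    have h2 := (Measure.ae_ae_comm (μ := μ) (ν := ν) hset).2 h1
    filter_upwards [h2] with x hx
    exact lintegral_mono_ae hx
  rcases eq_or_ne p 1 with rfl | hpne
  · simp only [eLpNorm_one_eq_lintegral_enorm, enorm_eq_self]
    rw [lintegral_lintegral_swap hF.aemeasurable]
  set M := ∫⁻ y, eLpNorm (fun x => F x y) p μ ∂ν with hM
  set S : α → ℝ≥0∞ := fun x => ∫⁻ y, F x y ∂ν with hSdef
  have hpr : 1 < p.toReal := by
    have : 1 < p := lt_of_le_of_ne hp1 hpne.symm
    simpa using (ENNReal.toReal_lt_toReal ENNReal.one_ne_top hp).2 this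
  set r := p.toReal with hr
  have hconj : r.HolderConjugate r.conjExponent := .conjExponent hpr
  -- Duality argument: bound `T^r` by `S T^(r-1)`, apply Tonelli and Hölder, then divide by a power
  -- of `∫ T^r`. The division needs this integral to be finite, hence the truncation `T` of `S`.
  have key : ∀ (T : α → ℝ≥0∞), Measurable T → (∀ x, T x ≤ S x) → ∫⁻ x, T x ^ r ∂μ ≠ ∞ →
      ∫⁻ x, T x ^ r ∂μ ≤ M ^ r := by
    intro T hT hTS hfin
    rcases eq_or_ne (∫⁻ x, T x ^ r ∂μ) 0 with h0 | h0
    · rw [h0]; exact bot_le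
    have h1 : ∫⁻ x, T x ^ r ∂μ ≤ M * (∫⁻ x, T x ^ r ∂μ) ^ (1 / r.conjExponent) := by
      calc ∫⁻ x, T x ^ r ∂μ ≤ ∫⁻ x, S x * T x ^ (r - 1) ∂μ := by
            refine lintegral_mono fun x => ?_
            have : T x ^ r = T x * T x ^ (r - 1) := by
              conv_rhs => rw [← ENNReal.rpow_one (T x), ← ENNReal.rpow_mul, one_mul]
              rw [← ENNReal.rpow_add_of_nonneg _ _ zero_le_one (by linarith)]
              congr 1; ring
            rw [this]
            gcongr
            exact hTS x
        _ = ∫⁻ x, ∫⁻ y, F x y * T x ^ (r - 1) ∂ν ∂μ := by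
            refine lintegral_congr fun x => ?_
            rw [lintegral_mul_const _ (hFx x)]
        _ = ∫⁻ y, ∫⁻ x, F x y * T x ^ (r - 1) ∂μ ∂ν := by
            refine lintegral_lintegral_swap (Measurable.aemeasurable ?_)
            exact hF.mul ((hT.comp measurable_fst).pow_const _)
        _ ≤ ∫⁻ y, eLpNorm (fun x => F x y) p μ * (∫⁻ x, T x ^ r ∂μ) ^ (1 / r.conjExponent) ∂ν := by
            refine lintegral_mono fun y => ?_
            rw [eLpNorm_eq_lintegral_rpow hp0 hp]
            exact ENNReal.lintegral_mul_rpow_le_lintegral_rpow_mul_lintegral_rpow hconj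
              (hFy y).aemeasurable hT.aemeasurable
        _ = _ := by rw [lintegral_mul_const _ (measurable_eLpNorm_right p hF)]
    have hr0 : 0 < r := by linarith
    have hconj' : 1 / r + 1 / r.conjExponent = 1 := by
      simpa using hconj.inv_add_inv_eq_one
    set I := ∫⁻ x, T x ^ r ∂μ with hI
    have h2 : I ^ (1 / r) * I ^ (1 / r.conjExponent) ≤ M * I ^ (1 / r.conjExponent) := by
      rw [← ENNReal.rpow_add _ _ h0 hfin, hconj', ENNReal.rpow_one]
      exact h1
    have h3 : I ^ (1 / r) ≤ M := by
      have hc0 : I ^ (1 / r.conjExponent) ≠ 0 := by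
        simp [ENNReal.rpow_eq_zero_iff, h0, hfin]
      have hct : I ^ (1 / r.conjExponent) ≠ ∞ := by
        simp [ENNReal.rpow_eq_top_iff, h0, hfin]
      exact (ENNReal.mul_le_mul_iff_left hc0 hct).1 h2
    calc I = (I ^ (1 / r)) ^ r := by rw [← ENNReal.rpow_mul]; simp [hr0.ne']
      _ ≤ M ^ r := by gcongr
  have hr0 : 0 < r := by linarith
  -- Cutting off height and support gives finite `L^r` norms; monotone convergence then recovers
  -- `S`.
  let T : ℕ → α → ℝ≥0∞ := fun n => (spanningSets μ n).indicator (fun x => min (S x) n)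
  have hTm : ∀ n, Measurable (T n) := fun n =>
    (hS.min measurable_const).indicator (measurableSet_spanningSets μ n)
  have hTle : ∀ n x, T n x ≤ S x := fun n x => by
    simp only [T]
    by_cases hx : x ∈ spanningSets μ n
    · rw [Set.indicator_of_mem hx]; exact min_le_left _ _
    · rw [Set.indicator_of_notMem hx]; exact bot_le
  have hTmono : ∀ x, Monotone (fun n => T n x) := by
    intro x n k hnk
    simp only [T]
    by_cases hx : x ∈ spanningSets μ n
    · rw [Set.indicator_of_mem hx, Set.indicator_of_mem (monotone_spanningSets μ hnk hx)]
      gcongr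
    · rw [Set.indicator_of_notMem hx]; exact bot_le
  have hTsup : ∀ x, S x = ⨆ n, T n x := by
    intro x
    refine le_antisymm ?_ (iSup_le fun n => hTle n x)
    refine le_of_forall_lt fun c hc => ?_
    obtain ⟨n, hn⟩ := ENNReal.exists_nat_gt (lt_of_lt_of_le hc le_top).ne
    have hx : x ∈ ⋃ n, spanningSets μ n := by rw [iUnion_spanningSets]; trivial
    obtain ⟨k, hk⟩ := Set.mem_iUnion.1 hx
    refine lt_of_lt_of_le ?_ (le_iSup (fun n => T n x) (max n k))
    simp only [T]
    rw [Set.indicator_of_mem (monotone_spanningSets μ (le_max_right n k) hk)]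
    refine lt_min hc (hn.trans_le ?_)
    exact_mod_cast le_max_left n k
  have hTfin : ∀ n, ∫⁻ x, T n x ^ r ∂μ ≠ ∞ := by
    intro n
    refine (lt_of_le_of_lt (b := ∫⁻ x, (spanningSets μ n).indicator (fun _ => (n : ℝ≥0∞) ^ r) x ∂μ)
      (lintegral_mono fun x => ?_) ?_).ne
    · simp only [T]
      by_cases hx : x ∈ spanningSets μ n
      · rw [Set.indicator_of_mem hx, Set.indicator_of_mem hx]
        gcongr
        exact min_le_right _ _
      · rw [Set.indicator_of_notMem hx, Set.indicator_of_notMem hx, ENNReal.zero_rpow_of_pos hr0]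
    · rw [lintegral_indicator_const (measurableSet_spanningSets μ n)]
      exact ENNReal.mul_lt_top (ENNReal.rpow_lt_top_of_nonneg hr0.le (by simp))
        (measure_spanningSets_lt_top μ n)
  have hfinal : ∫⁻ x, S x ^ r ∂μ ≤ M ^ r := by
    have hsup : ∀ x, S x ^ r = ⨆ n, T n x ^ r := by
      intro x
      rw [hTsup x]
      exact (ENNReal.orderIsoRpow r hr0).map_iSup _
    simp_rw [hsup]
    rw [lintegral_iSup (fun n => (hTm n).pow_const _)
      (fun n k hnk x => ENNReal.rpow_le_rpow (hTmono x hnk) hr0.le)]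
    exact iSup_le fun n => key _ (hTm n) (hTle n) (hTfin n)
  rw [eLpNorm_eq_lintegral_rpow hp0 hp]
  calc (∫⁻ x, S x ^ r ∂μ) ^ (1 / r) ≤ (M ^ r) ^ (1 / r) := by gcongr
    _ = M := by rw [← ENNReal.rpow_mul]; simp [hr0.ne']

/-- **Minkowski's inequality** for mixed norms: moving the larger exponent inside increases
the norm. -/
lemma eLpNorm_eLpNorm_le_swap [SigmaFinite μ] [SigmaFinite ν] {r a : ℝ≥0∞} (hr : 1 ≤ r)
    (hra : r ≤ a) {F : α → β → ℝ≥0∞} (hF : Measurable (Function.uncurry F)) :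
    eLpNorm (fun x => eLpNorm (F x) r ν) a μ ≤
      eLpNorm (fun y => eLpNorm (fun x => F x y) a μ) r ν := by
  have hr0 : r ≠ 0 := (zero_lt_one.trans_le hr).ne'
  rcases eq_or_ne r ∞ with rfl | hrt
  · obtain rfl : a = ∞ := top_le_iff.1 hra
    set M := eLpNorm (fun y => eLpNorm (fun x => F x y) ∞ μ) ∞ ν
    have hset : MeasurableSet {z : α × β | F z.1 z.2 ≤ M} := measurableSet_le hF measurable_const
    have h1 : ∀ᵐ y ∂ν, ∀ᵐ x ∂μ, F x y ≤ M := by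
      filter_upwards [ae_le_eLpNorm_top (μ := ν) (fun y => eLpNorm (fun x => F x y) ∞ μ)] with y hy
      filter_upwards [ae_le_eLpNorm_top (μ := μ) (fun x => F x y)] with x hx
      exact hx.trans hy
    refine eLpNorm_top_le_of_ae_le ?_
    filter_upwards [(Measure.ae_ae_comm (μ := μ) (ν := ν) hset).2 h1] with x hx
    exact eLpNorm_top_le_of_ae_le hx
  have hrp := ENNReal.toReal_pos hr0 hrt
  -- Raising both sides to the power `r` turns the `L^r` norms into integrals and the `L^a` norms
  -- into `L^{a/r}` norms. As `a / r ≥ 1`, Minkowski's integral inequality applies.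
  have hpow : ∀ {γ : Type _} [MeasurableSpace γ] (κ : Measure γ) (f : γ → ℝ≥0∞),
      eLpNorm f a κ ^ r.toReal = eLpNorm (fun x => f x ^ r.toReal) (a / r) κ := by
    intro γ _ κ f
    have := eLpNorm_enorm_rpow (μ := κ) (p := a / r) f hrp
    rw [ENNReal.ofReal_toReal hrt, ENNReal.div_mul_cancel hr0 hrt] at this
    simpa using this.symm
  have hpow' : ∀ {γ : Type _} [MeasurableSpace γ] (κ : Measure γ) (f : γ → ℝ≥0∞),
      eLpNorm f r κ ^ r.toReal = ∫⁻ x, f x ^ r.toReal ∂κ := by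
    intro γ _ κ f
    rw [eLpNorm_eq_lintegral_rpow hr0 hrt, ← ENNReal.rpow_mul]
    simp [hrp.ne']
  rw [← ENNReal.rpow_le_rpow_iff hrp, hpow μ, hpow' ν]
  simp_rw [hpow', hpow]
  refine eLpNorm_lintegral_le ?_ (F := fun x y => F x y ^ r.toReal) (hF.pow_const _)
  rwa [ENNReal.le_div_iff_mul_le (Or.inl hr0) (Or.inl hrt), one_mul]

/-- Powers of functions in Lebesgue norms. -/
lemma eLpNorm_rpow_le {p q : ℝ≥0∞} {θ : ℝ} (hθ : 0 ≤ θ) (h : q⁻¹ = ENNReal.ofReal θ * p⁻¹)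
    (f : α → ℝ≥0∞) :
    eLpNorm (fun x => f x ^ θ) q μ ≤ eLpNorm f p μ ^ θ := by
  rcases hθ.eq_or_lt with rfl | hθ
  · obtain rfl : q = ∞ := by simpa using h
    simpa using eLpNorm_top_le_of_ae_le (μ := μ) (f := fun _ => (1 : ℝ≥0∞)) (c := 1) (by simp)
  · have h0 : ENNReal.ofReal θ ≠ 0 := by simpa using hθ
    have hq : q * ENNReal.ofReal θ = p := by
      rw [← inv_inv q, h, ENNReal.mul_inv (Or.inl h0) (Or.inl ENNReal.ofReal_ne_top), inv_inv,
        mul_right_comm, ENNReal.inv_mul_cancel h0 ENNReal.ofReal_ne_top, one_mul]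
    have := eLpNorm_enorm_rpow (μ := μ) (p := q) f hθ
    rw [hq] at this
    simpa using this.le

end MixedLp

/-! ### Young's inequality with a kernel in a mixed norm space -/

section MixedYoung

variable {E : Type*} [AddCommGroup E] [MeasurableSpace E] [MeasurableAdd₂ E] [MeasurableNeg E]
  {μ : Measure E} [SigmaFinite μ] [μ.IsAddLeftInvariant] [μ.IsNegInvariant]

omit [SigmaFinite μ] in
lemma eLpNorm_comp_sub_left (p : ℝ≥0∞) {f : E → ℝ≥0∞} (hf : Measurable f) (x : E) :
    eLpNorm (fun t => f (x - t)) p μ = eLpNorm f p μ :=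
  eLpNorm_comp_measurePreserving hf.aestronglyMeasurable (Measure.measurePreserving_sub_left μ x)

omit [MeasurableNeg E] [SigmaFinite μ] [μ.IsNegInvariant] in
lemma eLpNorm_comp_sub_right (p : ℝ≥0∞) {f : E → ℝ≥0∞} (hf : Measurable f) (t : E) :
    eLpNorm (fun x => f (x - t)) p μ = eLpNorm f p μ :=
  eLpNorm_comp_measurePreserving hf.aestronglyMeasurable (measurePreserving_sub_right μ t)

/-- A mixed norm version of **Young's convolution inequality**. -/
lemma eLpNorm_lintegral_mul_comp_sub_le {r₀ p r₁ a : ℝ≥0∞} (hr₀ : 1 ≤ r₀) (hp : 1 ≤ p)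
    (hr₁ : 1 ≤ r₁) (h : 1 + a⁻¹ = r₀⁻¹ + p⁻¹ + r₁⁻¹) (h₁ : r₀⁻¹ + p⁻¹ ≤ 1)
    (h₂ : 1 ≤ p⁻¹ + r₁⁻¹) {F : E → E → ℝ≥0∞} (hF : Measurable (Function.uncurry F))
    {f : E → ℝ≥0∞} (hf : Measurable f) :
    eLpNorm (fun x => ∫⁻ t, F x t * f (x - t) ∂μ) a μ ≤
      eLpNorm (fun t => eLpNorm (fun x => F x t) r₀ μ) r₁ μ * eLpNorm f p μ := by
  have hFx : ∀ x, Measurable (F x) := fun x => hF.comp measurable_prodMk_left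
  have hFy : ∀ y, Measurable (fun x => F x y) := fun y => hF.comp measurable_prodMk_right
  have hfs : Measurable (fun z : E × E => f (z.1 - z.2)) := by
    simp only [sub_eq_add_neg]
    exact hf.comp (measurable_fst.add measurable_snd.neg)
  have hN := measurable_eLpNorm_right (μ := μ) r₀ hF
  -- Here `h₁` enters; this order of the exponents is what lets Minkowski exchange the norms in `x`
  -- and `t` below.
  have hr₁a : r₁ ≤ a := by
    rw [← ENNReal.inv_le_inv]
    have : 1 + a⁻¹ ≤ 1 + r₁⁻¹ := by rw [h]; gcongr
    exact (ENNReal.add_le_add_iff_left ENNReal.one_ne_top).1 this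
  have ha : 1 ≤ a := hr₁.trans hr₁a
  have hr₁' : r₁⁻¹ ≤ 1 := by simpa using hr₁
  have hp' : p⁻¹ ≤ 1 := by simpa using hp
  have hp0 : p ≠ 0 := (zero_lt_one.trans_le hp).ne'
  -- For `p = ∞` the conditions force `r₁ = 1` and `a = r₀`. This case is separate because `θ` below
  -- divides by `1/p`.
  rcases eq_or_ne p ∞ with rfl | hpt
  · obtain rfl : r₁ = 1 := by
      simp only [ENNReal.inv_top, zero_add, ENNReal.one_le_inv] at h₂
      exact le_antisymm h₂ hr₁
    obtain rfl : a = r₀ := by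
      simp only [ENNReal.inv_top, add_zero, inv_one, add_comm (1 : ℝ≥0∞)] at h
      exact inv_inj.1 ((ENNReal.add_left_inj ENNReal.one_ne_top).1 h)
    refine (eLpNorm_lintegral_le ha (F := fun x t => F x t * f (x - t)) (hF.mul hfs)).trans ?_
    rw [eLpNorm_one_eq_lintegral_enorm]
    simp only [enorm_eq_self]
    rw [← lintegral_mul_const _ hN]
    refine lintegral_mono fun t => ?_
    refine (eLpNorm_mul_le_mul_eLpNorm ha (p := a) (q := ∞) (by simp) (hFy t)
      (hfs.comp measurable_prodMk_right)).trans_eq ?_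
    rw [← eLpNorm_comp_sub_right ∞ hf t]
    rfl
  -- the conjugate exponent of `r₁` and the splitting of `f`
  set x : ℝ := p⁻¹.toReal with hx
  set R : ℝ := r₁⁻¹.toReal with hR
  have hpx : p⁻¹ = ENNReal.ofReal x := (ENNReal.ofReal_toReal (by simpa using hp0)).symm
  have hrR : r₁⁻¹ = ENNReal.ofReal R :=
    (ENNReal.ofReal_toReal (ne_top_of_le_ne_top ENNReal.one_ne_top hr₁')).symm
  have hx0 : 0 < x := ENNReal.toReal_pos (by simpa using hpt) (by simpa using hp0)
  have hR0 : 0 ≤ R := ENNReal.toReal_nonneg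
  have hR1 : R ≤ 1 := by
    have := ENNReal.toReal_mono ENNReal.one_ne_top hr₁'
    rwa [ENNReal.toReal_one] at this
  have h₂' : 1 ≤ x + R := by
    rw [hpx, hrR, ← ENNReal.ofReal_add hx0.le hR0, ← ENNReal.ofReal_one,
      ENNReal.ofReal_le_ofReal_iff (by positivity)] at h₂
    exact h₂
  -- `θ` is chosen so that `f^θ` lies in the space conjugate to `L^{r₁}` when `f ∈ L^p`; `h₂` says
  -- exactly that `θ ≤ 1`.
  set θ : ℝ := (1 - R) / x with hθ
  have hθ0 : 0 ≤ θ := div_nonneg (by linarith) hx0.le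
  have hθ1 : 0 ≤ 1 - θ := by
    rw [hθ, sub_nonneg, div_le_one hx0]; linarith
  have hθx : θ * x = 1 - R := div_mul_cancel₀ _ hx0.ne'
  set r' : ℝ≥0∞ := (ENNReal.ofReal (1 - R))⁻¹ with hr'
  have hconj : (1 : ℝ≥0∞)⁻¹ = r₁⁻¹ + r'⁻¹ := by
    rw [hr', inv_inv, hrR, ← ENNReal.ofReal_add hR0 (by linarith)]
    simp
  have hθr : r'⁻¹ = ENNReal.ofReal θ * p⁻¹ := by
    rw [hr', inv_inv, hpx, ← ENNReal.ofReal_mul hθ0, hθx]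
  -- The exponent of the remaining factor `f^(1-θ)`. The scaling relation `h` becomes `1/a = 1/r₀ +
  -- 1/q`, which is Hölder in `x`.
  set q : ℝ≥0∞ := (ENNReal.ofReal (1 - θ) * p⁻¹)⁻¹ with hq
  have haq : a⁻¹ = r₀⁻¹ + q⁻¹ := by
    have h3 : p⁻¹ + r₁⁻¹ = 1 + q⁻¹ := by
      rw [hq, inv_inv, hpx, hrR, ← ENNReal.ofReal_mul hθ1, ← ENNReal.ofReal_add hx0.le hR0,
        ← ENNReal.ofReal_one, ← ENNReal.ofReal_add zero_le_one (by positivity)]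
      congr 1
      linarith
    rw [add_assoc, h3, add_left_comm] at h
    exact (ENNReal.add_right_inj ENNReal.one_ne_top).1 h
  set A := eLpNorm f p μ with hA
  have hstep1 : ∀ x, ∫⁻ t, F x t * f (x - t) ∂μ ≤
      A ^ θ * eLpNorm (fun t => F x t * f (x - t) ^ (1 - θ)) r₁ μ := by
    intro x
    have hfx : Measurable (fun t => f (x - t)) := hfs.comp measurable_prodMk_left
    have h4 := eLpNorm_mul_le_mul_eLpNorm (μ := μ) le_rfl hconj
      (f := fun t => F x t * f (x - t) ^ (1 - θ)) (g := fun t => f (x - t) ^ θ)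
      ((hFx x).mul (hfx.pow_const _)) (hfx.pow_const _)
    have h5 : ∀ t, F x t * f (x - t) ^ (1 - θ) * f (x - t) ^ θ = F x t * f (x - t) := by
      intro t
      rw [mul_assoc, ← ENNReal.rpow_add_of_nonneg _ _ hθ1 hθ0, sub_add_cancel, ENNReal.rpow_one]
    rw [eLpNorm_one_eq_lintegral_enorm] at h4
    simp only [enorm_eq_self, h5] at h4
    refine h4.trans ?_
    rw [mul_comm]
    gcongr
    refine (eLpNorm_rpow_le hθ0 hθr _).trans_eq ?_
    rw [eLpNorm_comp_sub_left p hf x]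
  have hG : Measurable (Function.uncurry fun x t => F x t * f (x - t) ^ (1 - θ)) :=
    hF.mul (hfs.pow_const _)
  calc eLpNorm (fun x => ∫⁻ t, F x t * f (x - t) ∂μ) a μ
      ≤ eLpNorm (fun x => A ^ θ * eLpNorm (fun t => F x t * f (x - t) ^ (1 - θ)) r₁ μ) a μ :=
        eLpNorm_mono_ennreal hstep1
    _ ≤ A ^ θ * eLpNorm (fun x => eLpNorm (fun t => F x t * f (x - t) ^ (1 - θ)) r₁ μ) a μ :=
        eLpNorm_const_mul_le _ (measurable_eLpNorm_left r₁ hG)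
    _ ≤ A ^ θ * eLpNorm (fun t => eLpNorm (fun x => F x t * f (x - t) ^ (1 - θ)) a μ) r₁ μ := by
        gcongr
        exact eLpNorm_eLpNorm_le_swap hr₁ hr₁a hG
    _ ≤ A ^ θ * eLpNorm (fun t => A ^ (1 - θ) * eLpNorm (fun x => F x t) r₀ μ) r₁ μ := by
        gcongr
        refine eLpNorm_mono_ennreal fun t => ?_
        have hft : Measurable (fun x => f (x - t)) := hfs.comp measurable_prodMk_right
        refine (eLpNorm_mul_le_mul_eLpNorm ha haq (hFy t) (hft.pow_const _)).trans ?_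
        rw [mul_comm]
        gcongr
        refine (eLpNorm_rpow_le (p := p) hθ1 (by rw [hq, inv_inv]) _).trans_eq ?_
        rw [eLpNorm_comp_sub_right p hf t]
    _ ≤ A ^ θ * (A ^ (1 - θ) * eLpNorm (fun t => eLpNorm (fun x => F x t) r₀ μ) r₁ μ) := by
        gcongr
        exact eLpNorm_const_mul_le _ hN
    _ = _ := by
        rw [← mul_assoc, ← ENNReal.rpow_add_of_nonneg _ _ hθ0 hθ1, add_sub_cancel,
          ENNReal.rpow_one, mul_comm]

/-- **Young's convolution inequality**, with the exponent of the kernel as an unknown. -/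
lemma eLpNorm_conv_le {p a e : ℝ≥0∞} (hp : 1 ≤ p) (he : 1 ≤ e) (h : 1 + a⁻¹ = p⁻¹ + e⁻¹)
    {G k : E → ℝ≥0∞} (hG : Measurable G) (hk : Measurable k) :
    eLpNorm (fun x => ∫⁻ t, G t * k (x - t) ∂μ) a μ ≤ eLpNorm G p μ * eLpNorm k e μ := by
  have he' : e⁻¹ ≤ 1 := by simpa using he
  -- A kernel independent of `x` has `L^∞` norm in `x` equal to its value, at most; so `r₀ = ∞`
  -- recovers the classical inequality.
  refine (eLpNorm_lintegral_mul_comp_sub_le (r₀ := ∞) (r₁ := p) (p := e) (by simp) he hp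
    (by rw [h]; simp [add_comm]) (by simpa using he')
    (by rw [add_comm e⁻¹, ← h]; exact le_self_add) (F := fun _ t => G t)
    (hG.comp measurable_snd) hk).trans ?_
  gcongr
  refine eLpNorm_mono_ennreal fun t => eLpNorm_top_le_of_ae_le (by simp)

end MixedYoung

/-! ### Multilinear convolution estimate in the time variables -/

section IteratedNorm

variable {d : ℕ}

lemma measurable_finCons {γ E : Type*} [MeasurableSpace γ] [MeasurableSpace E] {n : ℕ} {f : γ → E}
    {g : γ → Fin n → E} (hf : Measurable f) (hg : Measurable g) :
    Measurable (fun z => (Fin.cons (f z) (g z) : Fin (n + 1) → E)) := by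
  refine measurable_pi_iff.2 fun k => ?_
  refine Fin.cases ?_ (fun k => ?_) k
  · simpa using hf
  · simpa using measurable_pi_iff.1 hg k

lemma measurable_finSnoc {γ E : Type*} [MeasurableSpace γ] [MeasurableSpace E] {n : ℕ} {f : γ → E}
    {g : γ → Fin n → E} (hf : Measurable f) (hg : Measurable g) :
    Measurable (fun z => (Fin.snoc (g z) (f z) : Fin (n + 1) → E)) := by
  refine measurable_pi_iff.2 fun k => ?_
  refine Fin.lastCases ?_ (fun k => ?_) k
  · simpa using hf
  · simpa using measurable_pi_iff.1 hg k

lemma piFinSuccAbove_zero_symm_apply {E : Type*} [MeasurableSpace E] {n : ℕ} (x : E × (Fin n → E)) :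
    (MeasurableEquiv.piFinSuccAbove (fun _ : Fin (n + 1) => E) 0).symm x = Fin.cons x.1 x.2 := by
  rw [MeasurableEquiv.piFinSuccAbove_symm_apply]
  exact Fin.insertNth_zero' _ _

/-- Tonelli with the first variable innermost, for the time estimate; `lintegral_finSucc'` has it
outermost, for the frequency estimate. -/
lemma lintegral_finSucc {E : Type*} [MeasureSpace E] [SigmaFinite (volume : Measure E)]
    {n : ℕ} {G : (Fin (n + 1) → E) → ℝ≥0∞} (hG : Measurable G) :
    ∫⁻ t, G t = ∫⁻ t' : Fin n → E, ∫⁻ t₀ : E, G (Fin.cons t₀ t') := by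
  have h := (volume_preserving_piFinSuccAbove (fun _ : Fin (n + 1) => E) 0).symm
  rw [← h.lintegral_comp_emb (MeasurableEquiv.measurableEmbedding _), Measure.volume_eq_prod,
    lintegral_prod_symm']
  · simp_rw [piFinSuccAbove_zero_symm_apply]
  · exact hG.comp (MeasurableEquiv.measurable _)

lemma lintegral_finSucc' {E : Type*} [MeasureSpace E] [SigmaFinite (volume : Measure E)]
    {n : ℕ} {G : (Fin (n + 1) → E) → ℝ≥0∞} (hG : Measurable G) :
    ∫⁻ t, G t = ∫⁻ t₀ : E, ∫⁻ t' : Fin n → E, G (Fin.cons t₀ t') := by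
  have h := (volume_preserving_piFinSuccAbove (fun _ : Fin (n + 1) => E) 0).symm
  rw [← h.lintegral_comp_emb (MeasurableEquiv.measurableEmbedding _), Measure.volume_eq_prod,
    lintegral_prod]
  · simp_rw [piFinSuccAbove_zero_symm_apply]
  · exact (hG.comp (MeasurableEquiv.measurable _)).aemeasurable

lemma measurable_eLpNorm_cons {n : ℕ} (r : ℝ≥0∞) {F : (Fin (n + 1) → Rd d) → ℝ≥0∞}
    (hF : Measurable F) :
    Measurable (fun y : Fin n → Rd d => eLpNorm (fun x : Rd d => F (Fin.cons x y)) r volume) :=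
  measurable_eLpNorm_right (F := fun (x : Rd d) (y : Fin n → Rd d) => F (Fin.cons x y)) r
    (hF.comp (measurable_finCons measurable_fst measurable_snd))

lemma iteratedNorm_succ {n : ℕ} (r : Fin (n + 1) → ℝ≥0∞) (F : (Fin (n + 1) → Rd d) → ℝ≥0∞) :
    iteratedNorm (n + 1) r F = iteratedNorm n (fun k => r k.succ)
      (fun y => eLpNorm (fun x : Rd d => F (Fin.cons x y)) (r 0) volume) := rfl

lemma iteratedNorm_mono {n : ℕ} {r : Fin n → ℝ≥0∞} {F G : (Fin n → Rd d) → ℝ≥0∞}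
    (h : ∀ x, F x ≤ G x) : iteratedNorm n r F ≤ iteratedNorm n r G := by
  induction n with
  | zero => exact h _
  | succ n ih => exact ih fun y => eLpNorm_mono_ennreal fun x => h _

lemma iteratedNorm_mul_const_le {n : ℕ} {r : Fin n → ℝ≥0∞} (c : ℝ≥0∞)
    {F : (Fin n → Rd d) → ℝ≥0∞} (hF : Measurable F) :
    iteratedNorm n r (fun x => F x * c) ≤ iteratedNorm n r F * c := by
  induction n with
  | zero => exact le_rfl
  | succ n ih =>
    rw [iteratedNorm_succ, iteratedNorm_succ]
    refine le_trans (iteratedNorm_mono fun y => ?_) (ih (measurable_eLpNorm_cons (r 0) hF))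
    simp_rw [mul_comm _ c]
    exact eLpNorm_const_mul_le c (hF.comp (measurable_finCons measurable_id measurable_const))

set_option maxHeartbeats 400000 in
/-- The multilinear convolution estimate in the time variables. -/
lemma eLpNorm_lintegral_prod_comp_sub_le {m : ℕ} {r : Fin (m + 1) → ℝ≥0∞} {p : Fin m → ℝ≥0∞}
    {a : ℝ≥0∞} (hr : ∀ i, 1 ≤ r i) (hp : ∀ i, 1 ≤ p i)
    (h₁ : ∀ k : Fin m, (r k.castSucc)⁻¹ + (p k)⁻¹ ≤ 1)
    (h₂ : ∀ k : Fin m, 1 ≤ (p k)⁻¹ + (r k.succ)⁻¹)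
    (h : m + a⁻¹ = (r 0)⁻¹ + ∑ k : Fin m, ((p k)⁻¹ + (r k.succ)⁻¹))
    {F : (Fin (m + 1) → Rd d) → ℝ≥0∞} (hF : Measurable F)
    {f : Fin m → Rd d → ℝ≥0∞} (hf : ∀ k, Measurable (f k)) :
    eLpNorm (fun x : Rd d => ∫⁻ t : Fin m → Rd d, F (Fin.cons x t) * ∏ k, f k (x - t k)) a volume ≤
      iteratedNorm (m + 1) r F * ∏ k, eLpNorm (f k) (p k) volume := by
  induction m generalizing a with
  | zero =>
    have ha : a = r 0 := by simpa using h
    subst ha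
    simp only [Finset.univ_eq_empty, Finset.prod_empty, mul_one]
    have : ∀ x : Rd d, ∫⁻ t : Fin 0 → Rd d, F (Fin.cons x t) = F (Fin.cons x Fin.elim0) := by
      intro x
      rw [lintegral_unique]
      simp only [volume_pi, Measure.pi_univ]
      simp only [Finset.univ_eq_empty, Finset.prod_empty, mul_one]
      congr
    simp_rw [this]
    exact le_rfl
  | succ m ih =>
    -- The exponent in `x` that Young's inequality yields after the integration over the first time
    -- variable. It replaces `r 0` in the induction, and `hsum` shows that the subtraction is not
    -- truncated.
    set b : ℝ≥0∞ := ((r 0)⁻¹ + (p 0)⁻¹ + (r 1)⁻¹ - 1)⁻¹ with hb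
    have hsum : 1 ≤ (r 0)⁻¹ + (p 0)⁻¹ + (r 1)⁻¹ := by
      rw [add_assoc]; exact (h₂ 0).trans le_add_self
    have hb1 : 1 + b⁻¹ = (r 0)⁻¹ + (p 0)⁻¹ + (r 1)⁻¹ := by
      rw [hb, inv_inv, add_tsub_cancel_of_le hsum]
    -- Since `b ≥ r 1`, the condition linking `r 1` and `p 1` passes to `b` and `p 1`, so the chain
    -- survives the induction step.
    have hb2 : b⁻¹ ≤ (r 1)⁻¹ := by
      have : 1 + b⁻¹ ≤ 1 + (r 1)⁻¹ := by
        rw [hb1]; exact add_le_add_left (h₁ 0) _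
      exact (ENNReal.add_le_add_iff_left ENNReal.one_ne_top).1 this
    have hb3 : 1 ≤ b := (hr 1).trans (ENNReal.inv_le_inv.1 hb2)
    let r' : Fin (m + 1) → ℝ≥0∞ := Fin.cons b (fun k => r k.succ.succ)
    let F' : (Fin (m + 1) → Rd d) → ℝ≥0∞ := fun y =>
      ∫⁻ t₀ : Rd d, F (Fin.cons (y 0) (Fin.cons t₀ (Fin.tail y))) * f 0 (y 0 - t₀)
    have hmt : Measurable (fun y : Fin (m + 1) → Rd d => Fin.tail y) :=
      measurable_pi_iff.2 fun k => measurable_pi_apply _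
    have hF' : Measurable F' := by
      refine Measurable.lintegral_prod_right' (f := fun z : (Fin (m + 1) → Rd d) × Rd d =>
        F (Fin.cons (z.1 0) (Fin.cons z.2 (Fin.tail z.1))) * f 0 (z.1 0 - z.2)) ?_
      have h0 : Measurable (fun z : (Fin (m + 1) → Rd d) × Rd d => z.1 0) :=
        (measurable_pi_apply 0).comp measurable_fst
      exact (hF.comp (measurable_finCons h0 (measurable_finCons measurable_snd
        (hmt.comp measurable_fst)))).mul ((hf 0).comp (h0.sub measurable_snd))
    have hsplit : ∀ x : Rd d,
        ∫⁻ t : Fin (m + 1) → Rd d, F (Fin.cons x t) * ∏ k, f k (x - t k) =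
          ∫⁻ t : Fin m → Rd d, F' (Fin.cons x t) * ∏ k : Fin m, f k.succ (x - t k) := by
      intro x
      have hprod : Measurable fun t : Fin (m + 1) → Rd d => ∏ k, f k (x - t k) :=
        Finset.measurable_fun_prod _ fun k _ =>
          (hf k).comp (measurable_const.sub (measurable_pi_apply k))
      have hm : Measurable fun t : Fin (m + 1) → Rd d =>
          F (Fin.cons x t) * ∏ k, f k (x - t k) :=
        (hF.comp (measurable_finCons measurable_const measurable_id)).mul hprod
      rw [lintegral_finSucc hm]
      refine lintegral_congr fun t => ?_
      simp only [F', Fin.prod_univ_succ, Fin.cons_zero, Fin.cons_succ, Fin.tail_cons, ← mul_assoc]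
      rw [lintegral_mul_const]
      exact (hF.comp (measurable_finCons measurable_const
        (measurable_finCons measurable_id measurable_const))).mul
        ((hf 0).comp (measurable_const.sub measurable_id))
    have hG : Measurable fun y : Fin m → Rd d => eLpNorm (fun t₀ : Rd d => eLpNorm
        (fun x : Rd d => F (Fin.cons x (Fin.cons t₀ y))) (r 0) volume) (r 1) volume := by
      have hm₀ : Measurable fun y : Fin (m + 1) → Rd d =>
        eLpNorm (fun x : Rd d => F (Fin.cons x y)) (r 0) volume := measurable_eLpNorm_cons (r 0) hF
      exact measurable_eLpNorm_right (F := fun (t₀ : Rd d) (y : Fin m → Rd d) => eLpNorm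
        (fun x : Rd d => F (Fin.cons x (Fin.cons t₀ y))) (r 0) volume) (r 1)
        (hm₀.comp (measurable_finCons measurable_fst measurable_snd))
    simp_rw [hsplit]
    have hIH := ih (r := r') (p := fun k => p k.succ) (a := a) (f := fun k => f k.succ)
      (F := F') ?_ (fun k => hp _) ?_ (fun k => h₂ k.succ) ?_ hF' (fun k => hf _)
    · refine hIH.trans ?_
      rw [Fin.prod_univ_succ, ← mul_assoc]
      gcongr
      rw [iteratedNorm_succ, iteratedNorm_succ, iteratedNorm_succ]
      -- The two innermost norms are those in `x` and in the first time variable, so the mixed Young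
      -- inequality applies with the remaining variables frozen.
      refine le_trans (iteratedNorm_mono (G := fun y => (eLpNorm (fun t₀ : Rd d => eLpNorm
        (fun x : Rd d => F (Fin.cons x (Fin.cons t₀ y))) (r 0) volume) (r 1) volume) *
          eLpNorm (f 0) (p 0) volume) fun y => ?_) (iteratedNorm_mul_const_le _ ?_)
      · simp only [F', r', Fin.cons_zero, Fin.tail_cons]
        exact eLpNorm_lintegral_mul_comp_sub_le (hr 0) (hp 0) (hr 1) hb1 (h₁ 0) (h₂ 0)
          (F := fun x t => F (Fin.cons x (Fin.cons t y)))
          (hF.comp (measurable_finCons measurable_fst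
            (measurable_finCons measurable_snd measurable_const))) (hf 0)
      · exact hG
    · intro i
      refine Fin.cases ?_ (fun k => ?_) i
      · exact hb3
      · exact hr _
    · intro k
      rcases m with _ | m
      · exact k.elim0
      refine Fin.cases ?_ (fun j => ?_) k
      · simp only [r', Fin.castSucc_zero, Fin.cons_zero]
        exact (add_le_add_left hb2 _).trans (h₁ 1)
      · simpa only [r', Fin.castSucc_succ, Fin.cons_succ] using h₁ j.succ.succ
    · have hc : (1 : ℝ≥0∞) + (m + a⁻¹) =
          1 + (b⁻¹ + ∑ k : Fin m, ((p k.succ)⁻¹ + (r k.succ.succ)⁻¹)) := by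
        rw [← add_assoc, ← add_assoc, hb1]
        rw [Fin.sum_univ_succ] at h
        push_cast at h
        rw [add_comm (1 : ℝ≥0∞), h]
        simp only [Fin.succ_zero_eq_one]
        ring
      simpa only [r', Fin.cons_zero, Fin.cons_succ] using
        (ENNReal.add_right_inj ENNReal.one_ne_top).1 hc

end IteratedNorm

/-! ### Multilinear convolution estimate in the frequency variables -/

section IteratedNorm

variable {d : ℕ}

/-- Pairing each `q k` with `s k.succ` rather than `s k.castSucc` leaves `s 0` over and makes every
summand at least `1`. This bounds the intermediate exponent of the frequency estimate. -/
lemma sum_inv_chain_le {m : ℕ} {s : Fin (m + 1) → ℝ≥0∞} {q : Fin m → ℝ≥0∞}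
    (h₂ : ∀ k : Fin m, 1 ≤ (q k)⁻¹ + (s k.succ)⁻¹) :
    m + (s 0)⁻¹ ≤ (s (Fin.last m))⁻¹ + ∑ k : Fin m, ((q k)⁻¹ + (s k.castSucc)⁻¹) := by
  have h3 : (s (Fin.last m))⁻¹ + ∑ k : Fin m, ((q k)⁻¹ + (s k.castSucc)⁻¹) =
      (s 0)⁻¹ + ∑ k : Fin m, ((q k)⁻¹ + (s k.succ)⁻¹) := by
    rw [Finset.sum_add_distrib, Finset.sum_add_distrib, add_left_comm, add_left_comm (s 0)⁻¹,
      add_comm (s (Fin.last m))⁻¹, ← Fin.sum_univ_castSucc (fun k => (s k)⁻¹),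
      Fin.sum_univ_succ (fun k => (s k)⁻¹)]
  rw [h3, add_comm]
  gcongr
  calc (m : ℝ≥0∞) = ∑ _k : Fin m, (1 : ℝ≥0∞) := by simp
    _ ≤ _ := Finset.sum_le_sum fun k _ => h₂ k

lemma measurable_convolution_integrand {m : ℕ} {N : (Fin (m + 1) → Rd d) → ℝ≥0∞}
    (hN : Measurable N) {φ : Fin m → Rd d → ℝ≥0∞} (hφ : ∀ k, Measurable (φ k)) :
    Measurable (fun z : Rd d × (Fin m → Rd d) =>
      N (Fin.snoc z.2 (z.1 - ∑ k, z.2 k)) * ∏ k, φ k (z.2 k)) := by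
  have h : ∀ k, Measurable (fun z : Rd d × (Fin m → Rd d) => z.2 k) := fun k =>
    (measurable_pi_apply k).comp measurable_snd
  refine (hN.comp (measurable_finSnoc (measurable_fst.sub
    (Finset.measurable_fun_sum _ fun k _ => h k)) measurable_snd)).mul ?_
  exact Finset.measurable_fun_prod _ fun k _ => (hφ k).comp (h k)

set_option maxHeartbeats 400000 in
/-- The multilinear convolution estimate in the frequency variables. -/
lemma eLpNorm_lintegral_snoc_mul_prod_le {m : ℕ} {s : Fin (m + 1) → ℝ≥0∞} {q : Fin m → ℝ≥0∞}
    {a : ℝ≥0∞} (hs : ∀ i, 1 ≤ s i) (hq : ∀ i, 1 ≤ q i)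
    (h₁ : ∀ k : Fin m, (s k.castSucc)⁻¹ + (q k)⁻¹ ≤ 1)
    (h₂ : ∀ k : Fin m, 1 ≤ (q k)⁻¹ + (s k.succ)⁻¹)
    (h : m + a⁻¹ = (s (Fin.last m))⁻¹ + ∑ k : Fin m, ((q k)⁻¹ + (s k.castSucc)⁻¹))
    {N : (Fin (m + 1) → Rd d) → ℝ≥0∞} (hN : Measurable N)
    {φ : Fin m → Rd d → ℝ≥0∞} (hφ : ∀ k, Measurable (φ k)) :
    eLpNorm (fun x : Rd d => ∫⁻ u : Fin m → Rd d,
      N (Fin.snoc u (x - ∑ k, u k)) * ∏ k, φ k (u k)) a volume ≤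
      iteratedNorm (m + 1) s N * ∏ k, eLpNorm (φ k) (q k) volume := by
  induction m generalizing a with
  | zero =>
    have ha : a = s 0 := by simpa using h
    subst ha
    simp only [Finset.univ_eq_empty, Finset.prod_empty, mul_one, Finset.sum_empty, sub_zero]
    have : ∀ x : Rd d, ∫⁻ u : Fin 0 → Rd d, N (Fin.snoc u x) = N (Fin.cons x Fin.elim0) := by
      intro x
      rw [lintegral_unique]
      simp only [volume_pi, Measure.pi_univ]
      simp only [Finset.univ_eq_empty, Finset.prod_empty, mul_one]
      congr 1
      funext i
      obtain rfl : i = Fin.last 0 := Fin.fin_one_eq_zero i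
      rw [Fin.snoc_last]
      rfl
    simp_rw [this]
    exact le_rfl
  | succ m ih =>
    -- The exponent produced by the induction hypothesis for all frequency variables but the first.
    -- `hchain` makes the subtraction honest and gives `b ≤ s 1`, so `q 0` and `b` satisfy the
    -- second condition of Young's inequality.
    set b : ℝ≥0∞ := ((s (Fin.last (m + 1)))⁻¹ +
      ∑ k : Fin m, ((q k.succ)⁻¹ + (s k.castSucc.succ)⁻¹) - m)⁻¹ with hb
    have hchain := sum_inv_chain_le (s := fun k => s k.succ) (q := fun k => q k.succ)
      (fun k => h₂ k.succ)
    simp only [Fin.succ_last] at hchain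
    have hm : (m : ℝ≥0∞) ≠ ∞ := ENNReal.natCast_ne_top m
    have hb1 : m + b⁻¹ = (s (Fin.last (m + 1)))⁻¹ +
        ∑ k : Fin m, ((q k.succ)⁻¹ + (s k.castSucc.succ)⁻¹) := by
      rw [hb, inv_inv, add_tsub_cancel_of_le (le_self_add.trans hchain)]
    have hb2 : (s 1)⁻¹ ≤ b⁻¹ := by
      rw [← hb1] at hchain
      exact (ENNReal.add_le_add_iff_left hm).1 hchain
    have hb3 : 1 ≤ b := by
      rw [← ENNReal.inv_le_one, ← ENNReal.add_le_add_iff_left hm, hb1, add_comm]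
      gcongr
      · calc ∑ k : Fin m, ((q k.succ)⁻¹ + (s k.castSucc.succ)⁻¹)
            ≤ ∑ _k : Fin m, (1 : ℝ≥0∞) := by
              refine Finset.sum_le_sum fun k _ => ?_
              rw [add_comm]
              exact h₁ k.succ
          _ = m := by simp
      · simpa using hs _
    let N' : (Fin (m + 1) → Rd d) → ℝ≥0∞ := fun y =>
      eLpNorm (fun u₁ : Rd d => N (Fin.cons u₁ y)) (s 0) volume
    have hN' : Measurable N' := measurable_eLpNorm_cons (s 0) hN
    have hIH := ih (s := fun k => s k.succ) (q := fun k => q k.succ) (a := b) (N := N')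
      (φ := fun k => φ k.succ) (fun i => hs _) (fun i => hq _) (fun k => h₁ k.succ)
      (fun k => h₂ k.succ) hb1 hN' (fun k => hφ _)
    -- The integral over all variables but the first, with `y` the total of the remaining
    -- frequencies; `y = x - u₁` turns the whole into a convolution in `u₁`.
    let K : Rd d → Rd d → ℝ≥0∞ := fun u₁ y => ∫⁻ u : Fin m → Rd d,
      N (Fin.cons u₁ (Fin.snoc u (y - ∑ k, u k) : Fin (m + 1) → Rd d)) * ∏ k, φ k.succ (u k)
    have hKint : Measurable (fun z : (Rd d × Rd d) × (Fin m → Rd d) =>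
        N (Fin.cons z.1.1 (Fin.snoc z.2 (z.1.2 - ∑ k, z.2 k) : Fin (m + 1) → Rd d)) *
          ∏ k, φ k.succ (z.2 k)) := by
      have h : ∀ k, Measurable (fun z : (Rd d × Rd d) × (Fin m → Rd d) => z.2 k) := fun k =>
        (measurable_pi_apply k).comp measurable_snd
      refine (hN.comp (measurable_finCons (measurable_fst.comp measurable_fst)
        (measurable_finSnoc ((measurable_snd.comp measurable_fst).sub
        (Finset.measurable_fun_sum _ fun k _ => h k)) measurable_snd))).mul ?_
      exact Finset.measurable_fun_prod _ fun k _ => (hφ k.succ).comp (h k)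
    have hK : Measurable (Function.uncurry K) := hKint.lintegral_prod_right'
    have hsplit : ∀ x : Rd d, ∫⁻ u : Fin (m + 1) → Rd d,
        N (Fin.snoc u (x - ∑ k, u k)) * ∏ k, φ k (u k) =
        ∫⁻ t : Rd d, K (x - t) t * φ 0 (x - t) := by
      intro x
      have hm : Measurable fun u : Fin (m + 1) → Rd d =>
          N (Fin.snoc u (x - ∑ k, u k)) * ∏ k, φ k (u k) :=
        (measurable_convolution_integrand hN hφ).comp measurable_prodMk_left
      rw [lintegral_finSucc' hm, ← lintegral_sub_left_eq_self _ x]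
      refine lintegral_congr fun t => ?_
      simp only [K]
      rw [← lintegral_mul_const]
      · refine lintegral_congr fun u => ?_
        simp only [Fin.sum_univ_succ, Fin.prod_univ_succ, Fin.cons_zero, Fin.cons_succ]
        rw [← Fin.cons_snoc_eq_snoc_cons, mul_assoc, mul_comm (φ 0 _)]
        congr 4
        abel
      · exact hKint.comp (measurable_prodMk_left (x := ((x - t, t) : Rd d × Rd d)))
    simp_rw [hsplit]
    have hKs : Measurable (Function.uncurry fun x t : Rd d => K (x - t) t) :=
      hK.comp ((measurable_fst.sub measurable_snd).prodMk measurable_snd)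
    -- The kernel is `K (x - t) t`. For fixed `t`, its `L^{s 0}` norm in `x` is that of `K (·) t` by
    -- translation invariance, and Minkowski reduces this to the induction hypothesis for `N'`.
    refine (eLpNorm_lintegral_mul_comp_sub_le (hs 0) (hq 0) hb3 (a := a) ?_ (h₁ 0)
      ((h₂ 0).trans (add_le_add_right hb2 _)) hKs (hφ 0)).trans ?_
    · refine (ENNReal.add_right_inj hm).1 ?_
      rw [Fin.sum_univ_succ] at h
      push_cast at h
      rw [← add_assoc, h, add_left_comm, add_left_comm (m : ℝ≥0∞), hb1, Fin.castSucc_zero]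
      simp only [Fin.succ_castSucc]
      ring
    · rw [Fin.prod_univ_succ, mul_comm (eLpNorm (φ 0) (q 0) volume), ← mul_assoc]
      gcongr
      refine le_trans (eLpNorm_mono_ennreal fun t => ?_) hIH
      have hKt : Measurable fun u₁ => K u₁ t := hK.comp measurable_prodMk_right
      rw [eLpNorm_comp_sub_right (μ := (volume : Measure (Rd d))) (s 0) hKt t]
      refine (eLpNorm_lintegral_le (hs 0) (F := fun u₁ u => N (Fin.cons u₁ (Fin.snoc u
        (t - ∑ k, u k) : Fin (m + 1) → Rd d)) * ∏ k, φ k.succ (u k)) (hKint.comp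
        ((measurable_fst.prodMk measurable_const).prodMk measurable_snd))).trans ?_
      refine lintegral_mono fun u => ?_
      simp only [N', mul_comm _ (∏ k : Fin m, φ k.succ (u k))]
      exact eLpNorm_const_mul_le _ (hN.comp (measurable_finCons measurable_id measurable_const))

end IteratedNorm

/-! ### The transform of the symbol on mixed norm spaces -/

section MixedEstimates

variable {d : ℕ}

lemma measurable_iteratedNorm {γ : Type*} [MeasurableSpace γ] {n : ℕ} (r : Fin n → ℝ≥0∞)
    {F : (Fin n → Rd d) → γ → ℝ≥0∞} (hF : Measurable (Function.uncurry F)) :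
    Measurable (fun c => iteratedNorm n r (fun a => F a c)) := by
  induction n with
  | zero => exact hF.comp measurable_prodMk_left
  | succ n ih =>
    simp only [iteratedNorm_succ]
    refine ih (fun k => r k.succ)
      (F := fun y c => eLpNorm (fun x : Rd d => F (Fin.cons x y) c) (r 0) volume) ?_
    exact measurable_eLpNorm_right
      (F := fun (x : Rd d) (z : (Fin n → Rd d) × γ) => F (Fin.cons x z.1) z.2) (r 0)
      (hF.comp ((measurable_finCons measurable_fst
        (measurable_fst.comp measurable_snd)).prodMk (measurable_snd.comp measurable_snd)))

/-- The transform of the symbol class controlling the short-time Fourier transform of `T_σ f`. -/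
noncomputable def symbolTransform {m : ℕ} (F : (Fin (m + 1) → Rd d) → (Fin (m + 1) → Rd d) → ℝ≥0∞)
    (f : Fin m → Rd d → Rd d → ℝ≥0∞) (x ω : Rd d) : ℝ≥0∞ :=
  ∫⁻ ξ : Fin m → Rd d, ∫⁻ t : Fin m → Rd d,
    F (Fin.cons x t) (Fin.snoc ξ (ω - ∑ k, ξ k)) * ∏ k, f k (x - t k) (ξ k)

lemma measurable_symbolTransform_integrand {m : ℕ}
    {F : (Fin (m + 1) → Rd d) → (Fin (m + 1) → Rd d) → ℝ≥0∞}
    (hF : Measurable (Function.uncurry F)) {f : Fin m → Rd d → Rd d → ℝ≥0∞}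
    (hf : ∀ k, Measurable (Function.uncurry (f k))) :
    Measurable (fun z : ((Rd d × Rd d) × (Fin m → Rd d)) × (Fin m → Rd d) =>
      F (Fin.cons z.1.1.1 z.2) (Fin.snoc z.1.2 (z.1.1.2 - ∑ k, z.1.2 k)) *
        ∏ k, f k (z.1.1.1 - z.2 k) (z.1.2 k)) := by
  have hx : Measurable (fun z : ((Rd d × Rd d) × (Fin m → Rd d)) × (Fin m → Rd d) => z.1.1.1) :=
    measurable_fst.comp (measurable_fst.comp measurable_fst)
  have hω : Measurable (fun z : ((Rd d × Rd d) × (Fin m → Rd d)) × (Fin m → Rd d) => z.1.1.2) :=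
    measurable_snd.comp (measurable_fst.comp measurable_fst)
  have hξ : ∀ k, Measurable
      (fun z : ((Rd d × Rd d) × (Fin m → Rd d)) × (Fin m → Rd d) => z.1.2 k) := fun k =>
    (measurable_pi_apply k).comp (measurable_snd.comp measurable_fst)
  have ht : ∀ k, Measurable
      (fun z : ((Rd d × Rd d) × (Fin m → Rd d)) × (Fin m → Rd d) => z.2 k) := fun k =>
    (measurable_pi_apply k).comp measurable_snd
  have h1 : Measurable (fun z : ((Rd d × Rd d) × (Fin m → Rd d)) × (Fin m → Rd d) =>
      ((Fin.cons z.1.1.1 z.2, Fin.snoc z.1.2 (z.1.1.2 - ∑ k, z.1.2 k)) :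
        (Fin (m + 1) → Rd d) × (Fin (m + 1) → Rd d))) :=
    (measurable_finCons hx measurable_snd).prodMk (measurable_finSnoc
      (hω.sub (Finset.measurable_fun_sum _ fun k _ => hξ k)) (measurable_snd.comp measurable_fst))
  refine (hF.comp h1).mul ?_
  exact Finset.measurable_fun_prod _ fun k _ => (hf k).comp ((hx.sub (ht k)).prodMk (hξ k))

lemma measurable_symbolTransform {m : ℕ}
    {F : (Fin (m + 1) → Rd d) → (Fin (m + 1) → Rd d) → ℝ≥0∞}
    (hF : Measurable (Function.uncurry F)) {f : Fin m → Rd d → Rd d → ℝ≥0∞}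
    (hf : ∀ k, Measurable (Function.uncurry (f k))) :
    Measurable (Function.uncurry (symbolTransform F f)) :=
  (measurable_symbolTransform_integrand hF hf).lintegral_prod_right'.lintegral_prod_right'

/-- Boundedness of the transform of symbols on mixed norm spaces. -/
lemma mixedNorm_symbolTransform_le {m : ℕ} {r s : Fin (m + 1) → ℝ≥0∞} {p q : Fin m → ℝ≥0∞}
    {a b : ℝ≥0∞} (ha : 1 ≤ a) (hr : ∀ i, 1 ≤ r i) (hs : ∀ i, 1 ≤ s i) (hp : ∀ i, 1 ≤ p i)
    (hq : ∀ i, 1 ≤ q i)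
    (hr₁ : ∀ k : Fin m, (r k.castSucc)⁻¹ + (p k)⁻¹ ≤ 1)
    (hr₂ : ∀ k : Fin m, 1 ≤ (p k)⁻¹ + (r k.succ)⁻¹)
    (hrs : m + a⁻¹ = (r 0)⁻¹ + ∑ k : Fin m, ((p k)⁻¹ + (r k.succ)⁻¹))
    (hs₁ : ∀ k : Fin m, (s k.castSucc)⁻¹ + (q k)⁻¹ ≤ 1)
    (hs₂ : ∀ k : Fin m, 1 ≤ (q k)⁻¹ + (s k.succ)⁻¹)
    (hss : m + b⁻¹ = (s (Fin.last m))⁻¹ + ∑ k : Fin m, ((q k)⁻¹ + (s k.castSucc)⁻¹))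
    {F : (Fin (m + 1) → Rd d) → (Fin (m + 1) → Rd d) → ℝ≥0∞}
    (hF : Measurable (Function.uncurry F)) {f : Fin m → Rd d → Rd d → ℝ≥0∞}
    (hf : ∀ k, Measurable (Function.uncurry (f k))) :
    eLpNorm (fun ω => eLpNorm (fun x => symbolTransform F f x ω) a volume) b volume ≤
      iteratedNorm (m + 1) s (fun c => iteratedNorm (m + 1) r (fun y => F y c)) *
        ∏ k, eLpNorm (fun ξ => eLpNorm (fun t => f k t ξ) (p k) volume) (q k) volume := by
  refine le_trans (eLpNorm_mono_ennreal fun ω => ?_)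
    (eLpNorm_lintegral_snoc_mul_prod_le hs hq hs₁ hs₂ hss (measurable_iteratedNorm r hF)
      (fun k => measurable_eLpNorm_right (p k) (hf k)))
  have hint := measurable_symbolTransform_integrand hF hf
  -- Minkowski takes the integral over `ξ` out of the norm in `x`. For frozen `ξ` the time estimate
  -- applies, and its right side is the integrand of the frequency estimate.
  refine (eLpNorm_lintegral_le ha (F := fun x ξ => ∫⁻ t : Fin m → Rd d,
    F (Fin.cons x t) (Fin.snoc ξ (ω - ∑ k, ξ k)) * ∏ k, f k (x - t k) (ξ k)) ?_).trans
    (lintegral_mono fun ξ => ?_)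
  · exact hint.lintegral_prod_right'.comp
      ((measurable_fst.prodMk measurable_const).prodMk measurable_snd)
  · exact eLpNorm_lintegral_prod_comp_sub_le hr hp hr₁ hr₂ hrs
      (F := fun y => F y (Fin.snoc ξ (ω - ∑ k, ξ k))) (hF.comp measurable_prodMk_right)
      (f := fun k t => f k t (ξ k)) (fun k => (hf k).comp measurable_prodMk_right)

/-- Young's inequality for mixed norms and a product kernel. -/
lemma mixedNorm_conv_le {p q a b e₁ e₂ : ℝ≥0∞} (hp : 1 ≤ p) (ha : 1 ≤ a) (hb : 1 ≤ b)
    (he₁ : 1 ≤ e₁) (he₂ : 1 ≤ e₂) (h₁ : 1 + p⁻¹ = a⁻¹ + e₁⁻¹) (h₂ : 1 + q⁻¹ = b⁻¹ + e₂⁻¹)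
    {H : Rd d → Rd d → ℝ≥0∞} (hH : Measurable (Function.uncurry H))
    {k : Rd d → ℝ≥0∞} (hk : Measurable k) :
    eLpNorm (fun ζ => eLpNorm (fun z => ∫⁻ ω, ∫⁻ x, H x ω * k (z - x) * k (ζ - ω)) p volume) q
      (volume : Measure (Rd d)) ≤
      eLpNorm (fun ω => eLpNorm (fun x => H x ω) a volume) b volume *
        (eLpNorm k e₁ volume * eLpNorm k e₂ volume) := by
  have hint : Measurable (fun z : ((Rd d × Rd d) × Rd d) × Rd d =>
      H z.2 z.1.2 * k (z.1.1.1 - z.2) * k (z.1.1.2 - z.1.2)) := by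
    have h1 : Measurable (fun z : ((Rd d × Rd d) × Rd d) × Rd d => H z.2 z.1.2) :=
      hH.comp (measurable_snd.prodMk (measurable_snd.comp measurable_fst))
    exact (h1.mul (hk.comp ((measurable_fst.comp (measurable_fst.comp measurable_fst)).sub
      measurable_snd))).mul (hk.comp ((measurable_snd.comp (measurable_fst.comp
        measurable_fst)).sub (measurable_snd.comp measurable_fst)))
  have hHa : Measurable (fun ω => eLpNorm (fun x => H x ω) a volume * eLpNorm k e₁ volume) :=
    (measurable_eLpNorm_right a hH).mul_const _
  have hks : ∀ z : Rd d, Measurable (fun x => k (z - x)) := fun z =>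
    hk.comp (measurable_const.sub measurable_id)
  have hstep : ∀ ζ : Rd d,
      eLpNorm (fun z => ∫⁻ ω, ∫⁻ x, H x ω * k (z - x) * k (ζ - ω)) p volume ≤
        ∫⁻ ω, (eLpNorm (fun x => H x ω) a volume * eLpNorm k e₁ volume) * k (ζ - ω) := by
    intro ζ
    refine (eLpNorm_lintegral_le hp (F := fun z ω => ∫⁻ x, H x ω * k (z - x) * k (ζ - ω))
      (hint.lintegral_prod_right'.comp
      ((measurable_fst.prodMk measurable_const).prodMk measurable_snd))).trans
      (lintegral_mono fun ω => ?_)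
    have hHω : Measurable fun x => H x ω := hH.comp measurable_prodMk_right
    have hc : Measurable fun z : Rd d => ∫⁻ x, H x ω * k (z - x) :=
      Measurable.lintegral_prod_right' (f := fun z : Rd d × Rd d => H z.2 ω * k (z.1 - z.2))
        ((hHω.comp measurable_snd).mul (hk.comp (measurable_fst.sub measurable_snd)))
    have h3 : ∀ z : Rd d, ∫⁻ x, H x ω * k (z - x) * k (ζ - ω) =
        k (ζ - ω) * ∫⁻ x, H x ω * k (z - x) := by
      intro z
      have hm : Measurable fun x => H x ω * k (z - x) := hHω.mul (hks z)
      rw [lintegral_mul_const _ hm, mul_comm]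
    simp_rw [h3]
    refine (eLpNorm_const_mul_le _ hc).trans ?_
    rw [mul_comm]
    gcongr
    exact eLpNorm_conv_le ha he₁ h₁ hHω hk
  refine (eLpNorm_mono_ennreal hstep).trans ?_
  refine (eLpNorm_conv_le hb he₂ h₂ hHa hk).trans ?_
  rw [← mul_assoc]
  gcongr
  simp_rw [mul_comm _ (eLpNorm k e₁ volume)]
  exact eLpNorm_const_mul_le _ (measurable_eLpNorm_right a hH)

end MixedEstimates

/-! ### Schwartz seminorms and translations -/

section SchwartzSeminorms

variable {V : Type} [NormedAddCommGroup V] [InnerProductSpace ℝ V]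

/-- An increasing sequence of seminorms defining the topology of the Schwartz space. -/
noncomputable def schwartzSup (V : Type) [NormedAddCommGroup V] [InnerProductSpace ℝ V] (N : ℕ) :
    Seminorm ℂ 𝓢(V, ℂ) :=
  (Finset.Iic (N, N)).sup (schwartzSeminormFamily ℂ V ℂ)

lemma seminorm_le_schwartzSup {k n N : ℕ} (hk : k ≤ N) (hn : n ≤ N) (f : 𝓢(V, ℂ)) :
    SchwartzMap.seminorm ℂ k n f ≤ schwartzSup V N f := by
  have h : (k, n) ∈ Finset.Iic (N, N) := Finset.mem_Iic.2 ⟨hk, hn⟩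
  exact Finset.le_sup (f := schwartzSeminormFamily ℂ V ℂ) h f

lemma schwartzSup_le {N : ℕ} {f : 𝓢(V, ℂ)} {C : ℝ} (hC : 0 ≤ C)
    (h : ∀ k n, k ≤ N → n ≤ N → SchwartzMap.seminorm ℂ k n f ≤ C) : schwartzSup V N f ≤ C :=
  Seminorm.finset_sup_apply_le hC fun i hi => h i.1 i.2 (Finset.mem_Iic.1 hi).1
    (Finset.mem_Iic.1 hi).2

lemma schwartzSup_mono {N M : ℕ} (h : N ≤ M) (f : 𝓢(V, ℂ)) :
    schwartzSup V N f ≤ schwartzSup V M f :=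
  schwartzSup_le (apply_nonneg _ _) fun _ _ hk hn =>
    seminorm_le_schwartzSup (hk.trans h) (hn.trans h) f

lemma exists_le_schwartzSup {q : Seminorm ℂ 𝓢(V, ℂ)} (hq : Continuous q) :
    ∃ (N : ℕ) (C : ℝ), 0 ≤ C ∧ ∀ f, q f ≤ C * schwartzSup V N f := by
  obtain ⟨s, C, -, h⟩ := Seminorm.bound_of_continuous (schwartz_withSeminorms ℂ V ℂ) q hq
  refine ⟨s.sup (fun i => max i.1 i.2), C, C.2, fun f => (h f).trans ?_⟩
  change C * (s.sup (schwartzSeminormFamily ℂ V ℂ)) f ≤ _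
  gcongr
  refine Seminorm.finset_sup_apply_le (apply_nonneg _ _) fun i hi => ?_
  have h1 : max i.1 i.2 ≤ s.sup (fun i => max i.1 i.2) :=
    Finset.le_sup (f := fun i : ℕ × ℕ => max i.1 i.2) hi
  exact seminorm_le_schwartzSup ((le_max_left _ _).trans h1) ((le_max_right _ _).trans h1) f

lemma continuous_schwartzSup (N : ℕ) : Continuous (schwartzSup V N) :=
  (schwartz_withSeminorms ℂ V ℂ).partial_sups.continuous_seminorm (N, N)

lemma exists_schwartzSup_map_le (A : 𝓢(V, ℂ) →L[ℂ] 𝓢(V, ℂ)) (N : ℕ) :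
    ∃ (M : ℕ) (C : ℝ), 0 ≤ C ∧ ∀ f, schwartzSup V N (A f) ≤ C * schwartzSup V M f :=
  exists_le_schwartzSup (q := (schwartzSup V N).comp A.toLinearMap)
    ((continuous_schwartzSup N).comp A.continuous)

lemma one_add_norm_pow_mul_le {k n N : ℕ} (hk : k ≤ N) (hn : n ≤ N) (f : 𝓢(V, ℂ)) (x : V) :
    (1 + ‖x‖) ^ k * ‖iteratedFDeriv ℝ n f x‖ ≤ 2 ^ N * schwartzSup V N f :=
  SchwartzMap.one_add_le_sup_seminorm_apply (𝕜 := ℂ) (m := (N, N)) hk hn f x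

lemma one_add_norm_pow_mul_apply_le {k N : ℕ} (hk : k ≤ N) (f : 𝓢(V, ℂ)) (x : V) :
    (1 + ‖x‖) ^ k * ‖f x‖ ≤ 2 ^ N * schwartzSup V N f := by
  simpa using one_add_norm_pow_mul_le hk (Nat.zero_le N) f x

omit [InnerProductSpace ℝ V] in
lemma one_add_norm_le_mul (x y : V) : 1 + ‖x‖ ≤ (1 + ‖y‖) * (1 + ‖x - y‖) := by
  have h : ‖x‖ ≤ ‖y‖ + ‖x - y‖ := by simpa using norm_add_le y (x - y)
  nlinarith [norm_nonneg y, norm_nonneg (x - y)]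

lemma schwartzSup_compSubConst_le (N : ℕ) (z : V) (f : 𝓢(V, ℂ)) :
    schwartzSup V N (SchwartzMap.compSubConstCLM ℂ z f) ≤
      2 ^ N * (1 + ‖z‖) ^ N * schwartzSup V N f := by
  have h0 : 0 ≤ schwartzSup V N f := apply_nonneg _ _
  refine schwartzSup_le (by positivity) fun k n hk hn => ?_
  refine SchwartzMap.seminorm_le_bound ℂ k n _ (by positivity) fun y => ?_
  have h1 : iteratedFDeriv ℝ n (SchwartzMap.compSubConstCLM ℂ z f) y =
      iteratedFDeriv ℝ n f (y - z) := iteratedFDeriv_comp_sub n z y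
  rw [h1]
  calc ‖y‖ ^ k * ‖iteratedFDeriv ℝ n f (y - z)‖
      ≤ ((1 + ‖z‖) * (1 + ‖y - z‖)) ^ k * ‖iteratedFDeriv ℝ n f (y - z)‖ := by
        gcongr
        linarith [one_add_norm_le_mul y z]
    _ = (1 + ‖z‖) ^ k * ((1 + ‖y - z‖) ^ k * ‖iteratedFDeriv ℝ n f (y - z)‖) := by
        rw [mul_pow]; ring
    _ ≤ (1 + ‖z‖) ^ N * (2 ^ N * schwartzSup V N f) := by
        refine mul_le_mul ?_ (one_add_norm_pow_mul_le hk hn f _) (by positivity) (by positivity)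
        exact pow_le_pow_right₀ (by linarith [norm_nonneg z]) hk
    _ = _ := by ring

/-- Mean value inequality on the segment from `y` to `y - z`, at the price of one more derivative.
-/
lemma schwartzSup_compSubConst_sub_le (N : ℕ) (z : V) (f : 𝓢(V, ℂ)) :
    schwartzSup V N (SchwartzMap.compSubConstCLM ℂ z f - f) ≤
      ‖z‖ * ((1 + ‖z‖) ^ N * (2 ^ (N + 1) * schwartzSup V (N + 1) f)) := by
  have h0 : 0 ≤ schwartzSup V (N + 1) f := apply_nonneg _ _
  refine schwartzSup_le (by positivity) fun k n hk hn => ?_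
  refine SchwartzMap.seminorm_le_bound ℂ k n _ (by positivity) fun y => ?_
  have h1 : iteratedFDeriv ℝ n (SchwartzMap.compSubConstCLM ℂ z f - f : 𝓢(V, ℂ)) y =
      iteratedFDeriv ℝ n f (y - z) - iteratedFDeriv ℝ n f y := by
    have h2 : iteratedFDeriv ℝ n (SchwartzMap.compSubConstCLM ℂ z f) y =
      iteratedFDeriv ℝ n f (y - z) := iteratedFDeriv_comp_sub n z y
    rw [← h2]
    exact iteratedFDeriv_sub_apply ((SchwartzMap.smooth _ ⊤).of_le (mod_cast le_top)).contDiffAt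
      ((SchwartzMap.smooth _ ⊤).of_le (mod_cast le_top)).contDiffAt
  rw [h1]
  have hdiff : ∀ w ∈ segment ℝ y (y - z), DifferentiableAt ℝ (iteratedFDeriv ℝ n f) w :=
    fun w _ => ((f.smooth ⊤).differentiable_iteratedFDeriv
      (by exact_mod_cast WithTop.coe_lt_top (n : ℕ))) w
  have hbound : ∀ w ∈ segment ℝ y (y - z),
      ‖y‖ ^ k * ‖fderiv ℝ (iteratedFDeriv ℝ n f) w‖ ≤
        (1 + ‖z‖) ^ N * (2 ^ (N + 1) * schwartzSup V (N + 1) f) := by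
    intro w hw
    rw [norm_fderiv_iteratedFDeriv]
    have hyw : ‖y - w‖ ≤ ‖z‖ := by
      obtain ⟨a, b, ha, hb, hab, rfl⟩ := hw
      have : y - (a • y + b • (y - z)) = b • z := by
        rw [smul_sub, ← add_sub_assoc, ← add_smul, hab, one_smul]; abel
      rw [this, norm_smul, Real.norm_of_nonneg hb]
      exact mul_le_of_le_one_left (norm_nonneg _) (by linarith)
    calc ‖y‖ ^ k * ‖iteratedFDeriv ℝ (n + 1) f w‖
        ≤ ((1 + ‖z‖) * (1 + ‖w‖)) ^ k * ‖iteratedFDeriv ℝ (n + 1) f w‖ := by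
          gcongr
          have h3 := one_add_norm_le_mul y w
          nlinarith [norm_nonneg w, norm_nonneg y]
      _ = (1 + ‖z‖) ^ k * ((1 + ‖w‖) ^ k * ‖iteratedFDeriv ℝ (n + 1) f w‖) := by
          rw [mul_pow]; ring
      _ ≤ _ := by
          refine mul_le_mul ?_ (one_add_norm_pow_mul_le (by omega) (by omega) f _)
            (by positivity) (by positivity)
          exact pow_le_pow_right₀ (by linarith [norm_nonneg z]) hk
  -- The weight `‖y‖ ^ k` is constant along the segment and is divided out. At `y = 0` only `k = 0`
  -- leaves something to prove.
  rcases (norm_nonneg y).eq_or_lt with hy | hy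
  · rcases Nat.eq_zero_or_pos k with rfl | hk0
    · have := (convex_segment y (y - z)).norm_image_sub_le_of_norm_fderiv_le hdiff
        (fun w hw => by simpa using hbound w hw) (left_mem_segment ℝ _ _) (right_mem_segment ℝ _ _)
      simp only [pow_zero, one_mul]
      refine this.trans_eq ?_
      rw [sub_sub_cancel_left, norm_neg, mul_comm]
    · rw [← hy, zero_pow hk0.ne', zero_mul]; positivity
  · have hyk : 0 < ‖y‖ ^ k := by positivity
    have := (convex_segment y (y - z)).norm_image_sub_le_of_norm_fderiv_le hdiff
      (C := ((1 + ‖z‖) ^ N * (2 ^ (N + 1) * schwartzSup V (N + 1) f)) / ‖y‖ ^ k)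
      (fun w hw => by rw [le_div_iff₀ hyk, mul_comm]; exact hbound w hw)
      (left_mem_segment ℝ _ _) (right_mem_segment ℝ _ _)
    rw [sub_sub_cancel_left, norm_neg, div_mul_eq_mul_div, le_div_iff₀ hyk] at this
    linarith

/-- Translation is jointly continuous on the Schwartz space. -/
lemma continuous_compSubConst {X : Type*} [TopologicalSpace X] {z : X → V} {f : X → 𝓢(V, ℂ)}
    (hz : Continuous z) (hf : Continuous f) :
    Continuous (fun x => SchwartzMap.compSubConstCLM ℂ (z x) (f x)) := by
  rw [continuous_iff_continuousAt]
  intro x₀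
  refine ((schwartz_withSeminorms ℂ V ℂ).tendsto_nhds _ _).2 ?_
  rintro ⟨k, n⟩ ε hε
  set N := max k n
  have hlim : Filter.Tendsto (fun x => 2 ^ N * (1 + ‖z x‖) ^ N * schwartzSup V N (f x - f x₀) +
      2 ^ N * (1 + ‖z x₀‖) ^ N * (‖z x - z x₀‖ * ((1 + ‖z x - z x₀‖) ^ N *
        (2 ^ (N + 1) * schwartzSup V (N + 1) (f x₀))))) (nhds x₀) (nhds 0) := by
    have hc : Continuous (fun x => 2 ^ N * (1 + ‖z x‖) ^ N * schwartzSup V N (f x - f x₀) +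
      2 ^ N * (1 + ‖z x₀‖) ^ N * (‖z x - z x₀‖ * ((1 + ‖z x - z x₀‖) ^ N *
        (2 ^ (N + 1) * schwartzSup V (N + 1) (f x₀))))) := by
      have h1 : Continuous fun x => schwartzSup V N (f x - f x₀) :=
        (continuous_schwartzSup N).comp (hf.sub continuous_const)
      fun_prop
    have := hc.tendsto x₀
    simpa using this
  filter_upwards [hlim.eventually (gt_mem_nhds hε)] with x hx
  refine lt_of_le_of_lt ?_ hx
  -- The first term is small because `f x → f x₀` and translations by bounded vectors are uniformly
  -- bounded; the second is a fixed translation of a small increment of the fixed function `f x₀`.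
  have hsplit : SchwartzMap.compSubConstCLM ℂ (z x) (f x) -
      SchwartzMap.compSubConstCLM ℂ (z x₀) (f x₀) =
      SchwartzMap.compSubConstCLM ℂ (z x) (f x - f x₀) + SchwartzMap.compSubConstCLM ℂ (z x₀)
        (SchwartzMap.compSubConstCLM ℂ (z x - z x₀) (f x₀) - f x₀) := by
    ext y
    simp only [map_sub, SchwartzMap.compSubConstCLM_comp]
    simp
  rw [hsplit]
  calc _ ≤ schwartzSup V N (SchwartzMap.compSubConstCLM ℂ (z x) (f x - f x₀) +
        SchwartzMap.compSubConstCLM ℂ (z x₀)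
          (SchwartzMap.compSubConstCLM ℂ (z x - z x₀) (f x₀) - f x₀)) :=
        seminorm_le_schwartzSup (le_max_left _ _) (le_max_right _ _) _
    _ ≤ _ := (map_add_le_add _ _ _).trans (add_le_add (schwartzSup_compSubConst_le N _ _)
        ((schwartzSup_compSubConst_le N _ _).trans (by
          gcongr
          exact schwartzSup_compSubConst_sub_le N _ _)))

end SchwartzSeminorms

/-! ### Continuity, growth and decay of short-time Fourier transforms -/

section ShortTimeFourier

variable {V : Type} [NormedAddCommGroup V] [InnerProductSpace ℝ V] [FiniteDimensional ℝ V]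
  [MeasurableSpace V] [BorelSpace V]

lemma fourier_tfShift (φ : 𝓢(V, ℂ)) (z ζ : V) :
    𝓕 (tfShift φ z ζ) =
      SchwartzMap.compSubConstCLM ℂ (-ζ) (𝓕 (SchwartzMap.compSubConstCLM ℂ z φ)) := by
  ext ξ
  rw [SchwartzMap.compSubConstCLM_apply]
  simp only [SchwartzMap.fourier_coe]
  rw [Real.fourier_eq', Real.fourier_eq']
  congr 1
  funext y
  rw [tfShift_apply, smul_eq_mul, smul_eq_mul, ← mul_assoc, ← Complex.exp_add,
    SchwartzMap.compSubConstCLM_apply]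
  congr 2
  rw [sub_neg_eq_add, inner_add_right]
  push_cast
  ring

/-- Modulations are translations on the Fourier side. Continuity and polynomial growth of `tfShift`
in `(z, ζ)` thus follow from the estimates for translations alone. -/
lemma tfShift_eq_fourierInv (φ : 𝓢(V, ℂ)) (z ζ : V) :
    tfShift φ z ζ = 𝓕⁻ (SchwartzMap.compSubConstCLM ℂ (-ζ)
      (𝓕 (SchwartzMap.compSubConstCLM ℂ z φ))) := by
  rw [← fourier_tfShift, FourierTransform.fourierInv_fourier_eq]

lemma continuous_tfShift {X : Type*} [TopologicalSpace X] (φ : 𝓢(V, ℂ)) {z ζ : X → V}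
    (hz : Continuous z) (hζ : Continuous ζ) : Continuous (fun x => tfShift φ (z x) (ζ x)) := by
  simp_rw [tfShift_eq_fourierInv]
  have h1 : Continuous fun x => 𝓕 (SchwartzMap.compSubConstCLM ℂ (z x) φ) :=
    (FourierTransform.fourierCLM ℂ 𝓢(V, ℂ)).continuous.comp
      (continuous_compSubConst hz continuous_const)
  exact (FourierTransform.fourierInvCLM ℂ 𝓢(V, ℂ)).continuous.comp
    (continuous_compSubConst hζ.neg h1)

lemma continuous_stft {X : Type*} [TopologicalSpace X] (φ : 𝓢(V, ℂ)) (f : 𝓢'(V, ℂ)) {z ζ : X → V}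
    (hz : Continuous z) (hζ : Continuous ζ) : Continuous (fun x => stft φ f (z x) (ζ x)) :=
  f.continuous.comp (continuous_tfShift φ hz hζ)

lemma exists_schwartzSup_tfShift_le (φ : 𝓢(V, ℂ)) (N : ℕ) :
    ∃ (M : ℕ) (C : ℝ), 0 ≤ C ∧ ∀ z ζ : V,
      schwartzSup V N (tfShift φ z ζ) ≤ C * (1 + ‖z‖) ^ M * (1 + ‖ζ‖) ^ M := by
  obtain ⟨M₁, C₁, hC₁, h₁⟩ := exists_schwartzSup_map_le (FourierTransform.fourierInvCLM ℂ 𝓢(V, ℂ)) N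
  obtain ⟨M₂, C₂, hC₂, h₂⟩ := exists_schwartzSup_map_le (FourierTransform.fourierCLM ℂ 𝓢(V, ℂ)) M₁
  have h0 : 0 ≤ schwartzSup V M₂ φ := apply_nonneg _ _
  refine ⟨max M₁ M₂, C₁ * (2 ^ M₁ * (C₂ * (2 ^ M₂ * schwartzSup V M₂ φ))), by positivity,
    fun z ζ => ?_⟩
  rw [tfShift_eq_fourierInv]
  have hz : (1 : ℝ) ≤ 1 + ‖z‖ := by linarith [norm_nonneg z]
  have hζ : (1 : ℝ) ≤ 1 + ‖ζ‖ := by linarith [norm_nonneg ζ]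
  calc _ ≤ C₁ * schwartzSup V M₁ (SchwartzMap.compSubConstCLM ℂ (-ζ)
        (𝓕 (SchwartzMap.compSubConstCLM ℂ z φ))) := h₁ _
    _ ≤ C₁ * (2 ^ M₁ * (1 + ‖-ζ‖) ^ M₁ *
        schwartzSup V M₁ (𝓕 (SchwartzMap.compSubConstCLM ℂ z φ))) := by
        gcongr
        exact schwartzSup_compSubConst_le _ _ _
    _ ≤ C₁ * (2 ^ M₁ * (1 + ‖-ζ‖) ^ M₁ *
        (C₂ * schwartzSup V M₂ (SchwartzMap.compSubConstCLM ℂ z φ))) := by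
        gcongr
        exact h₂ _
    _ ≤ C₁ * (2 ^ M₁ * (1 + ‖-ζ‖) ^ M₁ *
        (C₂ * (2 ^ M₂ * (1 + ‖z‖) ^ M₂ * schwartzSup V M₂ φ))) := by
        gcongr
        exact schwartzSup_compSubConst_le _ _ _
    _ = C₁ * (2 ^ M₁ * (C₂ * (2 ^ M₂ * schwartzSup V M₂ φ))) * (1 + ‖z‖) ^ M₂ *
        (1 + ‖ζ‖) ^ M₁ := by rw [norm_neg]; ring
    _ ≤ _ := by
        gcongr
        · exact le_max_right _ _
        · exact le_max_left _ _

lemma stft_coe (φ ψ : 𝓢(V, ℂ)) (z ζ : V) :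
    stft φ (ψ : 𝓢'(V, ℂ)) z ζ = ∫ y, tfShift φ z ζ y * ψ y := by
  rw [stft, SchwartzMap.coe_apply]
  rfl

omit [FiniteDimensional ℝ V] [MeasurableSpace V] [BorelSpace V] in
lemma norm_tfShift_apply (φ : 𝓢(V, ℂ)) (z ζ y : V) : ‖tfShift φ z ζ y‖ = ‖φ (y - z)‖ := by
  rw [tfShift_apply, norm_mul, Complex.norm_exp_ofReal_mul_I, one_mul]

lemma fourier_compSubConst (φ : 𝓢(V, ℂ)) (z ξ : V) :
    𝓕 (SchwartzMap.compSubConstCLM ℂ z φ) ξ =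
      Complex.exp (((-2 * Real.pi * inner ℝ z ξ : ℝ) : ℂ) * Complex.I) * 𝓕 φ ξ := by
  simp only [SchwartzMap.fourier_coe]
  rw [Real.fourier_eq', Real.fourier_eq', ← integral_const_mul]
  conv_rhs => rw [← integral_sub_right_eq_self _ z]
  congr 1
  funext y
  rw [smul_eq_mul, smul_eq_mul, ← mul_assoc, ← Complex.exp_add,
    SchwartzMap.compSubConstCLM_apply]
  congr 2
  rw [inner_sub_left]
  push_cast
  ring

lemma norm_fourier_compSubConst (φ : 𝓢(V, ℂ)) (z ξ : V) :
    ‖𝓕 (SchwartzMap.compSubConstCLM ℂ z φ) ξ‖ = ‖𝓕 φ ξ‖ := by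
  rw [fourier_compSubConst, norm_mul, Complex.norm_exp_ofReal_mul_I, one_mul]

/-- The growth in `z` is shared out by `1 + ‖z‖ ≤ (1 + ‖y‖)(1 + ‖y - z‖)`, and each Schwartz
function absorbs its part. The extra `dim V + 1` powers make the `y`-integral converge. -/
lemma exists_norm_integral_le (N : ℕ) : ∃ (M : ℕ) (C : ℝ), 0 ≤ C ∧
    ∀ (f g : 𝓢(V, ℂ)) (F : V → ℂ) (z : V), (∀ y, ‖F y‖ ≤ ‖f y‖ * ‖g (y - z)‖) →
      ‖∫ y, F y‖ * (1 + ‖z‖) ^ N ≤ C * (schwartzSup V M f * schwartzSup V M g) := by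
  set D := Module.finrank ℝ V + 1 with hD
  have hint : Integrable (fun y : V => (1 + ‖y‖) ^ (-(D : ℝ))) :=
    integrable_one_add_norm (by rw [hD]; push_cast; linarith)
  refine ⟨N + D, 2 ^ (N + D) * 2 ^ (N + D) * ∫ y : V, (1 + ‖y‖) ^ (-(D : ℝ)), ?_,
    fun f g F z hF => ?_⟩
  · have : 0 ≤ ∫ y : V, (1 + ‖y‖) ^ (-(D : ℝ)) := integral_nonneg fun y => by positivity
    positivity
  have hb : ∀ y, ‖F y * ((1 + ‖z‖) ^ N : ℝ)‖ ≤ 2 ^ (N + D) * schwartzSup V (N + D) f *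
      (2 ^ (N + D) * schwartzSup V (N + D) g) * (1 + ‖y‖) ^ (-(D : ℝ)) := by
    intro y
    have hy : (0 : ℝ) < 1 + ‖y‖ := by positivity
    have hz : 1 + ‖z‖ ≤ (1 + ‖y‖) * (1 + ‖y - z‖) := by
      rw [norm_sub_rev]; exact one_add_norm_le_mul z y
    rw [Real.rpow_neg hy.le, Real.rpow_natCast, ← div_eq_mul_inv, le_div_iff₀ (by positivity),
      norm_mul, Complex.norm_real, Real.norm_of_nonneg (by positivity)]
    calc ‖F y‖ * (1 + ‖z‖) ^ N * (1 + ‖y‖) ^ D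
        ≤ (‖f y‖ * ‖g (y - z)‖) * ((1 + ‖y‖) * (1 + ‖y - z‖)) ^ N * (1 + ‖y‖) ^ D := by
          gcongr
          exact hF y
      _ = ((1 + ‖y‖) ^ (N + D) * ‖f y‖) * ((1 + ‖y - z‖) ^ N * ‖g (y - z)‖) := by
          rw [mul_pow, pow_add]; ring
      _ ≤ _ := mul_le_mul (one_add_norm_pow_mul_apply_le le_rfl f y)
          (one_add_norm_pow_mul_apply_le (by omega) g _) (by positivity)
          (mul_nonneg (by positivity) (apply_nonneg _ _))
  have h1 := norm_integral_le_of_norm_le (hint.const_mul _) (Filter.Eventually.of_forall hb)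
  rw [integral_mul_const, integral_const_mul, norm_mul, Complex.norm_real,
    Real.norm_of_nonneg (by positivity)] at h1
  refine h1.trans_eq ?_
  ring

/-- Rapid decay of the short-time Fourier transform of a Schwartz function. -/
lemma exists_norm_stft_coe_le (φ : 𝓢(V, ℂ)) (N : ℕ) : ∃ (M : ℕ) (C : ℝ), 0 ≤ C ∧
    ∀ (ψ : 𝓢(V, ℂ)) (z ζ : V), ‖stft φ (ψ : 𝓢'(V, ℂ)) z ζ‖ * ((1 + ‖z‖) ^ N * (1 + ‖ζ‖) ^ N) ≤
      C * schwartzSup V M ψ := by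
  -- The decay in `z` and in `ζ` is obtained separately, the latter by Parseval. Bounding a product
  -- of two powers by their squares halves the exponents, whence `2 * N`.
  obtain ⟨M, C, hC, h⟩ := exists_norm_integral_le (V := V) (2 * N)
  obtain ⟨M', C', hC', h'⟩ := exists_schwartzSup_map_le
    (FourierTransform.fourierInvCLM ℂ 𝓢(V, ℂ)) M
  have h0 : 0 ≤ schwartzSup V M φ := apply_nonneg _ _
  have h1 : 0 ≤ schwartzSup V M (𝓕 φ) := apply_nonneg _ _
  refine ⟨max M M', C * schwartzSup V M φ + C * (C' * schwartzSup V M (𝓕 φ)),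
    by positivity, fun ψ z ζ => ?_⟩
  have hψ : 0 ≤ schwartzSup V (max M M') ψ := apply_nonneg _ _
  set A := ‖stft φ (ψ : 𝓢'(V, ℂ)) z ζ‖ with hA
  have hz : A * (1 + ‖z‖) ^ (2 * N) ≤ C * schwartzSup V M φ * schwartzSup V (max M M') ψ := by
    rw [hA, stft_coe]
    refine (h ψ φ _ z fun y => ?_).trans ?_
    · rw [norm_mul, norm_tfShift_apply, mul_comm]
    · rw [mul_comm (schwartzSup V M ψ), ← mul_assoc]
      gcongr
      exact schwartzSup_mono (le_max_left _ _) _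
  have hζ : A * (1 + ‖ζ‖) ^ (2 * N) ≤
      C * (C' * schwartzSup V M (𝓕 φ)) * schwartzSup V (max M M') ψ := by
    have hpars : stft φ (ψ : 𝓢'(V, ℂ)) z ζ = ∫ η, 𝓕⁻ ψ η * 𝓕 (tfShift φ z ζ) η := by
      rw [← SchwartzMap.integral_fourier_mul_eq, FourierTransform.fourier_fourierInv_eq, stft_coe]
      congr 1
      funext y
      rw [mul_comm]
    rw [hA, hpars, ← norm_neg ζ]
    refine (h (𝓕⁻ ψ) (𝓕 φ) _ (-ζ) fun y => ?_).trans ?_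
    · rw [norm_mul, fourier_tfShift, SchwartzMap.compSubConstCLM_apply, norm_fourier_compSubConst]
    · have := h' ψ
      calc C * (schwartzSup V M (𝓕⁻ ψ) * schwartzSup V M (𝓕 φ))
          ≤ C * ((C' * schwartzSup V (max M M') ψ) * schwartzSup V M (𝓕 φ)) := by
            gcongr
            refine (h' ψ).trans ?_
            gcongr
            exact schwartzSup_mono (le_max_right _ _) _
        _ = _ := by ring
  have hA0 : 0 ≤ A := norm_nonneg _
  rw [pow_mul'] at hz hζ
  nlinarith [mul_nonneg hA0 (sq_nonneg ((1 + ‖z‖) ^ N - (1 + ‖ζ‖) ^ N)),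
    mul_nonneg hA0 (sq_nonneg ((1 + ‖z‖) ^ N + (1 + ‖ζ‖) ^ N))]

end ShortTimeFourier

/-! ### Tempered distributions commute with integrals of Schwartz functions -/

section Interchange

variable {V : Type} [NormedAddCommGroup V] [InnerProductSpace ℝ V]

open scoped BoundedContinuousFunction

/-- Bounded continuous functions with values in a normed group. -/
abbrev NormedBCF (V W : Type*) [TopologicalSpace V] [NormedAddCommGroup W] := V →ᵇ W

/-- The values of an `n`-th derivative of a Schwartz function. -/
abbrev DerivSpace (V : Type) [NormedAddCommGroup V] [InnerProductSpace ℝ V] (n : ℕ) :=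
  ContinuousMultilinearMap ℝ (fun _ : Fin n => V) ℂ

/-- The bounded function `y ↦ ‖y‖ᵏ Dⁿf(y)` of a Schwartz function `f`. -/
noncomputable def weightedDerivFun (k n : ℕ) (f : 𝓢(V, ℂ)) : NormedBCF V (DerivSpace V n) :=
  BoundedContinuousFunction.ofNormedAddCommGroup
    (fun y => ‖y‖ ^ k • iteratedFDeriv ℝ n f y)
    ((continuous_norm.pow k).smul ((f.smooth ⊤).continuous_iteratedFDeriv
      (by exact_mod_cast le_top)))
    (SchwartzMap.seminorm ℂ k n f)
    (fun y => by
      rw [norm_smul, norm_pow, norm_norm]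
      exact SchwartzMap.le_seminorm ℂ k n f y)

lemma weightedDerivFun_apply (k n : ℕ) (f : 𝓢(V, ℂ)) (y : V) :
    weightedDerivFun k n f y = ‖y‖ ^ k • iteratedFDeriv ℝ n f y := rfl

lemma norm_weightedDerivFun_le (k n : ℕ) (f : 𝓢(V, ℂ)) :
    ‖weightedDerivFun k n f‖ ≤ SchwartzMap.seminorm ℂ k n f :=
  BoundedContinuousFunction.norm_ofNormedAddCommGroup_le _ (apply_nonneg _ _) _

/-- The map `f ↦ ‖·‖ᵏ Dⁿf` as a continuous linear map. -/
noncomputable def weightedDeriv (k n : ℕ) : 𝓢(V, ℂ) →L[ℂ] NormedBCF V (DerivSpace V n) :=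
  SchwartzMap.mkCLMtoNormedSpace (σ := RingHom.id ℂ) (weightedDerivFun k n)
    (fun f g => by
      refine BoundedContinuousFunction.ext fun y => ?_
      have h : iteratedFDeriv ℝ n (f + g : 𝓢(V, ℂ)) y =
          iteratedFDeriv ℝ n f y + iteratedFDeriv ℝ n g y :=
        iteratedFDeriv_add_apply ((SchwartzMap.smooth _ ⊤).of_le (mod_cast le_top)).contDiffAt
          ((SchwartzMap.smooth _ ⊤).of_le (mod_cast le_top)).contDiffAt
      rw [BoundedContinuousFunction.add_apply]
      simp only [weightedDerivFun_apply, h, smul_add])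
    (fun c f => by
      refine BoundedContinuousFunction.ext fun y => ?_
      have h : iteratedFDeriv ℝ n (c • f : 𝓢(V, ℂ)) y = c • iteratedFDeriv ℝ n f y :=
        iteratedFDeriv_const_smul_apply
          ((SchwartzMap.smooth _ ⊤).of_le (mod_cast le_top)).contDiffAt
      rw [BoundedContinuousFunction.smul_apply]
      simp only [weightedDerivFun_apply, h, RingHom.id_apply, smul_comm c])
    ⟨{(k, n)}, 1, zero_le_one, fun f => by
      simpa using norm_weightedDerivFun_le k n f⟩

lemma weightedDeriv_apply (k n : ℕ) (f : 𝓢(V, ℂ)) (y : V) :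
    weightedDeriv k n f y = ‖y‖ ^ k • iteratedFDeriv ℝ n f y := rfl

lemma norm_weightedDeriv_le {k n N : ℕ} (hk : k ≤ N) (hn : n ≤ N) (f : 𝓢(V, ℂ)) :
    ‖weightedDeriv k n f‖ ≤ schwartzSup V N f :=
  (norm_weightedDerivFun_le k n f).trans (seminorm_le_schwartzSup hk hn f)

/-- A functional which is bounded by finitely many norms `‖Jᵢ f‖` commutes with every integral with
which all the `Jᵢ` commute. -/
lemma map_integral_of_norm_le {S : Type*} [AddCommGroup S] [Module ℂ S] {Y : Type*}
    [MeasurableSpace Y] {μ : Measure Y} {ι : Type*} [Fintype ι] {E : ι → Type*}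
    [∀ i, NormedAddCommGroup (E i)] [∀ i, NormedSpace ℂ (E i)] [∀ i, CompleteSpace (E i)]
    (J : (i : ι) → S →ₗ[ℂ] E i) (hinj : ∀ f, (∀ i, J i f = 0) → f = 0) (σ : S →ₗ[ℂ] ℂ) {C : ℝ}
    (hσ : ∀ f, ‖σ f‖ ≤ C * ‖fun i => J i f‖) {G : Y → S} {Φ : S}
    (hint : ∀ i, Integrable (fun x => J i (G x)) μ) (hΦ : ∀ i, J i Φ = ∫ x, J i (G x) ∂μ) :
    σ Φ = ∫ x, σ (G x) ∂μ := by
  -- The functional is transported to the range of `K` in a Banach space, where it is bounded by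
  -- `hσ`, and extended by Hahn–Banach. The extension commutes with the Bochner integral there.
  let K : S →ₗ[ℂ] ((i : ι) → E i) := LinearMap.pi J
  have hK : Function.Injective K := (injective_iff_map_eq_zero _).2 fun f hf =>
    hinj f fun i => congrFun hf i
  let e := LinearEquiv.ofInjective K hK
  let ℓ : StrongDual ℂ (LinearMap.range K) :=
    LinearMap.mkContinuous (σ ∘ₗ (e.symm : _ →ₗ[ℂ] S)) C (by
      intro u
      obtain ⟨f, rfl⟩ := e.surjective u
      have h : ‖e f‖ = ‖fun i => J i f‖ := rfl
      rw [h]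
      simpa using hσ f)
  obtain ⟨L, hL, -⟩ := exists_extension_norm_eq _ ℓ
  have hLK : ∀ f, L (K f) = σ f := by
    intro f
    have h := hL (e f)
    rw [show ((e f : LinearMap.range K) : (i : ι) → E i) = K f from rfl] at h
    rw [h]
    simp [ℓ]
  have hKint : Integrable (fun x => K (G x)) μ := Integrable.of_eval hint
  have hKΦ : K Φ = ∫ x, K (G x) ∂μ := by
    funext i
    rw [eval_integral (f := fun x => K (G x)) hint]
    exact hΦ i
  rw [← hLK, hKΦ, ← L.integral_comp_comm hKint]
  simp_rw [hLK]

/-- Differentiation under the integral sign, for families with everywhere bounded derivatives. -/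
lemma fderiv_integral_apply {Y : Type*} [MeasurableSpace Y] {μ : Measure Y} {F : Type*}
    [NormedAddCommGroup F] [NormedSpace ℝ F] {f : Y → V → F}
    (hf : ∀ y, Integrable (fun x => f x y) μ) (hd : ∀ x, Differentiable ℝ (f x)) {b : Y → ℝ}
    (hb : Integrable b μ) (hle : ∀ x y, ‖fderiv ℝ (f x) y‖ ≤ b x)
    (hm : ∀ y, AEStronglyMeasurable (fun x => fderiv ℝ (f x) y) μ) (y v : V) :
    Integrable (fun x => fderiv ℝ (f x) y v) μ ∧
      fderiv ℝ (fun y => ∫ x, f x y ∂μ) y v = ∫ x, fderiv ℝ (f x) y v ∂μ := by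
  have hint : Integrable (fun x => fderiv ℝ (f x) y) μ :=
    hb.mono' (hm y) (Filter.Eventually.of_forall fun x => hle x y)
  have hder := hasFDerivAt_integral_of_dominated_of_fderiv_le (s := Set.univ) (x₀ := y)
    (F' := fun y x => fderiv ℝ (f x) y) (F := fun y x => f x y) (bound := b) Filter.univ_mem
    (Filter.Eventually.of_forall fun y => (hf y).aestronglyMeasurable) (hf y) (hm y)
    (Filter.Eventually.of_forall fun x y _ => hle x y) hb
    (Filter.Eventually.of_forall fun x y _ => (hd x y).hasFDerivAt)
  exact ⟨hint.apply_continuousLinearMap v,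
    by rw [hder.fderiv, ContinuousLinearMap.integral_apply hint]⟩

variable {X : Type*} [TopologicalSpace X] [SecondCountableTopology X] [MeasurableSpace X]
  [OpensMeasurableSpace X] {μ : Measure X}

lemma integrable_weightedDeriv {G : X → 𝓢(V, ℂ)} (hG : Continuous G)
    (hint : ∀ N, Integrable (fun x => schwartzSup V N (G x)) μ) (k n : ℕ) :
    Integrable (fun x => weightedDeriv k n (G x)) μ :=
  (hint (max k n)).mono' ((weightedDeriv k n).continuous.comp hG).aestronglyMeasurable
    (Filter.Eventually.of_forall fun _ =>
      norm_weightedDeriv_le (le_max_left k n) (le_max_right k n) _)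

lemma integrable_iteratedFDeriv {G : X → 𝓢(V, ℂ)} (hG : Continuous G)
    (hint : ∀ N, Integrable (fun x => schwartzSup V N (G x)) μ) (n : ℕ) (y : V) :
    Integrable (fun x => iteratedFDeriv ℝ n (G x) y) μ := by
  have h := (BoundedContinuousFunction.evalCLM ℂ y).integrable_comp
    (integrable_weightedDeriv hG hint 0 n)
  simpa [weightedDeriv_apply] using h

/-- Derivatives commute with integrals of families of Schwartz functions. -/
lemma iteratedFDeriv_integral_schwartz {G : X → 𝓢(V, ℂ)} (hG : Continuous G)
    (hint : ∀ N, Integrable (fun x => schwartzSup V N (G x)) μ) (n : ℕ) :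
    iteratedFDeriv ℝ n (fun y => ∫ x, G x y ∂μ) =
      fun y => ∫ x, iteratedFDeriv ℝ n (G x) y ∂μ := by
  induction n with
  | zero =>
    funext y
    simp only [iteratedFDeriv_zero_eq_comp, Function.comp_apply]
    exact ((continuousMultilinearCurryFin0 ℝ V
      ℂ).symm.toContinuousLinearEquiv.integral_comp_comm _).symm
  | succ n ih =>
    funext y
    ext v
    rw [ContinuousMultilinearMap.integral_apply (integrable_iteratedFDeriv hG hint (n + 1) y)]
    simp only [iteratedFDeriv_succ_apply_left]
    -- The derivative of order `n + 1` is dominated, uniformly in `y`, by the integrable function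
    -- `schwartzSup V (n + 1) (G x)`.
    obtain ⟨h₁, h₂⟩ := fderiv_integral_apply (integrable_iteratedFDeriv hG hint n)
      (fun x => ((G x).smooth ⊤).differentiable_iteratedFDeriv
        (by exact_mod_cast WithTop.coe_lt_top (n : ℕ))) (hint (n + 1)) (fun x y => by
        rw [norm_fderiv_iteratedFDeriv]
        exact (SchwartzMap.norm_iteratedFDeriv_le_seminorm ℂ (G x) (n + 1) y).trans
          (seminorm_le_schwartzSup (Nat.zero_le _) le_rfl _))
      (fun y => by
        simp_rw [fderiv_iteratedFDeriv]
        exact (LinearIsometryEquiv.continuous _).comp_aestronglyMeasurable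
          (integrable_iteratedFDeriv hG hint (n + 1) y).aestronglyMeasurable) y (v 0)
    rw [ih, h₂]
    exact ContinuousMultilinearMap.integral_apply h₁ _

/-- Continuous functionals commute with integrals of families of Schwartz functions. -/
lemma map_integral_schwartz {G : X → 𝓢(V, ℂ)} (hG : Continuous G)
    (hint : ∀ N, Integrable (fun x => schwartzSup V N (G x)) μ) {Φ : 𝓢(V, ℂ)}
    (hΦ : ∀ y, Φ y = ∫ x, G x y ∂μ) (σ : 𝓢'(V, ℂ)) :
    σ Φ = ∫ x, σ (G x) ∂μ := by
  -- A tempered distribution is controlled by finitely many seminorms, so finitely many maps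
  -- `weightedDeriv` suffice as coordinates; the index `(0, 0)` makes them jointly injective.
  obtain ⟨N, C, hC, hσ⟩ := exists_le_schwartzSup (V := V)
    (q := (normSeminorm ℂ ℂ).comp (σ : 𝓢(V, ℂ) →ₗ[ℂ] ℂ)) (continuous_norm.comp σ.continuous)
  refine map_integral_of_norm_le (ι := Finset.Iic (N, N))
    (E := fun i => NormedBCF V (DerivSpace V i.1.2))
    (fun i => (weightedDeriv (V := V) i.1.1 i.1.2).toLinearMap)
    (fun f hf => ?_) (σ : 𝓢(V, ℂ) →ₗ[ℂ] ℂ) (C := C) (fun f => ?_)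
    (fun i => integrable_weightedDeriv hG hint i.1.1 i.1.2) (fun i => ?_)
  · ext y
    have h := DFunLike.congr_fun (hf ⟨(0, 0), Finset.mem_Iic.2 (Prod.mk_le_mk.2
      ⟨Nat.zero_le _, Nat.zero_le _⟩)⟩) y
    have h' := congrArg norm h
    simpa [weightedDeriv_apply] using h'
  · refine (hσ f).trans (mul_le_mul_of_nonneg_left ?_ hC)
    refine schwartzSup_le (norm_nonneg _) fun k n hk hn => ?_
    refine SchwartzMap.seminorm_le_bound ℂ k n f (norm_nonneg _) fun y => ?_
    refine le_trans ?_ (norm_le_pi_norm (fun i : Finset.Iic (N, N) =>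
      weightedDeriv i.1.1 i.1.2 f) ⟨(k, n), Finset.mem_Iic.2 ⟨hk, hn⟩⟩)
    have := (weightedDeriv k n f).norm_coe_le_norm y
    rwa [weightedDeriv_apply, norm_smul, norm_pow, norm_norm] at this
  · refine BoundedContinuousFunction.ext fun y => ?_
    refine Eq.trans ?_ ((BoundedContinuousFunction.evalCLM ℂ y).integral_comp_comm
      (integrable_weightedDeriv hG hint i.1.1 i.1.2))
    have h4 : (Φ : V → ℂ) = fun y => ∫ x, G x y ∂μ := funext hΦ
    change ‖y‖ ^ i.1.1 • iteratedFDeriv ℝ i.1.2 Φ y =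
      ∫ x, ‖y‖ ^ i.1.1 • iteratedFDeriv ℝ i.1.2 (G x) y ∂μ
    rw [h4, iteratedFDeriv_integral_schwartz hG hint, integral_smul]

end Interchange

/-! ### Inversion formula -/

section Inversion

variable {V : Type} [NormedAddCommGroup V] [InnerProductSpace ℝ V] [FiniteDimensional ℝ V]
  [MeasurableSpace V] [BorelSpace V]

lemma integrable_one_add_norm_inv_mul (V : Type) [NormedAddCommGroup V] [InnerProductSpace ℝ V]
    [FiniteDimensional ℝ V] [MeasurableSpace V] [BorelSpace V] :
    Integrable (fun x : V × V => ((1 + ‖x.1‖) ^ (Module.finrank ℝ V + 1))⁻¹ *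
      ((1 + ‖x.2‖) ^ (Module.finrank ℝ V + 1))⁻¹) := by
  have hint : Integrable (fun y : V => ((1 + ‖y‖) ^ (Module.finrank ℝ V + 1))⁻¹) := by
    have h := integrable_one_add_norm (E := V) (μ := volume)
      (r := ((Module.finrank ℝ V + 1 : ℕ) : ℝ)) (by push_cast; linarith)
    refine h.congr (Filter.Eventually.of_forall fun y => ?_)
    have hy : (0 : ℝ) ≤ 1 + ‖y‖ := by positivity
    simp only [Real.rpow_neg hy, Real.rpow_natCast]
  exact hint.mul_prod hint

/-- The seminorms of `tfShift g` grow polynomially, while the transform of `Φ` decays faster than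
any power: `M` powers beat the growth and `dim V + 1` more give integrability. -/
lemma integrable_schwartzSup_stft_smul_tfShift (g γ Φ : 𝓢(V, ℂ)) (N : ℕ) :
    Integrable (fun x : V × V => schwartzSup V N
      (stft γ (Φ : 𝓢'(V, ℂ)) x.1 (-x.2) • tfShift g x.1 x.2)) := by
  obtain ⟨M, C, hC, h⟩ := exists_schwartzSup_tfShift_le g N
  obtain ⟨M', C', hC', h'⟩ := exists_norm_stft_coe_le γ (M + (Module.finrank ℝ V + 1))
  refine ((integrable_one_add_norm_inv_mul V).const_mul (C * (C' * schwartzSup V M' Φ))).mono'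
    ?_ (Filter.Eventually.of_forall fun x => ?_)
  · exact ((continuous_schwartzSup N).comp
      ((continuous_stft γ _ continuous_fst continuous_snd.neg).smul
        (continuous_tfShift g continuous_fst continuous_snd))).aestronglyMeasurable
  · have hx := h' Φ x.1 (-x.2)
    rw [Real.norm_of_nonneg (apply_nonneg _ _), map_smul_eq_mul, ← mul_inv, ← div_eq_mul_inv,
      le_div_iff₀ (by positivity)]
    rw [norm_neg, pow_add, pow_add] at hx
    calc _ ≤ ‖stft γ (Φ : 𝓢'(V, ℂ)) x.1 (-x.2)‖ * (C * (1 + ‖x.1‖) ^ M * (1 + ‖x.2‖) ^ M) *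
          ((1 + ‖x.1‖) ^ (Module.finrank ℝ V + 1) * (1 + ‖x.2‖) ^ (Module.finrank ℝ V + 1)) := by
          gcongr
          exact h _ _
      _ ≤ C * (C' * schwartzSup V M' Φ) := by
          refine le_trans (le_of_eq ?_) (mul_le_mul_of_nonneg_left hx hC)
          ring

/-- The product of two Schwartz functions. -/
noncomputable def schwartzMul (f g : 𝓢(V, ℂ)) : 𝓢(V, ℂ) := SchwartzMap.smulLeftCLM ℂ f g

omit [FiniteDimensional ℝ V] [MeasurableSpace V] [BorelSpace V] in
lemma schwartzMul_apply (f g : 𝓢(V, ℂ)) (y : V) : schwartzMul f g y = f y * g y := by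
  rw [schwartzMul, SchwartzMap.smulLeftCLM_apply_apply f.hasTemperateGrowth, smul_eq_mul]

lemma stft_coe_neg_eq_fourierInv (γ Φ : 𝓢(V, ℂ)) (z ζ : V) :
    stft γ (Φ : 𝓢'(V, ℂ)) z (-ζ) =
      𝓕⁻ (schwartzMul Φ (SchwartzMap.compSubConstCLM ℂ z γ)) ζ := by
  rw [stft_coe, SchwartzMap.fourierInv_coe, Real.fourierInv_eq']
  congr 1
  funext y
  rw [tfShift_apply, schwartzMul_apply, SchwartzMap.compSubConstCLM_apply, smul_eq_mul,
    inner_neg_right]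
  push_cast
  ring_nf

/-- The integral over `ζ` is Fourier inversion for `Φ · γ(· - z)`; the integral over `z` then leaves
`∫ g γ`. All pairings are bilinear, hence `-ζ` in place of a conjugate. -/
lemma integral_stft_smul_tfShift (g γ Φ : 𝓢(V, ℂ)) (y : V) :
    ∫ x : V × V, (stft γ (Φ : 𝓢'(V, ℂ)) x.1 (-x.2) • tfShift g x.1 x.2) y =
      Φ y * ∫ u, g u * γ u := by
  have hint : Integrable (fun x : V × V =>
      (stft γ (Φ : 𝓢'(V, ℂ)) x.1 (-x.2) • tfShift g x.1 x.2) y) (volume.prod volume) := by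
    refine (integrable_schwartzSup_stft_smul_tfShift g γ Φ 0).mono' ?_
      (Filter.Eventually.of_forall fun x => ?_)
    · have h : Continuous (fun x : V × V => stft γ (Φ : 𝓢'(V, ℂ)) x.1 (-x.2) •
          tfShift g x.1 x.2) := (continuous_stft γ _ continuous_fst continuous_snd.neg).smul
        (continuous_tfShift g continuous_fst continuous_snd)
      exact (((BoundedContinuousFunction.evalCLM ℂ y).continuous.comp
        (SchwartzMap.toBoundedContinuousFunctionCLM ℂ V ℂ).continuous).comp h).aestronglyMeasurable
    · exact (SchwartzMap.norm_le_seminorm ℂ _ y).trans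
        (seminorm_le_schwartzSup le_rfl le_rfl _)
  rw [Measure.volume_eq_prod, integral_prod _ hint]
  have hin : ∀ z : V, ∫ ζ, (stft γ (Φ : 𝓢'(V, ℂ)) z (-ζ) • tfShift g z ζ) y =
      Φ y * (g (y - z) * γ (y - z)) := by
    intro z
    have h1 : 𝓕 (𝓕⁻ (schwartzMul Φ (SchwartzMap.compSubConstCLM ℂ z γ))) y =
        Φ y * γ (y - z) := by
      rw [FourierTransform.fourier_fourierInv_eq, schwartzMul_apply,
        SchwartzMap.compSubConstCLM_apply]
    rw [← mul_assoc, mul_right_comm, ← h1, SchwartzMap.fourier_coe, Real.fourier_eq',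
      ← integral_mul_const]
    congr 1
    funext ζ
    rw [smul_apply, stft_coe_neg_eq_fourierInv, tfShift_apply, smul_eq_mul,
      smul_eq_mul, real_inner_comm]
    push_cast
    ring
  simp_rw [hin]
  rw [integral_const_mul, integral_sub_left_eq_self (fun u => g u * γ u)]

/-- Inversion formula for the short-time Fourier transform of a tempered distribution. -/
lemma stft_inversion (g γ : 𝓢(V, ℂ)) (σ : 𝓢'(V, ℂ)) (Φ : 𝓢(V, ℂ)) :
    σ Φ * ∫ u, g u * γ u =
      ∫ x : V × V, stft g σ x.1 x.2 * stft γ (Φ : 𝓢'(V, ℂ)) x.1 (-x.2) := by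
  have h := map_integral_schwartz (μ := (volume : Measure (V × V)))
    (G := fun x => stft γ (Φ : 𝓢'(V, ℂ)) x.1 (-x.2) • tfShift g x.1 x.2)
    ((continuous_stft γ _ continuous_fst continuous_snd.neg).smul
      (continuous_tfShift g continuous_fst continuous_snd))
    (fun N => integrable_schwartzSup_stft_smul_tfShift g γ Φ N)
    (Φ := (∫ u, g u * γ u) • Φ)
    (fun y => by
      rw [integral_stft_smul_tfShift, smul_apply, smul_eq_mul, mul_comm]) σ
  rw [map_smul, smul_eq_mul, mul_comm] at h
  rw [h]
  congr 1
  funext x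
  rw [map_smul, smul_eq_mul, mul_comm]
  rfl

end Inversion

/-! ### Choice of the dual window -/

section Window

/-- Linear changes of variables scale all integrals by the same factor. -/
lemma exists_integral_comp_eq {E F : Type*} [NormedAddCommGroup E] [NormedSpace ℝ E]
    [FiniteDimensional ℝ E] [MeasurableSpace E] [BorelSpace E] [NormedAddCommGroup F]
    [NormedSpace ℝ F] [FiniteDimensional ℝ F] [MeasurableSpace F] [BorelSpace F]
    (μ : Measure E) [μ.IsAddHaarMeasure] (ν : Measure F) [ν.IsAddHaarMeasure] (e : E ≃L[ℝ] F) :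
    ∃ c : ℂ, ∀ f : F → ℂ, ∫ y, f y ∂ν = c * ∫ x, f (e x) ∂μ := by
  have : (μ.map e).IsAddHaarMeasure := e.isAddHaarMeasure_map μ
  have h := Measure.isAddLeftInvariant_eq_smul ν (μ.map e)
  refine ⟨((ν.addHaarScalarFactor (μ.map e) : ℝ) : ℂ), fun f => ?_⟩
  have h1 : ∫ y, f y ∂(μ.map e) = ∫ x, f (e x) ∂μ :=
    e.toHomeomorph.measurableEmbedding.integral_map f
  conv_lhs => rw [h]
  rw [integral_smul_nnreal_measure, h1]
  rfl

variable {V : Type} [NormedAddCommGroup V] [InnerProductSpace ℝ V]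

lemma tfShift_tfShift_zero (φ : 𝓢(V, ℂ)) (B z ζ : V) :
    tfShift (tfShift φ 0 B) z ζ =
      Complex.exp (((2 * Real.pi * inner ℝ z B : ℝ) : ℂ) * Complex.I) • tfShift φ z (ζ + B) := by
  ext u
  rw [smul_apply, tfShift_apply, tfShift_apply, tfShift_apply, smul_eq_mul, sub_zero, ← mul_assoc,
    ← mul_assoc, ← Complex.exp_add, ← Complex.exp_add, inner_sub_left, inner_add_right]
  congr 2
  push_cast
  ring

lemma stft_tfShift_zero (φ : 𝓢(V, ℂ)) (f : 𝓢'(V, ℂ)) (B z ζ : V) :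
    stft (tfShift φ 0 B) f z ζ =
      Complex.exp (((2 * Real.pi * inner ℝ z B : ℝ) : ℂ) * Complex.I) * stft φ f z (ζ + B) := by
  rw [stft, tfShift_tfShift_zero, map_smul, smul_eq_mul, stft]

variable [FiniteDimensional ℝ V] [MeasurableSpace V] [BorelSpace V]

omit [FiniteDimensional ℝ V] [MeasurableSpace V] [BorelSpace V] in
lemma gaussian_ne_zero (x : V) : gaussian V x ≠ 0 := by
  rw [gaussian_apply]
  exact_mod_cast (Real.exp_pos _).ne'

lemma fourierInv_gaussian_ne_zero (x : V) : 𝓕⁻ (gaussian V) x ≠ 0 := by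
  have h1 : (gaussian V : V → ℂ) = fun v => Complex.exp (-(1 : ℂ) * ‖v‖ ^ 2) := by
    funext v
    rw [gaussian_apply]
    push_cast
    simp
  rw [SchwartzMap.fourierInv_coe, Real.fourierInv_eq_fourier_neg, h1,
    fourier_gaussian_innerProductSpace (by simp)]
  refine mul_ne_zero ?_ (Complex.exp_ne_zero _)
  rw [div_one, Ne, Complex.cpow_eq_zero_iff]
  simp [Real.pi_ne_zero]

/-- A nonzero Schwartz function has a nonzero pairing with some modulation of any nowhere
vanishing window. -/
lemma exists_integral_mul_tfShift_ne_zero {g γ : 𝓢(V, ℂ)} (hg : g ≠ 0) (hγ : ∀ x, γ x ≠ 0) :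
    ∃ B : V, ∫ u, g u * tfShift γ 0 B u ≠ 0 := by
  by_contra! h
  apply hg
  -- As a function of `B`, the pairing is the Fourier transform of `g γ`.
  have h1 : 𝓕 (schwartzMul g γ) = 0 := by
    ext B
    rw [SchwartzMap.fourier_coe, Real.fourier_eq', zero_apply, ← h B]
    congr 1
    funext u
    rw [tfShift_apply, schwartzMul_apply, smul_eq_mul, sub_zero]
    push_cast
    ring
  have h2 : schwartzMul g γ = 0 := by
    rw [← FourierTransform.fourierInv_fourier_eq (F := 𝓢(V, ℂ)) (schwartzMul g γ), h1]
    exact (FourierTransform.fourierInvCLM ℂ 𝓢(V, ℂ)).map_zero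
  ext x
  have h3 : schwartzMul g γ x = 0 := by rw [h2]; rfl
  rw [schwartzMul_apply] at h3
  exact (mul_eq_zero.1 h3).resolve_right (hγ x)

lemma fourier_tfShift_fourierInv (φ : 𝓢(V, ℂ)) (z ζ : V) :
    𝓕 (tfShift (𝓕⁻ φ) z ζ) =
      Complex.exp (((-2 * Real.pi * inner ℝ z ζ : ℝ) : ℂ) * Complex.I) • tfShift φ (-ζ) z := by
  ext u
  rw [fourier_tfShift, SchwartzMap.compSubConstCLM_apply, fourier_compSubConst,
    FourierTransform.fourier_fourierInv_eq, smul_apply, smul_eq_mul, tfShift_apply, ← mul_assoc,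
    ← Complex.exp_add, sub_neg_eq_add, inner_add_right, real_inner_comm u z]
  congr 2
  push_cast
  ring

/-- Parseval exchanges the roles of time and frequency. It converts the factors of the Rihaczek
transform, which contain `𝓕 f`, into transforms of `f` itself. -/
lemma integral_tfShift_fourierInv_mul_fourier (φ f : 𝓢(V, ℂ)) (z ζ : V) :
    ∫ u, tfShift (𝓕⁻ φ) z ζ u * 𝓕 f u =
      Complex.exp (((-2 * Real.pi * inner ℝ z ζ : ℝ) : ℂ) * Complex.I) *
        stft φ (f : 𝓢'(V, ℂ)) (-ζ) z := by
  rw [← SchwartzMap.integral_fourier_mul_eq, fourier_tfShift_fourierInv, stft_coe,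
    ← integral_const_mul]
  simp only [smul_apply, smul_eq_mul, mul_assoc]

end Window

/-! ### The window adapted to the Rihaczek transform -/

section SymbolWindow

variable {m d : ℕ}

lemma hasTemperateGrowth_inner_sum :
    (fun z : SymbolDomain m d => inner ℝ (z 0) (∑ k : Fin m, z k.succ)).HasTemperateGrowth := by
  have hp : ∀ j : Fin (m + 1), (fun z : SymbolDomain m d => z j).HasTemperateGrowth := fun j =>
    (PiLp.proj (𝕜 := ℝ) 2 (fun _ : Fin (m + 1) => Rd d) j).hasTemperateGrowth
  exact (innerSL ℝ).bilinear_hasTemperateGrowth (hp 0)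
    (Function.HasTemperateGrowth.sum fun k _ => hp k.succ)

/-- The window `(x, ξ) ↦ e^{-2πi x·(ξ₁ + ⋯ + ξₘ)} φ(x) 𝓕⁻φ(ξ₁) ⋯ 𝓕⁻φ(ξₘ)`, adapted to the
Rihaczek transform. -/
noncomputable def rihaczekWindow (m d : ℕ) : 𝓢(SymbolDomain m d, ℂ) :=
  SchwartzMap.smulLeftCLM ℂ (fun z : SymbolDomain m d =>
    Complex.exp (((-2 * Real.pi * inner ℝ (z 0) (∑ k : Fin m, z k.succ) : ℝ) : ℂ) * Complex.I))
  (tensorCLM (fun _ => 𝓕⁻ (gaussian (Rd d))) (gaussian (Rd d)))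

lemma rihaczekWindow_apply (z : SymbolDomain m d) : rihaczekWindow m d z =
    Complex.exp (((-2 * Real.pi * inner ℝ (z 0) (∑ k : Fin m, z k.succ) : ℝ) : ℂ) * Complex.I) *
      (gaussian (Rd d) (z 0) * ∏ k : Fin m, 𝓕⁻ (gaussian (Rd d)) (z k.succ)) := by
  have h : (fun z : SymbolDomain m d =>
      -2 * Real.pi * inner ℝ (z 0) (∑ k : Fin m, z k.succ)).HasTemperateGrowth :=
    (Function.HasTemperateGrowth.const (-2 * Real.pi)).mul hasTemperateGrowth_inner_sum
  rw [rihaczekWindow, SchwartzMap.smulLeftCLM_apply_apply (hasTemperateGrowth_cexp_comp h),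
    tensorCLM_apply, smul_eq_mul]

lemma rihaczekWindow_ne_zero (z : SymbolDomain m d) : rihaczekWindow m d z ≠ 0 := by
  rw [rihaczekWindow_apply]
  exact mul_ne_zero (Complex.exp_ne_zero _) (mul_ne_zero (gaussian_ne_zero _)
    (Finset.prod_ne_zero_iff.2 fun _ _ => fourierInv_gaussian_ne_zero _))

lemma tfShift_rihaczekWindow_mul_rihaczek (f : Fin m → 𝓢(Rd d, ℂ)) (ψ : 𝓢(Rd d, ℂ))
    (z ζ y : SymbolDomain m d) :
    tfShift (rihaczekWindow m d) z ζ y * rihaczek f ψ y =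
      Complex.exp (((-2 * Real.pi * inner ℝ (z 0) (∑ k : Fin m, z k.succ) : ℝ) : ℂ) * Complex.I) *
        ((tfShift (gaussian (Rd d)) (z 0) (ζ 0 - ∑ k : Fin m, z k.succ) (y 0) * ψ (y 0)) *
          ∏ k : Fin m, (tfShift (𝓕⁻ (gaussian (Rd d))) (z k.succ) (ζ k.succ - z 0) (y k.succ) *
            𝓕 (f k) (y k.succ))) := by
  rw [tfShift_apply, rihaczekWindow_apply, rihaczek_apply]
  simp only [tfShift_apply, Finset.prod_mul_distrib, ← Complex.exp_sum, ← Finset.sum_mul,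
    PiLp.sub_apply, SchwartzMap.fourier_coe]
  -- The terms `y₀ · y_k` of the window and of the Rihaczek transform cancel. The remaining phase is
  -- affine in `y`, so it splits over the coordinates.
  have hphase : ((-2 * Real.pi * inner ℝ y ζ : ℝ) : ℂ) * Complex.I +
      ((-2 * Real.pi * inner ℝ (y 0 - z 0) (∑ k : Fin m, (y k.succ - z k.succ)) : ℝ) : ℂ) *
        Complex.I + ((2 * Real.pi * inner ℝ (y 0) (∑ k : Fin m, y k.succ) : ℝ) : ℂ) * Complex.I =
      ((-2 * Real.pi * inner ℝ (z 0) (∑ k : Fin m, z k.succ) : ℝ) : ℂ) * Complex.I +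
      ((-2 * Real.pi * inner ℝ (y 0) (ζ 0 - ∑ k : Fin m, z k.succ) : ℝ) : ℂ) * Complex.I +
      (∑ k : Fin m, ((-2 * Real.pi * inner ℝ (y k.succ) (ζ k.succ - z 0) : ℝ) : ℂ)) *
        Complex.I := by
    rw [← add_mul, ← add_mul, ← add_mul, ← add_mul]
    congr 1
    simp only [← Complex.ofReal_sum, ← Complex.ofReal_add]
    congr 1
    rw [PiLp.inner_apply, Fin.sum_univ_succ]
    simp only [Finset.sum_sub_distrib, inner_sub_left, inner_sub_right, mul_sub,
      inner_sum, ← Finset.mul_sum, real_inner_comm (z 0)]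
    ring
  have hexp := congrArg Complex.exp hphase
  simp only [Complex.exp_add] at hexp
  linear_combination (gaussian (Rd d) (y 0 - z 0) * (∏ k : Fin m, 𝓕⁻ (gaussian (Rd d))
    (y k.succ - z k.succ)) * ψ (y 0) * ∏ k : Fin m, 𝓕 (f k : Rd d → ℂ) (y k.succ)) * hexp

end SymbolWindow

/-! ### The pairing as an integral of short-time Fourier transforms -/

section Representation

variable {m d : ℕ}

lemma exists_integral_symbolDomain_prod (m d : ℕ) : ∃ c : ℂ, ∀ F : Fin (m + 1) → Rd d → ℂ,
    ∫ y : SymbolDomain m d, ∏ j, F j (y j) = c * ∏ j, ∫ u, F j u := by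
  obtain ⟨c, hc⟩ := exists_integral_comp_eq (volume : Measure (Fin (m + 1) → Rd d))
    (volume : Measure (SymbolDomain m d))
    (PiLp.continuousLinearEquiv 2 ℝ (fun _ : Fin (m + 1) => Rd d)).symm
  refine ⟨c, fun F => ?_⟩
  rw [hc, ← integral_fintype_prod_volume_eq_prod]
  rfl

/-- After the cancellation of phases the integrand is a tensor product, and Fubini yields one factor
per coordinate. -/
lemma exists_stft_rihaczek (m d : ℕ) : ∃ c : ℂ, ∀ (f : Fin m → 𝓢(Rd d, ℂ)) (ψ : 𝓢(Rd d, ℂ))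
    (z ζ : SymbolDomain m d),
    stft (rihaczekWindow m d) ((rihaczek f ψ : 𝓢(SymbolDomain m d, ℂ)) :
      𝓢'(SymbolDomain m d, ℂ)) z ζ =
      c * (Complex.exp (((-2 * Real.pi * inner ℝ (z 0) (∑ k : Fin m, z k.succ) : ℝ) : ℂ) *
          Complex.I) *
        (stft (gaussian (Rd d)) (ψ : 𝓢'(Rd d, ℂ)) (z 0) (ζ 0 - ∑ k : Fin m, z k.succ) *
          ∏ k : Fin m, (Complex.exp (((-2 * Real.pi *
            inner ℝ (z k.succ) (ζ k.succ - z 0) : ℝ) : ℂ) * Complex.I) *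
            stft (gaussian (Rd d)) (f k : 𝓢'(Rd d, ℂ)) (z 0 - ζ k.succ) (z k.succ)))) := by
  obtain ⟨c, hc⟩ := exists_integral_symbolDomain_prod m d
  refine ⟨c, fun f ψ z ζ => ?_⟩
  rw [stft_coe]
  simp_rw [tfShift_rihaczekWindow_mul_rihaczek]
  rw [integral_const_mul]
  have h := hc (Fin.cons (fun u => tfShift (gaussian (Rd d)) (z 0) (ζ 0 - ∑ k : Fin m, z k.succ) u *
    ψ u) (fun k u => tfShift (𝓕⁻ (gaussian (Rd d))) (z k.succ) (ζ k.succ - z 0) u *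
            𝓕 (f k) u))
  simp only [Fin.prod_univ_succ, Fin.cons_zero, Fin.cons_succ] at h
  rw [h, ← stft_coe]
  simp_rw [integral_tfShift_fourierInv_mul_fourier, neg_sub]
  ring

/-- The coordinates in which `symbolStft` is defined, as a linear change of variables. -/
noncomputable def symbolCoordsₗ (m d : ℕ) :
    ((Fin (m + 1) → Rd d) × (Fin (m + 1) → Rd d)) ≃ₗ[ℝ] SymbolDomain m d × SymbolDomain m d where
  toFun x := (WithLp.toLp 2 (Fin.cons (x.1 0) (fun k : Fin m => x.2 k.castSucc) :
      Fin (m + 1) → Rd d),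
    WithLp.toLp 2 (Fin.cons (x.2 (Fin.last m)) (fun k : Fin m => -x.1 k.succ) :
      Fin (m + 1) → Rd d))
  invFun y := ((Fin.cons (y.1 0) (fun k : Fin m => -y.2 k.succ) : Fin (m + 1) → Rd d),
    (Fin.snoc (fun k : Fin m => y.1 k.succ) (y.2 0) : Fin (m + 1) → Rd d))
  map_add' x y := by
    refine Prod.ext ?_ ?_ <;> refine PiLp.ext fun j => ?_ <;>
      refine Fin.cases ?_ (fun k => ?_) j
    · rfl
    · rfl
    · rfl
    · exact neg_add _ _
  map_smul' c x := by
    refine Prod.ext ?_ ?_ <;> refine PiLp.ext fun j => ?_ <;>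
      refine Fin.cases ?_ (fun k => ?_) j
    · rfl
    · rfl
    · rfl
    · exact (smul_neg c (x.1 k.succ)).symm
  left_inv x := by
    refine Prod.ext ?_ ?_ <;> funext j
    · refine Fin.cases ?_ (fun k => ?_) j
      · rfl
      · exact neg_neg _
    · refine Fin.lastCases ?_ (fun k => ?_) j
      · simp
      · simp
  right_inv y := by
    refine Prod.ext ?_ ?_ <;> refine PiLp.ext fun j => ?_ <;>
      refine Fin.cases ?_ (fun k => ?_) j
    · rfl
    · simp
    · simp
    · exact neg_neg _

/-- The coordinates in which `symbolStft` is defined, as a continuous change of variables. -/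
noncomputable def symbolCoords (m d : ℕ) :
    ((Fin (m + 1) → Rd d) × (Fin (m + 1) → Rd d)) ≃L[ℝ] SymbolDomain m d × SymbolDomain m d :=
  { symbolCoordsₗ m d with
    continuous_toFun := by
      refine Continuous.prodMk ((PiLp.continuous_toLp 2 _).comp (continuous_pi fun j => ?_))
        ((PiLp.continuous_toLp 2 _).comp (continuous_pi fun j => ?_)) <;>
        refine Fin.cases ?_ (fun k => ?_) j
      · change Continuous fun x : (Fin (m + 1) → Rd d) × (Fin (m + 1) → Rd d) => x.1 0
        exact (continuous_apply (0 : Fin (m + 1))).comp continuous_fst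
      · exact (continuous_apply k.castSucc).comp continuous_snd
      · exact (continuous_apply (Fin.last m)).comp continuous_snd
      · exact ((continuous_apply k.succ).comp continuous_fst).neg
    continuous_invFun := by
      refine Continuous.prodMk (continuous_pi fun j => ?_) (continuous_pi fun j => ?_)
      · refine Fin.cases ?_ (fun k => ?_) j
        · exact (PiLp.continuous_apply 2 _ _).comp continuous_fst
        · exact ((PiLp.continuous_apply 2 _ _).comp continuous_snd).neg
      · refine Fin.lastCases ?_ (fun k => ?_) j
        · simp only [Fin.snoc_last]
          exact (PiLp.continuous_apply 2 _ _).comp continuous_snd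
        · simp only [Fin.snoc_castSucc]
          exact (PiLp.continuous_apply 2 _ _).comp continuous_fst }

lemma stft_symbolCoords (g : 𝓢(SymbolDomain m d, ℂ)) (σ : 𝓢'(SymbolDomain m d, ℂ))
    (x : (Fin (m + 1) → Rd d) × (Fin (m + 1) → Rd d)) :
    stft g σ (symbolCoords m d x).1 (symbolCoords m d x).2 = symbolStft g σ x.1 x.2 := rfl

lemma continuous_symbolStft (g : 𝓢(SymbolDomain m d, ℂ)) (σ : 𝓢'(SymbolDomain m d, ℂ)) :
    Continuous (fun x : (Fin (m + 1) → Rd d) × (Fin (m + 1) → Rd d) =>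
      symbolStft g σ x.1 x.2) :=
  continuous_stft g σ (symbolCoords m d).continuous.fst (symbolCoords m d).continuous.snd

/-- The product of the short-time Fourier transforms of `ψ` and of the entries of `f` that is
integrated against the short-time Fourier transform of the symbol. -/
noncomputable def atomStft (B₀ : Rd d) (B : Fin m → Rd d) (f : Fin m → 𝓢'(Rd d, ℂ))
    (ψ : 𝓢(Rd d, ℂ)) (x : (Fin (m + 1) → Rd d) × (Fin (m + 1) → Rd d)) : ℂ :=
  stft (gaussian (Rd d)) (ψ : 𝓢'(Rd d, ℂ)) (x.1 0)
      (B₀ - (x.2 (Fin.last m) + ∑ k : Fin m, x.2 k.castSucc)) *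
    ∏ k : Fin m, stft (gaussian (Rd d)) (f k) (x.1 0 - x.1 k.succ - B k) (x.2 k.castSucc)

/-- All phases are collected in `θ`, which does not depend on `f` and `ψ` and disappears in absolute
values. The modulation `β` of the window survives as a fixed shift of the arguments. -/
lemma exists_stft_tfShift_rihaczek (β : SymbolDomain m d) :
    ∃ (c : ℂ) (θ : (Fin (m + 1) → Rd d) × (Fin (m + 1) → Rd d) → ℂ), Continuous θ ∧
      (∀ x, ‖θ x‖ = 1) ∧ ∀ (f : Fin m → 𝓢(Rd d, ℂ)) (ψ : 𝓢(Rd d, ℂ)) x,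
      stft (tfShift (rihaczekWindow m d) 0 β) ((rihaczek f ψ : 𝓢(SymbolDomain m d, ℂ)) :
        𝓢'(SymbolDomain m d, ℂ)) (symbolCoords m d x).1 (-(symbolCoords m d x).2) =
      c * (θ x * atomStft (β 0) (fun k => β k.succ) (fun k => (f k : 𝓢'(Rd d, ℂ))) ψ x) := by
  obtain ⟨c, hc⟩ := exists_stft_rihaczek m d
  have hL : Continuous (fun x => symbolCoords m d x) := (symbolCoords m d).continuous
  refine ⟨c, fun x =>
    Complex.exp (((2 * Real.pi * inner ℝ (symbolCoords m d x).1 β : ℝ) : ℂ) * Complex.I) *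
    (Complex.exp (((-2 * Real.pi * inner ℝ ((symbolCoords m d x).1 0)
      (∑ k : Fin m, (symbolCoords m d x).1 k.succ) : ℝ) : ℂ) * Complex.I) *
      ∏ k : Fin m, Complex.exp (((-2 * Real.pi * inner ℝ ((symbolCoords m d x).1 k.succ)
        ((-(symbolCoords m d x).2 + β) k.succ - (symbolCoords m d x).1 0) : ℝ) : ℂ) *
          Complex.I)), ?_, ?_, fun f ψ x => ?_⟩
  · have h1 := hL.fst
    have h2 := hL.snd
    have h3 : ∀ j, Continuous fun x => (symbolCoords m d x).1 j := fun j =>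
      (PiLp.continuous_apply 2 _ j).comp h1
    have h4 : ∀ j, Continuous fun x => (-(symbolCoords m d x).2 + β) j := fun j =>
      (PiLp.continuous_apply 2 _ j).comp (h2.neg.add continuous_const)
    fun_prop
  · intro x
    simp only [norm_mul, norm_prod, Complex.norm_exp_ofReal_mul_I, Finset.prod_const_one, mul_one]
  · rw [stft_tfShift_zero, hc, Finset.prod_mul_distrib, atomStft]
    have e1 : (symbolCoords m d x).1 0 = x.1 0 := rfl
    have e2 : ∀ k : Fin m, (symbolCoords m d x).1 k.succ = x.2 k.castSucc := fun _ => rfl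
    have e3 : (-(symbolCoords m d x).2 + β) 0 - ∑ k : Fin m, (symbolCoords m d x).1 k.succ =
        β 0 - (x.2 (Fin.last m) + ∑ k : Fin m, x.2 k.castSucc) := by
      have : (-(symbolCoords m d x).2 + β) 0 = -x.2 (Fin.last m) + β 0 := rfl
      rw [this]
      simp only [e2]
      abel
    have e4 : ∀ k : Fin m, (symbolCoords m d x).1 0 - (-(symbolCoords m d x).2 + β) k.succ =
        x.1 0 - x.1 k.succ - β k.succ := by
      intro k
      have : (-(symbolCoords m d x).2 + β) k.succ = - -x.1 k.succ + β k.succ := rfl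
      rw [this, e1]
      abel
    rw [e3]
    simp_rw [e4]
    rw [e1]
    simp_rw [e2]
    ring

/-- The pairing of a symbol with a Rihaczek transform, in terms of the short-time Fourier
transforms of all the functions involved. -/
theorem exists_pairing_eq_integral {g : 𝓢(SymbolDomain m d, ℂ)} (hg : g ≠ 0) :
    ∃ (c : ℂ) (θ : (Fin (m + 1) → Rd d) × (Fin (m + 1) → Rd d) → ℂ) (B₀ : Rd d)
      (B : Fin m → Rd d), Continuous θ ∧ (∀ x, ‖θ x‖ = 1) ∧
      ∀ (σ : 𝓢'(SymbolDomain m d, ℂ)) (f : Fin m → 𝓢(Rd d, ℂ)) (ψ : 𝓢(Rd d, ℂ)),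
        σ (rihaczek f ψ) = c * ∫ x, θ x * symbolStft g σ x.1 x.2 *
          atomStft B₀ B (fun k => (f k : 𝓢'(Rd d, ℂ))) ψ x := by
  obtain ⟨β, hβ⟩ := exists_integral_mul_tfShift_ne_zero hg (rihaczekWindow_ne_zero (m := m) (d := d))
  obtain ⟨c, θ, hθ, hθ1, hc⟩ := exists_stft_tfShift_rihaczek β
  have hμ := Measure.prod.instIsAddHaarMeasure (volume : Measure (Fin (m + 1) → Rd d))
    (volume : Measure (Fin (m + 1) → Rd d))
  have hν := Measure.prod.instIsAddHaarMeasure (volume : Measure (SymbolDomain m d))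
    (volume : Measure (SymbolDomain m d))
  obtain ⟨c', hc'⟩ := exists_integral_comp_eq
    ((volume : Measure (Fin (m + 1) → Rd d)).prod (volume : Measure (Fin (m + 1) → Rd d)))
    ((volume : Measure (SymbolDomain m d)).prod (volume : Measure (SymbolDomain m d)))
    (symbolCoords m d)
  rw [← Measure.volume_eq_prod, ← Measure.volume_eq_prod] at hc'
  refine ⟨(∫ u, g u * tfShift (rihaczekWindow m d) 0 β u)⁻¹ * (c' * c), θ, β 0,
    fun k => β k.succ, hθ, hθ1, fun σ f ψ => ?_⟩
  have h := stft_inversion g (tfShift (rihaczekWindow m d) 0 β) σ (rihaczek f ψ)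
  rw [hc'] at h
  simp_rw [hc, stft_symbolCoords] at h
  rw [mul_assoc, ← div_eq_inv_mul, eq_div_iff hβ, h, mul_assoc]
  congr 1
  rw [← integral_const_mul]
  congr 1
  funext x
  ring

end Representation

/-! ### Arithmetic of exponents -/

section Exponents

/-- The exponents of the intermediate estimate and of the final application of Young's
inequality. -/
lemma exists_exponents {m : ℕ} {S p : ℝ≥0∞} (h : m + p⁻¹ ≤ S) (h' : S ≤ m + 1) :
    ∃ a e : ℝ≥0∞, 1 ≤ a ∧ 1 ≤ e ∧ m + a⁻¹ = S ∧ 1 + p⁻¹ = a⁻¹ + e⁻¹ := by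
  have hm : (m : ℝ≥0∞) ≠ ∞ := ENNReal.natCast_ne_top m
  have ha1 : S - m ≤ 1 := tsub_le_iff_left.2 h'
  have hpa : p⁻¹ ≤ S - m := ENNReal.le_sub_of_add_le_left hm h
  have hp1 : 1 + p⁻¹ - (S - m) ≤ 1 := by
    rw [tsub_le_iff_left, add_comm]
    gcongr
  have ha0 : S - m ≠ ∞ := (ha1.trans_lt ENNReal.one_lt_top).ne
  -- `a` turns the scaling inequality into an equality, and `e` is the Young exponent leading from
  -- `a` to `p`; the two hypotheses place both in `[1, ∞]`.
  refine ⟨(S - m)⁻¹, (1 + p⁻¹ - (S - m))⁻¹, ENNReal.one_le_inv.2 ha1, ENNReal.one_le_inv.2 hp1,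
    ?_, ?_⟩
  · rw [inv_inv, add_tsub_cancel_of_le (le_self_add.trans h)]
  · rw [inv_inv, inv_inv, add_tsub_cancel_of_le (ha1.trans le_self_add)]

lemma inv_add_inv_le_one_of_conjExponent_le {r p : ℝ≥0∞} (hr : 1 ≤ r) (h : r.conjExponent ≤ p) :
    r⁻¹ + p⁻¹ ≤ 1 := by
  have hc := ENNReal.HolderConjugate.conjExponent hr
  rw [← hc.inv_add_inv_eq_one]
  gcongr

lemma one_le_inv_add_inv_of_le_conjExponent {r p : ℝ≥0∞} (hr : 1 ≤ r) (h : p ≤ r.conjExponent) :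
    1 ≤ p⁻¹ + r⁻¹ := by
  have hc := ENNReal.HolderConjugate.conjExponent hr
  rw [← hc.inv_add_inv_eq_one, add_comm]
  gcongr

end Exponents

/-! ### Weights against decaying kernels -/

section WeightEstimates

variable {d : ℕ}

lemma IsWeight.exists_le {G : Type*} [NormedAddCommGroup G] {v : G → ℝ} (hv : IsWeight v) :
    ∃ (C : ℝ) (N : ℕ), 0 ≤ C ∧ ∀ x y, v (x + y) ≤ C * (1 + ‖x‖) ^ N * v y := by
  obtain ⟨w, -, hw0, -, ⟨C₁, N, hC₁⟩, C, hC⟩ := hv.moderate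
  refine ⟨|C| * |C₁|, N, by positivity, fun x y => (hC x y).trans ?_⟩
  have hy := hv.pos y
  have h1 : w x ≤ |C₁| * (1 + ‖x‖) ^ N := (hC₁ x).trans (by gcongr; exact le_abs_self _)
  calc C * w x * v y ≤ |C| * (|C₁| * (1 + ‖x‖) ^ N) * v y := by
        gcongr
        · exact hw0 x
        · exact le_abs_self _
    _ = _ := by ring

lemma IsWeight.exists_le_prod {w : Rd d × Rd d → ℝ} (hw : IsWeight w) :
    ∃ (C : ℝ) (N : ℕ), 0 ≤ C ∧ ∀ x y ξ η : Rd d,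
      w (x, ξ) ≤ C * ((1 + ‖x - y‖) ^ N * (1 + ‖ξ - η‖) ^ N) * w (y, η) := by
  obtain ⟨C, N, hC, h⟩ := hw.exists_le
  refine ⟨C, N, hC, fun x y ξ η => ?_⟩
  have hpos := hw.pos (y, η)
  have h1 := h (x - y, ξ - η) (y, η)
  rw [Prod.mk_add_mk, sub_add_cancel, sub_add_cancel] at h1
  refine h1.trans ?_
  rw [← mul_pow]
  gcongr
  rw [Prod.norm_mk]
  rcases max_cases ‖x - y‖ ‖ξ - η‖ with h | h <;> rw [h.1] <;>
    nlinarith [norm_nonneg (x - y), norm_nonneg (ξ - η)]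

/-- A polynomially decaying kernel in `L¹ ∩ L^∞`. -/
noncomputable def decayKernel (y : Rd d) : ℝ≥0∞ := ENNReal.ofReal ((1 + ‖y‖) ^ (d + 1))⁻¹

lemma measurable_decayKernel : Measurable (decayKernel : Rd d → ℝ≥0∞) := by
  refine Measurable.ennreal_ofReal (Measurable.inv ?_)
  exact ((measurable_const.add measurable_norm).pow_const _)

lemma decayKernel_le_one (y : Rd d) : decayKernel y ≤ 1 := by
  rw [decayKernel, ← ENNReal.ofReal_one]
  refine ENNReal.ofReal_le_ofReal (inv_le_one_of_one_le₀ (one_le_pow₀ ?_))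
  linarith [norm_nonneg y]

lemma eLpNorm_decayKernel_lt_top {e : ℝ≥0∞} (he : 1 ≤ e) :
    eLpNorm (decayKernel : Rd d → ℝ≥0∞) e volume < ∞ := by
  rcases eq_or_ne e ∞ with rfl | het
  · exact (eLpNorm_top_le_of_ae_le (Filter.Eventually.of_forall
      decayKernel_le_one)).trans_lt ENNReal.one_lt_top
  · have he0 : e ≠ 0 := (zero_lt_one.trans_le he).ne'
    have he1 : 1 ≤ e.toReal := by
      rw [← ENNReal.toReal_one]
      exact ENNReal.toReal_mono het he
    rw [eLpNorm_eq_lintegral_rpow he0 het]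
    refine ENNReal.rpow_lt_top_of_nonneg (by positivity) (ne_of_lt ?_)
    have hint : Integrable (fun y : Rd d => ((1 + ‖y‖) ^ (d + 1))⁻¹) := by
      have h := integrable_one_add_norm (E := Rd d) (μ := volume)
        (r := ((d + 1 : ℕ) : ℝ)) (by rw [finrank_euclideanSpace_fin]; push_cast; linarith)
      refine h.congr (Filter.Eventually.of_forall fun y => ?_)
      have hy : (0 : ℝ) ≤ 1 + ‖y‖ := by positivity
      simp only [Real.rpow_neg hy, Real.rpow_natCast]
    refine lt_of_le_of_lt (lintegral_mono fun y => ?_)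
      ((hasFiniteIntegral_iff_ofReal (Filter.Eventually.of_forall fun y => by positivity)).1 hint.2)
    calc decayKernel y ^ e.toReal ≤ decayKernel y ^ (1 : ℝ) :=
          ENNReal.rpow_le_rpow_of_exponent_ge (decayKernel_le_one y) he1
      _ = _ := ENNReal.rpow_one _

/-- Rapid decay of a quantity absorbs the growth of a weight. -/
lemma IsWeight.exists_mul_le_decay {w : Rd d × Rd d → ℝ} (hw : IsWeight w) (B : Rd d) :
    ∃ (N : ℕ) (C : ℝ), 0 ≤ C ∧ ∀ (A K : ℝ) (z ζ x ω : Rd d), 0 ≤ A →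
      A * ((1 + ‖x - z‖) ^ N * (1 + ‖B - ω + ζ‖) ^ N) ≤ K →
      ENNReal.ofReal (w (z, ζ)) * (ENNReal.ofReal A * ENNReal.ofReal (w (x, ω))⁻¹) ≤
        ENNReal.ofReal (C * K) * (decayKernel (z - x) * decayKernel (ζ - ω)) := by
  obtain ⟨C, N, hC, h⟩ := hw.exists_le_prod
  -- `N` powers absorb the quotient of weights and `d + 1` remain for `decayKernel`. The constant
  -- pays for removing the shift `B`.
  refine ⟨N + (d + 1), C * (1 + ‖B‖) ^ (N + (d + 1)), by positivity, fun A K z ζ x ω hA hK => ?_⟩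
  have hwx := hw.pos (x, ω)
  have hwz := hw.pos (z, ζ)
  have hK0 : 0 ≤ K := le_trans (by positivity) hK
  rw [decayKernel, decayKernel, ← ENNReal.ofReal_mul hA, ← ENNReal.ofReal_mul hwz.le,
    ← ENNReal.ofReal_mul (by positivity), ← ENNReal.ofReal_mul (by positivity)]
  refine ENNReal.ofReal_le_ofReal ?_
  have h1 := h z x ζ ω
  have h2 : 1 + ‖ζ - ω‖ ≤ (1 + ‖B‖) * (1 + ‖B - ω + ζ‖) := by
    have := one_add_norm_le_mul (ζ - ω) (-B)
    rwa [norm_neg, sub_neg_eq_add, show ζ - ω + B = B - ω + ζ by abel] at this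
  rw [norm_sub_rev x z] at hK
  rw [← mul_inv, ← div_eq_mul_inv, ← div_eq_mul_inv, le_div_iff₀ (by positivity),
    ← mul_div_assoc, div_mul_eq_mul_div, div_le_iff₀ hwx]
  calc w (z, ζ) * A * ((1 + ‖z - x‖) ^ (d + 1) * (1 + ‖ζ - ω‖) ^ (d + 1))
      ≤ (C * ((1 + ‖z - x‖) ^ N * (1 + ‖ζ - ω‖) ^ N) * w (x, ω)) * A *
          ((1 + ‖z - x‖) ^ (d + 1) * (1 + ‖ζ - ω‖) ^ (d + 1)) := by gcongr
    _ = C * w (x, ω) * (A * ((1 + ‖z - x‖) ^ (N + (d + 1)) *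
          (1 + ‖ζ - ω‖) ^ (N + (d + 1)))) := by rw [pow_add, pow_add]; ring
    _ ≤ C * w (x, ω) * (A * ((1 + ‖z - x‖) ^ (N + (d + 1)) *
          ((1 + ‖B‖) * (1 + ‖B - ω + ζ‖)) ^ (N + (d + 1)))) := by gcongr
    _ = C * w (x, ω) * (1 + ‖B‖) ^ (N + (d + 1)) * (A * ((1 + ‖z - x‖) ^ (N + (d + 1)) *
          (1 + ‖B - ω + ζ‖) ^ (N + (d + 1)))) := by rw [mul_pow]; ring
    _ ≤ C * w (x, ω) * (1 + ‖B‖) ^ (N + (d + 1)) * K := by gcongr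
    _ = _ := by ring

lemma stft_tfShift {V : Type} [NormedAddCommGroup V] [InnerProductSpace ℝ V]
    [FiniteDimensional ℝ V] [MeasurableSpace V] [BorelSpace V] (φ ψ : 𝓢(V, ℂ)) (z ζ x ω : V) :
    stft φ (tfShift ψ z ζ : 𝓢'(V, ℂ)) x ω =
      Complex.exp (((-2 * Real.pi * inner ℝ z (ω + ζ) : ℝ) : ℂ) * Complex.I) *
        stft φ (ψ : 𝓢'(V, ℂ)) (x - z) (ω + ζ) := by
  rw [stft_coe, stft_coe, ← integral_const_mul, ← integral_add_right_eq_self _ z]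
  congr 1
  funext y
  simp only [tfShift_apply]
  rw [add_sub_cancel_right, show y + z - x = y - (x - z) by abel]
  have h : ((-2 * Real.pi * inner ℝ (y + z) ω : ℝ) : ℂ) * Complex.I +
      ((-2 * Real.pi * inner ℝ (y + z) ζ : ℝ) : ℂ) * Complex.I =
      ((-2 * Real.pi * inner ℝ z (ω + ζ) : ℝ) : ℂ) * Complex.I +
      ((-2 * Real.pi * inner ℝ y (ω + ζ) : ℝ) : ℂ) * Complex.I := by
    rw [inner_add_left, inner_add_left, inner_add_right, inner_add_right]
    push_cast
    ring
  have h' := congrArg Complex.exp h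
  rw [Complex.exp_add, Complex.exp_add] at h'
  linear_combination (φ (y - (x - z)) * ψ y) * h'

lemma IsWeight.exists_stft_tfShift_le_decay {w : Rd d × Rd d → ℝ} (hw : IsWeight w)
    (φ : 𝓢(Rd d, ℂ)) (B : Rd d) : ∃ C : NNReal, ∀ z ζ x ω : Rd d,
      ENNReal.ofReal (w (z, ζ)) * (‖stft φ (tfShift φ z ζ : 𝓢'(Rd d, ℂ)) x (B - ω)‖ₑ *
        ENNReal.ofReal (w (x, ω))⁻¹) ≤ C * (decayKernel (z - x) * decayKernel (ζ - ω)) := by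
  obtain ⟨N, C, hC, h⟩ := hw.exists_mul_le_decay B
  obtain ⟨M, C', hC', h'⟩ := exists_norm_stft_coe_le φ N
  refine ⟨(C * (C' * schwartzSup (Rd d) M φ)).toNNReal, fun z ζ x ω => ?_⟩
  rw [← ofReal_norm, stft_tfShift, norm_mul, Complex.norm_exp_ofReal_mul_I, one_mul]
  exact h _ _ z ζ x ω (norm_nonneg _) (h' φ (x - z) (B - ω + ζ))

/-- The case `z = ζ = 0` of `IsWeight.exists_mul_le_decay`. Its bound by a Schwartz seminorm of `ψ`
makes the extended operator take values in tempered distributions. -/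
lemma IsWeight.exists_stft_coe_le_decay {w : Rd d × Rd d → ℝ} (hw : IsWeight w)
    (φ : 𝓢(Rd d, ℂ)) (B : Rd d) : ∃ (M : ℕ) (C : ℝ), 0 ≤ C ∧ ∀ (ψ : 𝓢(Rd d, ℂ)) (x ω : Rd d),
      ‖stft φ (ψ : 𝓢'(Rd d, ℂ)) x (B - ω)‖ₑ * ENNReal.ofReal (w (x, ω))⁻¹ ≤
        ENNReal.ofReal (C * schwartzSup (Rd d) M ψ) * (decayKernel x * decayKernel ω) := by
  obtain ⟨N, C, hC, h⟩ := hw.exists_mul_le_decay B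
  obtain ⟨M, C', hC', h'⟩ := exists_norm_stft_coe_le φ N
  have hw0 := hw.pos (0, 0)
  refine ⟨M, (w (0, 0))⁻¹ * (C * C'), by positivity, fun ψ x ω => ?_⟩
  have h1 := h ‖stft φ (ψ : 𝓢'(Rd d, ℂ)) x (B - ω)‖ _ 0 0 x ω (norm_nonneg _)
    (by simpa using h' ψ x (B - ω))
  have hsym : ∀ y : Rd d, decayKernel (0 - y) = decayKernel y := fun y => by
    simp [decayKernel]
  rw [hsym, hsym, ofReal_norm] at h1
  have h2 := mul_le_mul_right h1 (ENNReal.ofReal (w (0, 0))⁻¹)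
  rw [← mul_assoc, ← ENNReal.ofReal_mul (by positivity), inv_mul_cancel₀ hw0.ne',
    ENNReal.ofReal_one, one_mul, ← mul_assoc, ← ENNReal.ofReal_mul (by positivity)] at h2
  refine h2.trans_eq ?_
  congr 2
  ring

end WeightEstimates

/-! ### Integrating out the symbol variables -/

section ChangeOfVariables

variable {d : ℕ}

lemma lintegral_finSnoc {E : Type*} [MeasureSpace E] [SigmaFinite (volume : Measure E)]
    {n : ℕ} {G : (Fin (n + 1) → E) → ℝ≥0∞} (hG : Measurable G) :
    ∫⁻ t, G t = ∫⁻ t' : Fin n → E, ∫⁻ t₀ : E, G (Fin.snoc t' t₀) := by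
  have h := (volume_preserving_piFinSuccAbove (fun _ : Fin (n + 1) => E) (Fin.last n)).symm
  have happ : ∀ x : E × (Fin n → E),
      (MeasurableEquiv.piFinSuccAbove (fun _ : Fin (n + 1) => E) (Fin.last n)).symm x =
        Fin.snoc x.2 x.1 := fun x => by
    rw [MeasurableEquiv.piFinSuccAbove_symm_apply]
    exact Fin.insertNth_last' _ _
  rw [← h.lintegral_comp_emb (MeasurableEquiv.measurableEmbedding _), Measure.volume_eq_prod,
    lintegral_prod_symm']
  · simp_rw [happ]
  · exact hG.comp (MeasurableEquiv.measurable _)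

/-- Tonelli together with the substitution `ω = ν + ξ₁ + ⋯ + ξₘ`, the only combination of
frequencies seen by the test function. -/
lemma lintegral_mul_prod_eq_symbolTransform {m : ℕ}
    {F : (Fin (m + 1) → Rd d) → (Fin (m + 1) → Rd d) → ℝ≥0∞}
    (hF : Measurable (Function.uncurry F)) {f : Fin m → Rd d → Rd d → ℝ≥0∞}
    (hf : ∀ k, Measurable (Function.uncurry (f k))) {Ψ : Rd d → Rd d → ℝ≥0∞}
    (hΨ : Measurable (Function.uncurry Ψ)) :
    ∫⁻ x : (Fin (m + 1) → Rd d) × (Fin (m + 1) → Rd d),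
      Ψ (x.1 0) (x.2 (Fin.last m) + ∑ k : Fin m, x.2 k.castSucc) *
        (F x.1 x.2 * ∏ k : Fin m, f k (x.1 0 - x.1 k.succ) (x.2 k.castSucc)) =
      ∫⁻ ω, ∫⁻ x, Ψ x ω * symbolTransform F f x ω := by
  set G : (Fin (m + 1) → Rd d) × (Fin (m + 1) → Rd d) → ℝ≥0∞ := fun x =>
    Ψ (x.1 0) (x.2 (Fin.last m) + ∑ k : Fin m, x.2 k.castSucc) *
        (F x.1 x.2 * ∏ k : Fin m, f k (x.1 0 - x.1 k.succ) (x.2 k.castSucc)) with hG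
  have hGm : Measurable G := by
    have h1 : ∀ j, Measurable (fun x : (Fin (m + 1) → Rd d) × (Fin (m + 1) → Rd d) => x.1 j) :=
      fun j => (measurable_pi_apply j).comp measurable_fst
    have h2 : ∀ j, Measurable (fun x : (Fin (m + 1) → Rd d) × (Fin (m + 1) → Rd d) => x.2 j) :=
      fun j => (measurable_pi_apply j).comp measurable_snd
    refine (hΨ.comp ((h1 0).prodMk ((h2 _).add
      (Finset.measurable_sum _ fun k _ => h2 _)))).mul (hF.mul ?_)
    exact Finset.measurable_prod _ fun k _ => (hf k).comp (((h1 0).sub (h1 _)).prodMk (h2 _))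
  have hK : Measurable (fun z : ((Rd d × Rd d) × (Fin m → Rd d)) × (Fin m → Rd d) =>
      Ψ z.1.1.1 z.1.1.2 * (F (Fin.cons z.1.1.1 z.2) (Fin.snoc z.1.2 (z.1.1.2 - ∑ k, z.1.2 k)) *
        ∏ k, f k (z.1.1.1 - z.2 k) (z.1.2 k))) :=
    (hΨ.comp (measurable_fst.comp measurable_fst)).mul (measurable_symbolTransform_integrand hF hf)
  have hK' := hK.lintegral_prod_right' (ν := (volume : Measure (Fin m → Rd d)))
  calc ∫⁻ x, G x = ∫⁻ b, ∫⁻ a, G (a, b) := by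
        rw [Measure.volume_eq_prod, lintegral_prod_symm' _ hGm]
    _ = ∫⁻ ξ : Fin m → Rd d, ∫⁻ ν : Rd d, ∫⁻ x : Rd d, ∫⁻ t : Fin m → Rd d,
          G (Fin.cons x t, Fin.snoc ξ ν) := by
        rw [lintegral_finSnoc hGm.lintegral_prod_left']
        refine lintegral_congr fun ξ => lintegral_congr fun ν => ?_
        exact lintegral_finSucc' (hGm.comp measurable_prodMk_right)
    _ = ∫⁻ ξ : Fin m → Rd d, ∫⁻ ω : Rd d, ∫⁻ x : Rd d, ∫⁻ t : Fin m → Rd d,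
          Ψ x ω * (F (Fin.cons x t) (Fin.snoc ξ (ω - ∑ k, ξ k)) *
            ∏ k, f k (x - t k) (ξ k)) := by
        refine lintegral_congr fun ξ => ?_
        refine (lintegral_sub_right_eq_self (μ := volume) (fun ν : Rd d => ∫⁻ x : Rd d,
          ∫⁻ t : Fin m → Rd d, G (Fin.cons x t, Fin.snoc ξ ν)) (∑ k, ξ k)).symm.trans ?_
        simp only [hG, Fin.cons_zero, Fin.cons_succ, Fin.snoc_last, Fin.snoc_castSucc,
          sub_add_cancel]
    _ = ∫⁻ ω : Rd d, ∫⁻ ξ : Fin m → Rd d, ∫⁻ x : Rd d, ∫⁻ t : Fin m → Rd d,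
          Ψ x ω * (F (Fin.cons x t) (Fin.snoc ξ (ω - ∑ k, ξ k)) *
            ∏ k, f k (x - t k) (ξ k)) := by
        rw [lintegral_lintegral_swap]
        refine Measurable.aemeasurable ?_
        have := hK'.comp (f := fun z : ((Fin m → Rd d) × Rd d) × Rd d =>
          ((z.2, z.1.2), z.1.1)) (by fun_prop)
        exact this.lintegral_prod_right'
    _ = ∫⁻ ω : Rd d, ∫⁻ x : Rd d, ∫⁻ ξ : Fin m → Rd d, ∫⁻ t : Fin m → Rd d,
          Ψ x ω * (F (Fin.cons x t) (Fin.snoc ξ (ω - ∑ k, ξ k)) *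
            ∏ k, f k (x - t k) (ξ k)) := by
        refine lintegral_congr fun ω => ?_
        rw [lintegral_lintegral_swap]
        exact (hK'.comp (f := fun z : (Fin m → Rd d) × Rd d =>
          ((z.2, ω), z.1)) (by fun_prop)).aemeasurable
    _ = _ := by
        refine lintegral_congr fun ω => lintegral_congr fun x => ?_
        have hS := measurable_symbolTransform_integrand hF hf
        rw [symbolTransform, ← lintegral_const_mul]
        · refine lintegral_congr fun ξ => ?_
          rw [lintegral_const_mul]
          exact hS.comp (f := fun t : Fin m → Rd d => (((x, ω), ξ), t)) (by fun_prop)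
        · exact hS.lintegral_prod_right'.comp (f := fun ξ : Fin m → Rd d => ((x, ω), ξ))
            (by fun_prop)

end ChangeOfVariables

/-! ### Pointwise bounds of the integrand -/

section OperatorEstimates

variable {m d : ℕ}

/-- The moduli of the translated weighted short-time Fourier transforms of the arguments. -/
noncomputable def shiftedModulus (w : Fin m → Rd d × Rd d → ℝ) (B : Fin m → Rd d)
    (f : Fin m → 𝓢'(Rd d, ℂ)) (k : Fin m) (t ξ : Rd d) : ℝ≥0∞ :=
  ‖weightedStft (w k) (f k) (t - B k, ξ)‖ₑ

lemma continuous_weightedStft {w : Rd d × Rd d → ℝ} (hw : Continuous w) (f : 𝓢'(Rd d, ℂ)) :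
    Continuous (weightedStft w f) :=
  (Complex.continuous_ofReal.comp hw).mul (continuous_stft _ f continuous_fst continuous_snd)

lemma measurable_shiftedModulus {w : Fin m → Rd d × Rd d → ℝ} (hw : ∀ k, Continuous (w k))
    (B : Fin m → Rd d) (f : Fin m → 𝓢'(Rd d, ℂ)) (k : Fin m) :
    Measurable (Function.uncurry (shiftedModulus w B f k)) :=
  (((continuous_weightedStft (hw k) (f k)).comp
    ((continuous_fst.sub continuous_const).prodMk continuous_snd)).enorm).measurable

/-- The translation by `B k`, left over from the choice of the dual window, is invisible to the
norms. -/
lemma eLpNorm_shiftedModulus {w : Fin m → Rd d × Rd d → ℝ} (hw : ∀ k, Continuous (w k))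
    (B : Fin m → Rd d) (f : Fin m → 𝓢'(Rd d, ℂ)) (k : Fin m) (p q : ℝ≥0∞) :
    eLpNorm (fun ξ => eLpNorm (fun t => shiftedModulus w B f k t ξ) p volume) q volume =
      modNorm p q (w k) (f k) := by
  rw [modNorm, mixedNorm₂]
  congr 1
  funext ξ
  have h : Measurable (fun t : Rd d => ‖weightedStft (w k) (f k) (t, ξ)‖ₑ) :=
    ((continuous_weightedStft (hw k) (f k)).comp
      (continuous_id.prodMk continuous_const)).enorm.measurable
  exact (eLpNorm_comp_sub_right p h (B k)).trans (eLpNorm_enorm _)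

/-- The weight condition, for the integrand of the pairing. -/
lemma exists_enorm_mul_atomStft_le
    {v : (Fin (m + 1) → Rd d) × (Fin (m + 1) → Rd d) → ℝ} (hv : ∀ x, 0 < v x)
    {w₀ : Rd d × Rd d → ℝ} (hw₀ : ∀ x, 0 < w₀ x)
    {w : Fin m → Rd d × Rd d → ℝ} (hw : ∀ k, IsWeight (w k))
    (hvw : ∀ (x : Rd d) (t ξ : Fin m → Rd d) (ν : Rd d),
      (v (Fin.cons x t, Fin.snoc ξ ν))⁻¹ ≤
        (w₀ (x, ν + ∑ k, ξ k))⁻¹ * ∏ k, w k (x - t k, ξ k)) (B₀ : Rd d) (B : Fin m → Rd d) :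
    ∃ C : NNReal, ∀ (S : ℂ) (f : Fin m → 𝓢'(Rd d, ℂ)) (ψ : 𝓢(Rd d, ℂ))
      (x : (Fin (m + 1) → Rd d) × (Fin (m + 1) → Rd d)),
      ‖S * atomStft B₀ B f ψ x‖ₑ ≤ C *
        ((‖stft (gaussian (Rd d)) (ψ : 𝓢'(Rd d, ℂ)) (x.1 0)
            (B₀ - (x.2 (Fin.last m) + ∑ k : Fin m, x.2 k.castSucc))‖ₑ *
          ENNReal.ofReal (w₀ (x.1 0, x.2 (Fin.last m) + ∑ k : Fin m, x.2 k.castSucc))⁻¹) *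
        (‖(v x : ℂ) * S‖ₑ *
          ∏ k, shiftedModulus w B f k (x.1 0 - x.1 k.succ) (x.2 k.castSucc))) := by
  choose C N hC h using fun k => (hw k).exists_le_prod
  -- The weight condition evaluates `w k` at `x - t_k`, the integrand has `f k` at `x - t_k - B k`;
  -- moderateness reconciles the two at the cost of a constant.
  have hshift : ∀ k (t ξ : Rd d), w k (t, ξ) ≤ C k * (1 + ‖B k‖) ^ N k * w k (t - B k, ξ) := by
    intro k t ξ
    have := h k t (t - B k) ξ ξ
    simpa using this
  have hC0 : ∀ k, 0 ≤ C k * (1 + ‖B k‖) ^ N k := fun k => mul_nonneg (hC k) (by positivity)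
  refine ⟨(∏ k, C k * (1 + ‖B k‖) ^ N k).toNNReal, fun S f ψ x => ?_⟩
  set ω := x.2 (Fin.last m) + ∑ k : Fin m, x.2 k.castSucc with hω
  have hvx : (v x)⁻¹ ≤ (w₀ (x.1 0, ω))⁻¹ * ∏ k : Fin m, (C k * (1 + ‖B k‖) ^ N k *
      w k (x.1 0 - x.1 k.succ - B k, x.2 k.castSucc)) := by
    have h1 := hvw (x.1 0) (fun k => x.1 k.succ) (fun k => x.2 k.castSucc) (x.2 (Fin.last m))
    have h2 : (Fin.cons (x.1 0) (fun k : Fin m => x.1 k.succ) : Fin (m + 1) → Rd d) = x.1 :=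
      Fin.cons_self_tail x.1
    have h3 : (Fin.snoc (fun k : Fin m => x.2 k.castSucc) (x.2 (Fin.last m)) :
        Fin (m + 1) → Rd d) = x.2 := Fin.snoc_init_self x.2
    rw [h2, h3] at h1
    refine h1.trans ?_
    have := (hw₀ (x.1 0, ω)).le
    gcongr with k
    · exact fun k _ => ((hw k).pos _).le
    · exact hshift k _ _
  have hreal : ‖S * atomStft B₀ B f ψ x‖ ≤ (∏ k, C k * (1 + ‖B k‖) ^ N k) *
      ((‖stft (gaussian (Rd d)) (ψ : 𝓢'(Rd d, ℂ)) (x.1 0) (B₀ - ω)‖ * (w₀ (x.1 0, ω))⁻¹) *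
        (‖(v x : ℂ) * S‖ * ∏ k, ‖weightedStft (w k) (f k)
          (x.1 0 - x.1 k.succ - B k, x.2 k.castSucc)‖)) := by
    have hv0 := hv x
    have hn : ∀ k, ‖weightedStft (w k) (f k) (x.1 0 - x.1 k.succ - B k, x.2 k.castSucc)‖ =
        w k (x.1 0 - x.1 k.succ - B k, x.2 k.castSucc) *
        ‖stft (gaussian (Rd d)) (f k) (x.1 0 - x.1 k.succ - B k) (x.2 k.castSucc)‖ := fun k => by
      rw [weightedStft, norm_mul, Complex.norm_real, Real.norm_of_nonneg ((hw k).pos _).le]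
    calc ‖S * atomStft B₀ B f ψ x‖
        = (v x)⁻¹ * (v x * ‖S‖ * (‖stft (gaussian (Rd d)) (ψ : 𝓢'(Rd d, ℂ)) (x.1 0) (B₀ - ω)‖ *
          ∏ k : Fin m, ‖stft (gaussian (Rd d)) (f k) (x.1 0 - x.1 k.succ - B k)
            (x.2 k.castSucc)‖)) := by
          rw [mul_assoc, inv_mul_cancel_left₀ hv0.ne', atomStft, norm_mul, norm_mul, norm_prod]
      _ ≤ ((w₀ (x.1 0, ω))⁻¹ * ∏ k : Fin m, (C k * (1 + ‖B k‖) ^ N k *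
          w k (x.1 0 - x.1 k.succ - B k, x.2 k.castSucc))) *
          (v x * ‖S‖ * (‖stft (gaussian (Rd d)) (ψ : 𝓢'(Rd d, ℂ)) (x.1 0) (B₀ - ω)‖ *
          ∏ k : Fin m, ‖stft (gaussian (Rd d)) (f k) (x.1 0 - x.1 k.succ - B k)
            (x.2 k.castSucc)‖)) := by gcongr
      _ = _ := by
          simp_rw [hn]
          rw [norm_mul, Complex.norm_real, Real.norm_of_nonneg hv0.le]
          simp only [Finset.prod_mul_distrib]
          ring
  have hw0 := hw₀ (x.1 0, ω)
  rw [← ofReal_norm]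
  refine (ENNReal.ofReal_le_ofReal hreal).trans_eq ?_
  rw [ENNReal.ofReal_mul (Finset.prod_nonneg fun k _ => hC0 k),
    ENNReal.ofReal_mul (by positivity), ENNReal.ofReal_mul (norm_nonneg _),
    ENNReal.ofReal_mul (norm_nonneg _), ENNReal.ofReal_prod_of_nonneg fun k _ => norm_nonneg _]
  simp only [ofReal_norm]
  rfl

/-- Finiteness of the pairing of a mixed norm function with a decaying kernel. -/
lemma exists_lintegral_decay_mul_le {a b : ℝ≥0∞} (ha : 1 ≤ a) (hb : 1 ≤ b) :
    ∃ C : NNReal, ∀ H : Rd d → Rd d → ℝ≥0∞, Measurable (Function.uncurry H) →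
      ∫⁻ ω, ∫⁻ x, decayKernel x * decayKernel ω * H x ω ≤
        C * eLpNorm (fun ω => eLpNorm (fun x => H x ω) a volume) b volume := by
  have hca := ENNReal.HolderConjugate.conjExponent ha
  have hcb := ENNReal.HolderConjugate.conjExponent hb
  have h1a : 1 ≤ a.conjExponent := by
    rw [← ENNReal.inv_le_one, ← hca.inv_add_inv_eq_one]; exact le_add_self
  have h1b : 1 ≤ b.conjExponent := by
    rw [← ENNReal.inv_le_one, ← hcb.inv_add_inv_eq_one]; exact le_add_self
  have hka := eLpNorm_decayKernel_lt_top (d := d) h1a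
  have hkb := eLpNorm_decayKernel_lt_top (d := d) h1b
  refine ⟨(eLpNorm (decayKernel : Rd d → ℝ≥0∞) b.conjExponent volume *
    eLpNorm (decayKernel : Rd d → ℝ≥0∞) a.conjExponent volume).toNNReal, fun H hH => ?_⟩
  rw [ENNReal.coe_toNNReal (ENNReal.mul_lt_top hkb hka).ne]
  have hol : ∀ {c : ℝ≥0∞} (hc : c.HolderConjugate c.conjExponent) {h : Rd d → ℝ≥0∞},
      Measurable h → ∫⁻ x, decayKernel x * h x ≤
        eLpNorm (decayKernel : Rd d → ℝ≥0∞) c.conjExponent volume * eLpNorm h c volume := by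
    intro c hc h hh
    have := eLpNorm_mul_le_mul_eLpNorm (μ := (volume : Measure (Rd d))) (a := 1) le_rfl
      (p := c.conjExponent) (q := c) (by rw [add_comm, hc.inv_add_inv_eq_one, inv_one])
      measurable_decayKernel hh
    simpa [eLpNorm_one_eq_lintegral_enorm] using this
  calc ∫⁻ ω, ∫⁻ x, decayKernel x * decayKernel ω * H x ω
      = ∫⁻ ω, decayKernel ω * ∫⁻ x, decayKernel x * H x ω := by
        refine lintegral_congr fun ω => ?_
        have hm : Measurable fun x => decayKernel x * H x ω :=
          measurable_decayKernel.mul (hH.comp measurable_prodMk_right)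
        rw [← lintegral_const_mul _ hm]
        refine lintegral_congr fun x => ?_
        ring
    _ ≤ ∫⁻ ω, decayKernel ω * (eLpNorm (decayKernel : Rd d → ℝ≥0∞) a.conjExponent volume *
          eLpNorm (fun x => H x ω) a volume) := by
        gcongr with ω
        exact hol hca (hH.comp measurable_prodMk_right)
    _ = eLpNorm (decayKernel : Rd d → ℝ≥0∞) a.conjExponent volume *
          ∫⁻ ω, decayKernel ω * eLpNorm (fun x => H x ω) a volume := by
        have hm : Measurable fun ω => decayKernel ω * eLpNorm (fun x => H x ω) a volume :=
          measurable_decayKernel.mul (measurable_eLpNorm_right a hH)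
        rw [← lintegral_const_mul _ hm]
        refine lintegral_congr fun x => ?_
        ring
    _ ≤ eLpNorm (decayKernel : Rd d → ℝ≥0∞) a.conjExponent volume *
          (eLpNorm (decayKernel : Rd d → ℝ≥0∞) b.conjExponent volume *
            eLpNorm (fun ω => eLpNorm (fun x => H x ω) a volume) b volume) := by
        gcongr
        exact hol hcb (measurable_eLpNorm_right a hH)
    _ = _ := by ring

/-- A pointwise bound by a convolution gives a bound of the norm in a modulation space. -/
lemma modNorm_le_of_le_conv {p q a b e₁ e₂ : ℝ≥0∞} (hp : 1 ≤ p) (ha : 1 ≤ a) (hb : 1 ≤ b)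
    (he₁ : 1 ≤ e₁) (he₂ : 1 ≤ e₂) (h₁ : 1 + p⁻¹ = a⁻¹ + e₁⁻¹) (h₂ : 1 + q⁻¹ = b⁻¹ + e₂⁻¹)
    {H : Rd d → Rd d → ℝ≥0∞} (hH : Measurable (Function.uncurry H)) {w : Rd d × Rd d → ℝ}
    {T : 𝓢'(Rd d, ℂ)} {C : NNReal} (h : ∀ z ζ, ‖weightedStft w T (z, ζ)‖ₑ ≤
      C * ∫⁻ ω, ∫⁻ x, H x ω * decayKernel (z - x) * decayKernel (ζ - ω)) :
    modNorm p q w T ≤ C * (eLpNorm (fun ω => eLpNorm (fun x => H x ω) a volume) b volume *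
        (eLpNorm (decayKernel : Rd d → ℝ≥0∞) e₁ volume *
          eLpNorm (decayKernel : Rd d → ℝ≥0∞) e₂ volume)) := by
  refine le_trans ?_ (mul_le_mul_right
    (mixedNorm_conv_le hp ha hb he₁ he₂ h₁ h₂ hH measurable_decayKernel) _)
  rw [modNorm, mixedNorm₂]
  refine (eLpNorm_mono_ennreal fun ζ => ?_).trans
    (eLpNorm_const_mul_ennreal_le ENNReal.coe_ne_top _)
  refine (eLpNorm_enorm _).symm.trans_le ((eLpNorm_mono_ennreal fun z => h z ζ).trans
    (eLpNorm_const_mul_ennreal_le ENNReal.coe_ne_top _))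

end OperatorEstimates

/-! ### Schwartz functions in modulation spaces -/

section SchwartzInclusion

variable {d : ℕ}

/-- Schwartz functions belong to all weighted modulation spaces. -/
lemma coe_mem_modulationSpace {p q : ℝ≥0∞} (hp : 1 ≤ p) (hq : 1 ≤ q) {w : Rd d × Rd d → ℝ}
    (hw : IsWeight w) (f : 𝓢(Rd d, ℂ)) : (f : 𝓢'(Rd d, ℂ)) ∈ modulationSpace p q w := by
  refine ⟨(continuous_weightedStft hw.continuous _).measurable, ?_⟩
  obtain ⟨C, N, hC, h⟩ := hw.exists_le_prod
  obtain ⟨M, C', hC', h'⟩ := exists_norm_stft_coe_le (gaussian (Rd d)) (N + (d + 1))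
  have hw0 := hw.pos (0, 0)
  set K : ℝ := C * w (0, 0) * (C' * schwartzSup (Rd d) M f) with hK
  have hbound : ∀ t ξ, ‖weightedStft w (f : 𝓢'(Rd d, ℂ)) (t, ξ)‖ₑ ≤
      ENNReal.ofReal K * (decayKernel ξ * decayKernel t) := by
    intro t ξ
    have h1 := h t 0 ξ 0
    have h2 := h' f t ξ
    have hwt := (hw.pos (t, ξ)).le
    have hs : 0 ≤ schwartzSup (Rd d) M f := apply_nonneg _ _
    rw [sub_zero, sub_zero] at h1
    rw [← ofReal_norm, decayKernel, decayKernel, ← ENNReal.ofReal_mul (by positivity),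
      ← ENNReal.ofReal_mul (by positivity)]
    refine ENNReal.ofReal_le_ofReal ?_
    rw [← mul_inv, ← div_eq_mul_inv, le_div_iff₀ (by positivity), weightedStft, norm_mul,
      Complex.norm_real, Real.norm_of_nonneg hwt]
    calc _ ≤ (C * ((1 + ‖t‖) ^ N * (1 + ‖ξ‖) ^ N) * w (0, 0)) *
          ‖stft (gaussian (Rd d)) (f : 𝓢'(Rd d, ℂ)) t ξ‖ *
          ((1 + ‖ξ‖) ^ (d + 1) * (1 + ‖t‖) ^ (d + 1)) := by gcongr
      _ = C * w (0, 0) * (‖stft (gaussian (Rd d)) (f : 𝓢'(Rd d, ℂ)) t ξ‖ *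
          ((1 + ‖t‖) ^ (N + (d + 1)) * (1 + ‖ξ‖) ^ (N + (d + 1)))) := by
          rw [pow_add, pow_add]; ring
      _ ≤ _ := by rw [hK]; gcongr
  have hle : modNorm p q w (f : 𝓢'(Rd d, ℂ)) ≤ ENNReal.ofReal K *
      (eLpNorm (decayKernel : Rd d → ℝ≥0∞) p volume *
        eLpNorm (decayKernel : Rd d → ℝ≥0∞) q volume) := by
    have hp0 : eLpNorm (decayKernel : Rd d → ℝ≥0∞) p volume ≠ ∞ :=
      (eLpNorm_decayKernel_lt_top hp).ne
    rw [modNorm, mixedNorm₂, ← mul_assoc,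
      ← eLpNorm_const_mul_ennreal (ENNReal.mul_ne_top ENNReal.ofReal_ne_top hp0)]
    refine eLpNorm_mono_ennreal fun ξ => ?_
    refine (eLpNorm_enorm _).symm.trans_le ((eLpNorm_mono_ennreal fun t => hbound t ξ).trans ?_)
    simp_rw [← mul_assoc]
    rw [eLpNorm_const_mul_ennreal (ENNReal.mul_ne_top ENNReal.ofReal_ne_top
      ((decayKernel_le_one ξ).trans_lt ENNReal.one_lt_top).ne)]
    exact (mul_right_comm _ _ _).le
  exact hle.trans_lt (ENNReal.mul_lt_top ENNReal.ofReal_lt_top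
    (ENNReal.mul_lt_top (eLpNorm_decayKernel_lt_top hp) (eLpNorm_decayKernel_lt_top hq)))

end SchwartzInclusion

/-! ### Linearity and size of the pairing integrand -/

section Pairing

variable {m d : ℕ}

lemma atomStft_add (B₀ : Rd d) (B : Fin m → Rd d) (f : Fin m → 𝓢'(Rd d, ℂ))
    (ψ₁ ψ₂ : 𝓢(Rd d, ℂ)) (x : (Fin (m + 1) → Rd d) × (Fin (m + 1) → Rd d)) :
    atomStft B₀ B f (ψ₁ + ψ₂) x = atomStft B₀ B f ψ₁ x + atomStft B₀ B f ψ₂ x := by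
  rw [atomStft, atomStft, atomStft, map_add, ← add_mul]
  rfl

lemma atomStft_smul (B₀ : Rd d) (B : Fin m → Rd d) (f : Fin m → 𝓢'(Rd d, ℂ)) (a : ℂ)
    (ψ : 𝓢(Rd d, ℂ)) (x : (Fin (m + 1) → Rd d) × (Fin (m + 1) → Rd d)) :
    atomStft B₀ B f (a • ψ) x = a * atomStft B₀ B f ψ x := by
  rw [atomStft, atomStft, map_smul, ← mul_assoc]
  rfl

/-- `atomStft` as a multilinear map of its distributional arguments. -/
noncomputable def atomMultilinear (E : Fin m → Submodule ℂ 𝓢'(Rd d, ℂ)) (B₀ : Rd d)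
    (B : Fin m → Rd d) (ψ : 𝓢(Rd d, ℂ)) (x : (Fin (m + 1) → Rd d) × (Fin (m + 1) → Rd d)) :
    MultilinearMap ℂ (fun k => E k) ℂ :=
  stft (gaussian (Rd d)) (ψ : 𝓢'(Rd d, ℂ)) (x.1 0)
      (B₀ - (x.2 (Fin.last m) + ∑ k : Fin m, x.2 k.castSucc)) •
    (MultilinearMap.mkPiAlgebra ℂ (Fin m) ℂ).compLinearMap fun k =>
      { toFun := fun f : E k => stft (gaussian (Rd d)) (f : 𝓢'(Rd d, ℂ))
          (x.1 0 - x.1 k.succ - B k) (x.2 k.castSucc)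
        map_add' := fun _ _ => rfl
        map_smul' := fun _ _ => rfl }

lemma atomMultilinear_apply (E : Fin m → Submodule ℂ 𝓢'(Rd d, ℂ)) (B₀ : Rd d)
    (B : Fin m → Rd d) (ψ : 𝓢(Rd d, ℂ)) (x : (Fin (m + 1) → Rd d) × (Fin (m + 1) → Rd d))
    (f : (k : Fin m) → E k) :
    atomMultilinear E B₀ B ψ x f = atomStft B₀ B (fun k => (f k : 𝓢'(Rd d, ℂ))) ψ x := by
  simp only [atomMultilinear, atomStft, smul_apply,
    MultilinearMap.compLinearMap_apply, MultilinearMap.mkPiAlgebra_apply, smul_eq_mul]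
  rfl

lemma continuous_atomStft (B₀ : Rd d) (B : Fin m → Rd d) (f : Fin m → 𝓢'(Rd d, ℂ))
    (ψ : 𝓢(Rd d, ℂ)) : Continuous (atomStft B₀ B f ψ) := by
  refine (continuous_stft _ _ (by fun_prop) (by fun_prop)).mul (continuous_finsetProd _ fun k _ => ?_)
  exact continuous_stft _ _ (by fun_prop) (by fun_prop)

lemma exists_temperedDistribution (J : 𝓢(Rd d, ℂ) → ℂ) (hadd : ∀ f g, J (f + g) = J f + J g)
    (hsmul : ∀ (a : ℂ) f, J (a • f) = a * J f) {M : ℕ} {C : ℝ} (hC : 0 ≤ C)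
    (hJ : ∀ f, ‖J f‖ ≤ C * schwartzSup (Rd d) M f) :
    ∃ T : 𝓢'(Rd d, ℂ), ∀ ψ, T ψ = J ψ :=
  ⟨ContinuousLinearMap.toPointwiseConvergenceCLM ℂ (RingHom.id ℂ) 𝓢(Rd d, ℂ) ℂ
    (SchwartzMap.mkCLMtoNormedSpace (σ := RingHom.id ℂ) J hadd hsmul
      ⟨Finset.Iic (M, M), C, hC, hJ⟩), fun _ => rfl⟩

lemma lintegral_mul_atomStft_le
    {v : (Fin (m + 1) → Rd d) × (Fin (m + 1) → Rd d) → ℝ} (hv : IsWeight v)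
    {w₀ : Rd d × Rd d → ℝ} (hw₀ : IsWeight w₀)
    {w : Fin m → Rd d × Rd d → ℝ} (hw : ∀ k, IsWeight (w k))
    (hvw : ∀ (x : Rd d) (t ξ : Fin m → Rd d) (ν : Rd d),
      (v (Fin.cons x t, Fin.snoc ξ ν))⁻¹ ≤
        (w₀ (x, ν + ∑ k, ξ k))⁻¹ * ∏ k, w k (x - t k, ξ k)) (B₀ : Rd d) (B : Fin m → Rd d) :
    ∃ C : NNReal, ∀ (S : (Fin (m + 1) → Rd d) → (Fin (m + 1) → Rd d) → ℂ),
      Continuous (Function.uncurry S) → ∀ (f : Fin m → 𝓢'(Rd d, ℂ)) (ψ : 𝓢(Rd d, ℂ)),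
      ∫⁻ x, ‖S x.1 x.2 * atomStft B₀ B f ψ x‖ₑ ≤
        C * ∫⁻ ω, ∫⁻ x, (‖stft (gaussian (Rd d)) (ψ : 𝓢'(Rd d, ℂ)) x (B₀ - ω)‖ₑ *
          ENNReal.ofReal (w₀ (x, ω))⁻¹) *
          symbolTransform (fun a b => ‖(v (a, b) : ℂ) * S a b‖ₑ) (shiftedModulus w B f) x ω := by
  obtain ⟨C, hC⟩ := exists_enorm_mul_atomStft_le hv.pos hw₀.pos hw hvw B₀ B
  refine ⟨C, fun S hS f ψ => ?_⟩
  have hF : Measurable (Function.uncurry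
      fun (a b : Fin (m + 1) → Rd d) => ‖(v (a, b) : ℂ) * S a b‖ₑ) :=
    ((Complex.continuous_ofReal.comp hv.continuous).mul hS).enorm.measurable
  have hΨ : Measurable (Function.uncurry fun (x ω : Rd d) =>
      ‖stft (gaussian (Rd d)) (ψ : 𝓢'(Rd d, ℂ)) x (B₀ - ω)‖ₑ *
          ENNReal.ofReal (w₀ (x, ω))⁻¹) := by
    have h₁ : Measurable fun z : Rd d × Rd d =>
        ‖stft (gaussian (Rd d)) (ψ : 𝓢'(Rd d, ℂ)) z.1 (B₀ - z.2)‖ₑ :=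
      (continuous_stft _ _ continuous_fst (continuous_const.sub continuous_snd)).enorm.measurable
    have h₂ : Measurable fun z : Rd d × Rd d => ENNReal.ofReal (w₀ z)⁻¹ :=
      hw₀.continuous.measurable.inv.ennreal_ofReal
    exact h₁.mul h₂
  rw [← lintegral_mul_prod_eq_symbolTransform hF
    (measurable_shiftedModulus (fun k => (hw k).continuous) B f) hΨ,
    ← lintegral_const_mul' _ _ ENNReal.coe_ne_top]
  exact lintegral_mono fun x => hC _ f ψ x

end Pairing

/-! ### Exponents and the bound for the transformed symbol -/

section Boundedness

variable {m d : ℕ}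

/-- The mixed norm estimate for the transform of a symbol, in terms of the norms of modulation
spaces. -/
lemma exists_mixedNorm_symbolTransform_le {p q r s : Fin (m + 1) → ℝ≥0∞}
    (hp : ∀ i, 1 ≤ p i) (hq : ∀ i, 1 ≤ q i) (hr : ∀ i, 1 ≤ r i) (hs : ∀ i, 1 ≤ s i)
    (hpr : ∀ k : Fin m, (r k.castSucc).conjExponent ≤ p k.succ ∧
      p k.succ ≤ (r k.succ).conjExponent)
    (hqs : ∀ k : Fin m, (s k.castSucc).conjExponent ≤ q k.castSucc ∧
      q k.castSucc ≤ (s k.succ).conjExponent)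
    (hpr_sum : (m : ℝ≥0∞) + 1 / p 0 ≤
      1 / r 0 + ∑ k : Fin m, (1 / p k.succ + 1 / r k.succ))
    (hqs_sum : (m : ℝ≥0∞) + 1 / q (Fin.last m) ≤
      1 / s (Fin.last m) + ∑ k : Fin m, (1 / q k.castSucc + 1 / s k.castSucc)) :
    ∃ a b e₁ e₂ : ℝ≥0∞, 1 ≤ a ∧ 1 ≤ b ∧ 1 ≤ e₁ ∧ 1 ≤ e₂ ∧ 1 + (p 0)⁻¹ = a⁻¹ + e₁⁻¹ ∧
      1 + (q (Fin.last m))⁻¹ = b⁻¹ + e₂⁻¹ ∧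
      ∀ (F : (Fin (m + 1) → Rd d) → (Fin (m + 1) → Rd d) → ℝ≥0∞),
        Measurable (Function.uncurry F) → ∀ (w : Fin m → Rd d × Rd d → ℝ),
        (∀ k, Continuous (w k)) → ∀ (B : Fin m → Rd d) (f : Fin m → 𝓢'(Rd d, ℂ)),
        eLpNorm (fun ω => eLpNorm
          (fun x => symbolTransform F (shiftedModulus w B f) x ω) a volume) b volume ≤
        iteratedNorm (m + 1) s (fun c => iteratedNorm (m + 1) r (fun y => F y c)) *
          ∏ k, modNorm (p k.succ) (q k.castSucc) (w k) (f k) := by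
  simp only [one_div] at hpr_sum hqs_sum
  have hr₁ : ∀ k : Fin m, (r k.castSucc)⁻¹ + (p k.succ)⁻¹ ≤ 1 := fun k =>
    inv_add_inv_le_one_of_conjExponent_le (hr _) (hpr k).1
  have hs₁ : ∀ k : Fin m, (s k.castSucc)⁻¹ + (q k.castSucc)⁻¹ ≤ 1 := fun k =>
    inv_add_inv_le_one_of_conjExponent_le (hs _) (hqs k).1
  have hone : ∀ {c : ℝ≥0∞} {u : Fin m → ℝ≥0∞}, 1 ≤ c → (∀ k, u k ≤ 1) →
      c⁻¹ + ∑ k, u k ≤ m + 1 := by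
    intro c u hc hu
    rw [add_comm]
    refine add_le_add ((Finset.sum_le_sum fun k _ => hu k).trans_eq (by simp))
      (ENNReal.inv_le_one.2 hc)
  -- Regrouping `p k.succ` with `r k.castSucc` makes each summand at most `1`. The bound `m + 1`
  -- ensures that the intermediate exponent `a` is at least `1`.
  have hS₁ : (r 0)⁻¹ + ∑ k : Fin m, ((p k.succ)⁻¹ + (r k.succ)⁻¹) ≤ m + 1 := by
    have h : (r 0)⁻¹ + ∑ k : Fin m, ((p k.succ)⁻¹ + (r k.succ)⁻¹) =
        (r (Fin.last m))⁻¹ + ∑ k : Fin m, ((r k.castSucc)⁻¹ + (p k.succ)⁻¹) := by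
      rw [Finset.sum_add_distrib, Finset.sum_add_distrib, add_left_comm,
        ← Fin.sum_univ_succ (fun k => (r k)⁻¹), Fin.sum_univ_castSucc (fun k => (r k)⁻¹)]
      ring
    rw [h]
    exact hone (hr _) hr₁
  have hS₂ : (s (Fin.last m))⁻¹ + ∑ k : Fin m, ((q k.castSucc)⁻¹ + (s k.castSucc)⁻¹) ≤ m + 1 :=
    hone (hs _) fun k => by rw [add_comm]; exact hs₁ k
  obtain ⟨a, e₁, ha, he₁, ha', hae⟩ := exists_exponents hpr_sum hS₁
  obtain ⟨b, e₂, hb, he₂, hb', hbe⟩ := exists_exponents hqs_sum hS₂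
  refine ⟨a, b, e₁, e₂, ha, hb, he₁, he₂, hae, hbe, fun F hF w hw B f => ?_⟩
  have h := mixedNorm_symbolTransform_le ha hr hs (fun k => hp k.succ) (fun k => hq k.castSucc)
    hr₁ (fun k => one_le_inv_add_inv_of_le_conjExponent (hr _) (hpr k).2) ha' hs₁
    (fun k => one_le_inv_add_inv_of_le_conjExponent (hs _) (hqs k).2) hb' hF
    (measurable_shiftedModulus hw B f)
  simpa only [eLpNorm_shiftedModulus hw] using h

end Boundedness

end ModSpace

/-! ### Construction and boundedness of the extension -/

theorem corollary3p6 (m d : ℕ)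
    -- entries `p 0, …, p m` are `p₀, …, pₘ`; entries `q 0, …, q m` are `q₁, …, q_{m+1}`
    (p q r s : Fin (m + 1) → ℝ≥0∞)
    (hp : ∀ i, 1 ≤ p i) (hq : ∀ i, 1 ≤ q i) (hr : ∀ i, 1 ≤ r i) (hs : ∀ i, 1 ≤ s i)
    -- `r₀' ≤ p₁ ≤ r₁' ≤ ⋯ ≤ pₘ ≤ rₘ'`
    (hpr : ∀ k : Fin m, (r k.castSucc).conjExponent ≤ p k.succ ∧
      p k.succ ≤ (r k.succ).conjExponent)
    -- `s₁' ≤ q₁ ≤ s₂' ≤ ⋯ ≤ qₘ ≤ s_{m+1}'`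
    (hqs : ∀ k : Fin m, (s k.castSucc).conjExponent ≤ q k.castSucc ∧
      q k.castSucc ≤ (s k.succ).conjExponent)
    (hpr_sum : (m : ℝ≥0∞) + 1 / p 0 ≤
      1 / r 0 + ∑ k : Fin m, (1 / p k.succ + 1 / r k.succ))
    (hqs_sum : (m : ℝ≥0∞) + 1 / q (Fin.last m) ≤
      1 / s (Fin.last m) + ∑ k : Fin m, (1 / q k.castSucc + 1 / s k.castSucc))
    (v : (Fin (m + 1) → Rd d) × (Fin (m + 1) → Rd d) → ℝ) (hv : IsWeight v)
    (w₀ : Rd d × Rd d → ℝ) (hw₀ : IsWeight w₀)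
    (w : Fin m → Rd d × Rd d → ℝ) (hw : ∀ k, IsWeight (w k))
    (hvw : ∀ (x : Rd d) (t ξ : Fin m → Rd d) (ν : Rd d),
      (v (Fin.cons x t, Fin.snoc ξ ν))⁻¹ ≤
        (w₀ (x, ν + ∑ k, ξ k))⁻¹ * ∏ k, w k (x - t k, ξ k))
    -- the window that defines the symbol class
    (g : 𝓢(SymbolDomain m d, ℂ)) (hg : g ≠ 0) :
    ∃ hS : ∀ (k : Fin m) (f : 𝓢(Rd d, ℂ)),
        (f : 𝓢'(Rd d, ℂ)) ∈ modulationSpace (p k.succ) (q k.castSucc) (w k),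
      ∃ C : NNReal, ∀ σ ∈ symbolModulationSpace g r s (Equiv.refl _) (Equiv.refl _) v,
        ∃ T : MultilinearMap ℂ (fun k : Fin m => modulationSpace (p k.succ) (q k.castSucc) (w k))
            (modulationSpace (p 0) (q (Fin.last m)) w₀),
          (∀ f : Fin m → 𝓢(Rd d, ℂ),
            (T (fun k => ⟨(f k : 𝓢'(Rd d, ℂ)), hS k (f k)⟩) : 𝓢'(Rd d, ℂ)) =
              pseudoDiffOp σ f) ∧
          ∀ f : (k : Fin m) → modulationSpace (p k.succ) (q k.castSucc) (w k),
            modNorm (p 0) (q (Fin.last m)) w₀ (T f) ≤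
              C * symbolNorm g r s (Equiv.refl _) (Equiv.refl _) v σ *
                ∏ k, modNorm (p k.succ) (q k.castSucc) (w k) (f k) := by
  refine ⟨fun k f => coe_mem_modulationSpace (hp _) (hq _) (hw k) f, ?_⟩
  obtain ⟨c, θ, B₀, B, hθ, hθ1, hpair⟩ := exists_pairing_eq_integral hg
  obtain ⟨C₁, hC₁⟩ := lintegral_mul_atomStft_le hv hw₀ hw hvw B₀ B
  obtain ⟨a, b, e₁, e₂, ha, hb, he₁, he₂, hae, hbe, hnorm⟩ :=
    exists_mixedNorm_symbolTransform_le (d := d) hp hq hr hs hpr hqs hpr_sum hqs_sum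
  obtain ⟨C₂, hC₂⟩ := hw₀.exists_stft_tfShift_le_decay (gaussian (Rd d)) B₀
  obtain ⟨M, C₃, hC₃0, hC₃⟩ := hw₀.exists_stft_coe_le_decay (gaussian (Rd d)) B₀
  obtain ⟨C₄, hC₄⟩ := exists_lintegral_decay_mul_le (d := d) ha hb
  set κ : ℝ≥0∞ := eLpNorm (decayKernel : Rd d → ℝ≥0∞) e₁ volume *
    eLpNorm (decayKernel : Rd d → ℝ≥0∞) e₂ volume with hκ
  have hκ' : κ ≠ ∞ := (ENNReal.mul_lt_top (eLpNorm_decayKernel_lt_top he₁)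
    (eLpNorm_decayKernel_lt_top he₂)).ne
  -- `c` comes from the pairing formula, `C₁` from the weight condition, `C₂` from the decay of the
  -- Gaussian's transform against `w₀`, and `κ` from the last Young inequality. `C₃` and `C₄` only
  -- guarantee that the extension is well defined.
  refine ⟨‖c‖₊ * C₁ * C₂ * κ.toNNReal, fun σ hσ => ?_⟩
  set E := fun k : Fin m => modulationSpace (p k.succ) (q k.castSucc) (w k)
  set F : (Fin (m + 1) → Rd d) → (Fin (m + 1) → Rd d) → ℝ≥0∞ :=
    fun a b => ‖(v (a, b) : ℂ) * symbolStft g σ a b‖ₑ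
  have hScont : Continuous (Function.uncurry (symbolStft g σ)) := continuous_symbolStft g σ
  have hF : Measurable (Function.uncurry F) :=
    ((Complex.continuous_ofReal.comp hv.continuous).mul hScont).enorm.measurable
  let H : (Fin m → 𝓢'(Rd d, ℂ)) → Rd d → Rd d → ℝ≥0∞ :=
    fun f => symbolTransform F (shiftedModulus w B f)
  have hH : ∀ f, Measurable (Function.uncurry (H f)) := fun f =>
    measurable_symbolTransform hF (measurable_shiftedModulus (fun k => (hw k).continuous) B f)
  -- For identity permutations `permutedNorm` is `iteratedNorm` by definition, so `hnorm` applies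
  -- without rewriting.
  have hHnorm : ∀ f, eLpNorm (fun ω => eLpNorm (fun x => H f x ω) a volume) b volume ≤
      symbolNorm g r s (Equiv.refl _) (Equiv.refl _) v σ *
        ∏ k, modNorm (p k.succ) (q k.castSucc) (w k) (f k) := fun f =>
    hnorm F hF w (fun k => (hw k).continuous) B f
  have hHfin : ∀ f : (k : Fin m) → E k, eLpNorm (fun ω => eLpNorm
      (fun x => H (fun k => (f k : 𝓢'(Rd d, ℂ))) x ω) a volume) b volume < ∞ := fun f =>
    (hHnorm _).trans_lt (ENNReal.mul_lt_top hσ.2 (ENNReal.prod_lt_top fun k _ => (f k).2.2))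
  let I : (Fin m → 𝓢'(Rd d, ℂ)) → 𝓢(Rd d, ℂ) →
      (Fin (m + 1) → Rd d) × (Fin (m + 1) → Rd d) → ℂ :=
    fun f ψ x => θ x * symbolStft g σ x.1 x.2 * atomStft B₀ B f ψ x
  have hIenorm : ∀ f ψ, ∫⁻ x, ‖I f ψ x‖ₑ ≤ C₁ * ∫⁻ ω, ∫⁻ x,
      (‖stft (gaussian (Rd d)) (ψ : 𝓢'(Rd d, ℂ)) x (B₀ - ω)‖ₑ *
          ENNReal.ofReal (w₀ (x, ω))⁻¹) * H f x ω := by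
    intro f ψ
    refine le_trans (lintegral_mono fun x => ?_) (hC₁ (symbolStft g σ) hScont f ψ)
    simp only [I]
    rw [← ofReal_norm, ← ofReal_norm, mul_assoc, norm_mul, hθ1, one_mul]
  have hIle : ∀ f ψ, ∫⁻ x, ‖I f ψ x‖ₑ ≤ C₁ * (ENNReal.ofReal (C₃ * schwartzSup (Rd d) M ψ) *
      (C₄ * eLpNorm (fun ω => eLpNorm (fun x => H f x ω) a volume) b volume)) := by
    intro f ψ
    refine (hIenorm f ψ).trans (mul_le_mul_right ((?_ : _ ≤ _).trans
      (mul_le_mul_right (hC₄ (H f) (hH f)) _)) _)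
    rw [← lintegral_const_mul' _ _ ENNReal.ofReal_ne_top]
    refine lintegral_mono fun ω => ?_
    rw [← lintegral_const_mul' _ _ ENNReal.ofReal_ne_top]
    refine lintegral_mono fun x => ?_
    rw [← mul_assoc]
    exact mul_le_mul_left (hC₃ ψ x ω) _
  have hIint : ∀ (f : (k : Fin m) → E k) ψ, Integrable (I (fun k => (f k : 𝓢'(Rd d, ℂ))) ψ) := by
    intro f ψ
    refine ⟨((hθ.mul hScont).mul (continuous_atomStft B₀ B _ ψ)).aestronglyMeasurable, ?_⟩
    exact (hIle _ ψ).trans_lt (ENNReal.mul_lt_top ENNReal.coe_lt_top (ENNReal.mul_lt_top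
      ENNReal.ofReal_lt_top (ENNReal.mul_lt_top ENNReal.coe_lt_top (hHfin f))))
  -- The extension is defined by the integral formula itself; `hIle` gives both its convergence and
  -- its continuity in `ψ`.
  have hdist : ∀ f : (k : Fin m) → E k, ∃ T : 𝓢'(Rd d, ℂ), ∀ ψ,
      T ψ = c * ∫ x, I (fun k => (f k : 𝓢'(Rd d, ℂ))) ψ x := by
    intro f
    set h := eLpNorm (fun ω => eLpNorm
      (fun x => H (fun k => (f k : 𝓢'(Rd d, ℂ))) x ω) a volume) b volume
    refine exists_temperedDistribution _ (fun ψ₁ ψ₂ => ?_) (fun z ψ => ?_) (M := M)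
      (C := ‖c‖ * (C₁ * (C₃ * (C₄ * h.toReal)))) (by positivity) fun ψ => ?_
    · rw [← mul_add, ← integral_add (hIint f ψ₁) (hIint f ψ₂)]
      simp only [I, atomStft_add, mul_add]
    · simp only [I, atomStft_smul, mul_left_comm _ z]
      rw [integral_const_mul, mul_left_comm]
    · have hsup : 0 ≤ schwartzSup (Rd d) M ψ := apply_nonneg _ _
      have h1 : ‖∫ x, I (fun k => (f k : 𝓢'(Rd d, ℂ))) ψ x‖ ≤
          C₁ * (C₃ * schwartzSup (Rd d) M ψ * (C₄ * h.toReal)) := by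
        refine (norm_integral_le_lintegral_norm _).trans ?_
        simp only [ofReal_norm]
        refine ENNReal.toReal_le_of_le_ofReal (by positivity) ((hIle _ ψ).trans_eq ?_)
        rw [ENNReal.ofReal_mul (p := (C₁ : ℝ)) (by positivity),
          ENNReal.ofReal_mul (p := C₃ * schwartzSup (Rd d) M ψ) (by positivity),
          ENNReal.ofReal_mul (p := (C₄ : ℝ)) (by positivity), ENNReal.ofReal_coe_nnreal,
          ENNReal.ofReal_coe_nnreal, ENNReal.ofReal_toReal (hHfin f).ne]
      rw [norm_mul]
      calc _ ≤ ‖c‖ * (C₁ * (C₃ * schwartzSup (Rd d) M ψ * (C₄ * h.toReal))) := by gcongr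
        _ = _ := by ring
  choose T₀ hT₀ using hdist
  have hTnorm : ∀ f : (k : Fin m) → E k, modNorm (p 0) (q (Fin.last m)) w₀ (T₀ f) ≤
      (‖c‖₊ * C₁ * C₂ * κ.toNNReal : NNReal) *
        symbolNorm g r s (Equiv.refl _) (Equiv.refl _) v σ *
        ∏ k, modNorm (p k.succ) (q k.castSucc) (w k) (f k) := by
    intro f
    -- The transform of `T₀ f` at `(z, ζ)` is the value of `T₀ f` at `ψ = tfShift (gaussian (Rd d))
    -- z ζ`. The transform of this `ψ` concentrates near `z` in time and, after the reflection in
    -- `B₀ - ω`, near `ζ` in `ω`.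
    have hpt : ∀ z ζ, ‖weightedStft w₀ (T₀ f) (z, ζ)‖ₑ ≤ (‖c‖₊ * C₁ * C₂ : NNReal) *
        ∫⁻ ω, ∫⁻ x, H (fun k => (f k : 𝓢'(Rd d, ℂ))) x ω *
          decayKernel (z - x) * decayKernel (ζ - ω) := by
      intro z ζ
      have hw0 := (hw₀.pos (z, ζ)).le
      have h1 : ‖weightedStft w₀ (T₀ f) (z, ζ)‖ₑ ≤ ENNReal.ofReal (w₀ (z, ζ)) * (‖c‖₊ *
          (C₁ * ∫⁻ ω, ∫⁻ x, (‖stft (gaussian (Rd d))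
            (tfShift (gaussian (Rd d)) z ζ : 𝓢'(Rd d, ℂ)) x (B₀ - ω)‖ₑ *
            ENNReal.ofReal (w₀ (x, ω))⁻¹) * H (fun k => (f k : 𝓢'(Rd d, ℂ))) x ω)) := by
        rw [weightedStft, enorm_mul, stft, hT₀, enorm_mul, ← ofReal_norm (w₀ (z, ζ) : ℂ),
          Complex.norm_real, Real.norm_of_nonneg hw0]
        refine mul_le_mul_right (mul_le_mul_right ?_ _) _
        exact (enorm_integral_le_lintegral_enorm _).trans (hIenorm _ _)
      refine h1.trans ?_
      rw [mul_left_comm, mul_left_comm (ENNReal.ofReal _), ← mul_assoc, ENNReal.coe_mul,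
        ENNReal.coe_mul, mul_assoc _ (C₂ : ℝ≥0∞)]
      refine mul_le_mul_right ?_ _
      rw [← lintegral_const_mul' _ _ ENNReal.ofReal_ne_top,
        ← lintegral_const_mul' _ _ ENNReal.coe_ne_top]
      refine lintegral_mono fun ω => ?_
      rw [← lintegral_const_mul' _ _ ENNReal.ofReal_ne_top,
        ← lintegral_const_mul' _ _ ENNReal.coe_ne_top]
      refine lintegral_mono fun x => ?_
      rw [← mul_assoc]
      refine (mul_le_mul_left (hC₂ z ζ x ω) _).trans_eq ?_
      ring
    refine (modNorm_le_of_le_conv (hp 0) ha hb he₁ he₂ hae hbe (hH _) hpt).trans ?_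
    rw [← hκ, ENNReal.coe_mul _ κ.toNNReal, ENNReal.coe_toNNReal hκ']
    refine (mul_le_mul_right (mul_le_mul_left (hHnorm _) κ) _).trans_eq ?_
    ring
  let T : MultilinearMap ℂ (fun k : Fin m => E k) (modulationSpace (p 0) (q (Fin.last m)) w₀) :=
    { toFun := fun f => ⟨T₀ f, (continuous_weightedStft hw₀.continuous _).measurable,
        (hTnorm f).trans_lt (ENNReal.mul_lt_top (ENNReal.mul_lt_top ENNReal.coe_lt_top hσ.2)
          (ENNReal.prod_lt_top fun k _ => (f k).2.2))⟩
      map_update_add' := fun f i x y => by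
        refine Subtype.ext (DFunLike.ext _ _ fun ψ => ?_)
        change T₀ _ ψ = T₀ _ ψ + T₀ _ ψ
        rw [hT₀, hT₀, hT₀, ← mul_add, ← integral_add (hIint _ ψ) (hIint _ ψ)]
        simp only [I, ← atomMultilinear_apply E, MultilinearMap.map_update_add, mul_add]
      map_update_smul' := fun f i z x => by
        refine Subtype.ext (DFunLike.ext _ _ fun ψ => ?_)
        change T₀ _ ψ = z * T₀ _ ψ
        rw [hT₀, hT₀]
        simp only [I, ← atomMultilinear_apply E, MultilinearMap.map_update_smul, smul_eq_mul,
          mul_left_comm _ z]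
        rw [integral_const_mul, mul_left_comm] }
  refine ⟨T, fun f => DFunLike.ext _ _ fun ψ => ?_, hTnorm⟩
  -- On Schwartz functions the defining formula of `T₀` is the pairing identity, so the agreement
  -- with `pseudoDiffOp` is immediate.
  rw [pseudoDiffOp_apply, hpair]
  exact hT₀ _ ψ
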